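/- **Conventions.** Complex spaces are reduced, Hausdorff and have a countable topology; a function on such a space is *smooth* (resp. *smooth and strongly psh*) if locally, in some local embedding as an analytic subset of an open set $D\subset\mathbb C^N$, it is the restriction of a smooth function (resp. of a smooth function with positive definite Levi form). A *Kähler metric* on $X$ is a class of families $(U_\alpha,\varphi_\alpha)$, where $(U_\alpha)$ is an open cover of $X$, $\varphi_\alpha:U_\alpha\to\mathbb R$ is smooth and strongly psh, and $i\partial\bar\partial(\varphi_\alpha-\varphi_\beta)=0$ on $U_\alpha\cap U_\beta\cap X_{\rm reg}$. An *lcK metric* is a class of families $(U_\alpha,\varphi_\alpha,f_\alpha)$ with $\varphi_\alpha$ smooth and strongly psh, $f_\alpha:U_\alpha\to\mathbb R$ smooth, $e^{f_\alpha}i\partial\bar\partial\varphi_\alpha=e^{f_\beta}i\partial\bar\partial\varphi_\beta$ on $U_\alpha\cap U_\beta\cap X_{\rm reg}$, and $f_\alpha-f_\beta$ locally constant on $U_\alpha\cap U_\beta$ (the last condition is automatic in pure dimension at least $2$). In both cases two families are equivalent if their union is again such a family. The $f_\alpha$ define the *Lee form* $\theta$, a topologically closed $1$-form; the metric is *gcK*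 if $\theta$ is exact, i.e. if there is a continuous $f:X\to\mathbb C$ with all $f-f_\alpha$ locally constant. A complex space is *locally irreducible* if all its local rings are integral domains. **Statement.** Let $v\neq w$ be two points of $\mathbb P^n=\mathbb P^n(\mathbb C)$ (so $n\ge 1$), and let $X=\mathbb P^n/(v\sim w)$ with the quotient topology and the quotient structure sheaf (functions whose pull-back to $\mathbb P^n$ is holomorphic). Then: 1. $X$ is a compact connected complex space of pure dimension $n$. 2. The only singular point of $X$ is $[v]$, and the germ $(X,[v])$ is biholomorphic to $(\{(z,t)\in\mathbb C^n\times\mathbb C^n : z=0\text{ or }t=0\},0)$. In particular $X$ is reducible at $[v]$, hence not locally irreducible. 3. $\pi_1(X)\cong\mathbb Z$. 4. Let $\widetilde X=(\mathbb P^n\times\mathbb Z)/\!\sim$, where $(w,k)\sim(v,k+1)$ for all $k\in\mathbb Z$, with the quotient structure. It is a simply connected complex space, and $p:\widetilde X\to X$, $[z,k]\mapsto[z]$, is a locally biholomorphic covering map. The deck transformations of $p$ are exactly the powers of $\gamma([z,k])=[z,k+1]$. 5. There are Kähler metrics $\widetilde\omega_1,\widetilde\omega_2$ on $\widetilde X$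 whose restrictions to the component $\widetilde X_k\cong\mathbb P^n$ (the image of $\mathbb P^n\times\{k\}$) are $\omega_{FS}$ and $2^k\omega_{FS}$ respectively, for every $k\in\mathbb Z$, where $\omega_{FS}$ is the Fubini–Study form. The metric $\widetilde\omega_1$ is the pull-back of a Kähler metric on $X$; in particular $X$ admits a Kähler metric. The metric $\widetilde\omega_2$ induces an lcK metric $\omega$ on $X$ (i.e. there is a smooth function $F:\widetilde X\to\mathbb R$ with $p^*\omega=e^F\widetilde\omega_2$ and $p^*\theta=dF$ for the Lee form $\theta$ of $\omega$) which is not gcK. 6. Consequently the hypothesis of local irreducibility cannot be dropped in the theorem "on a compact, locally irreducible complex space that admits a Kähler metric, every lcK metric is gcK": its conclusion fails for some compact connected complex space of pure dimension $n$ that admits a Kähler metric. -/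

import Mathlib

open Set Filter Topology TopologicalSpace


noncomputable section

namespace LcKSpace

/-! ### Sheaves of complex valued functions and reduced complex spaces -/

/-- A sheaf of germs of `ℂ`-valued functions on `X`: it is recorded which functions are sections
at (equivalently, in a neighbourhood of) a point. The sections over an open set `U` are the
functions on `U` which are sections at every point of `U`. -/
structure FunctionSheaf (X : Type*) [TopologicalSpace X] where
  holAt : X → (X → ℂ) → Prop
  congr : ∀ {x : X} {f g : X → ℂ}, f =ᶠ[𝓝 x] g → holAt x f → holAt x g
  eventually : ∀ {x : X} {f : X → ℂ}, holAt x f → ∀ᶠ y in 𝓝 x, holAt y f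

/-- The holomorphic functions on a complex normed space. -/
def affineSheaf (E : Type*) [NormedAddCommGroup E] [NormedSpace ℂ E] [CompleteSpace E] :
    FunctionSheaf E where
  holAt x f := AnalyticAt ℂ f x
  congr h hf := hf.congr h
  eventually hf := hf.eventually_analyticAt

/-- The holomorphic functions on a subset `A`, i.e. the functions which are locally restrictions
of holomorphic functions of the ambient space. -/
def subSheaf {E : Type*} [NormedAddCommGroup E] [NormedSpace ℂ E] [CompleteSpace E]
    (A : Set E) : FunctionSheaf A where
  holAt x f := ∃ g : E → ℂ, AnalyticAt ℂ g x ∧ ∀ᶠ y : A in 𝓝 x, f y = g y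
  congr := by
    rintro x f f' h ⟨g, hg, hfg⟩
    exact ⟨g, hg, by filter_upwards [h, hfg] with y h1 h2 using h1 ▸ h2⟩
  eventually := by
    rintro x f ⟨g, hg, hfg⟩
    filter_upwards [continuous_subtype_val.continuousAt.eventually hg.eventually_analyticAt,
      hfg.eventually_nhds] with y h1 h2 using ⟨g, h1, h2⟩

/-- The direct image sheaf of a continuous map `q : Y → X`, as a sheaf of functions: `f` is a
section over `U` if and only if `f ∘ q` is a section over `q⁻¹ U`. For a surjective `q` this is
the quotient structure. -/
def quotientSheaf {X Y : Type*} [TopologicalSpace X] [TopologicalSpace Y] (O : FunctionSheaf Y)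
    (q : Y → X) (hq : Continuous q) : FunctionSheaf X where
  holAt x f := ∃ U : Set X, IsOpen U ∧ x ∈ U ∧ ∀ y, q y ∈ U → O.holAt y (f ∘ q)
  congr := by
    rintro x f g h ⟨U, hU, hx, H⟩
    obtain ⟨V, hV, hVo, hxV⟩ := eventually_nhds_iff.1 h
    refine ⟨U ∩ V, hU.inter hVo, ⟨hx, hxV⟩, fun y hy => O.congr ?_ (H y hy.1)⟩
    filter_upwards [(hVo.preimage hq).mem_nhds hy.2] with z hz using hV _ hz
  eventually := by
    rintro x f ⟨U, hU, hx, H⟩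
    filter_upwards [hU.mem_nhds hx] with y hy using ⟨U, hU, hy, H⟩

/-- The disjoint union of copies of `Y`, indexed by `ℤ`. -/
def copiesSheaf {Y : Type*} [TopologicalSpace Y] (O : FunctionSheaf Y) :
    FunctionSheaf (Y × ℤ) where
  holAt a f := O.holAt a.1 (fun y => f (y, a.2))
  congr := by
    rintro ⟨y, k⟩ f g h hf
    exact O.congr ((Continuous.prodMk_left k).continuousAt.eventually h) hf
  eventually := by
    rintro ⟨y, k⟩ f hf
    have h2 : ∀ᶠ j : ℤ in 𝓝 k, j = k := by simp
    rw [nhds_prod_eq]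
    filter_upwards [(O.eventually hf).prod_mk h2] with a ha
    obtain ⟨h1, h2⟩ := ha
    rw [h2]
    exact h1

section Spaces

variable {X Y : Type*} [TopologicalSpace X] [TopologicalSpace Y]

/-- A homeomorphism between open subsets is biholomorphic if it identifies the two sheaves. -/
def IsBihol (O : FunctionSheaf X) (O' : FunctionSheaf Y) (e : OpenPartialHomeomorph X Y) : Prop :=
  ∀ x ∈ e.source, ∀ f : Y → ℂ, O.holAt x (f ∘ e) ↔ O'.holAt (e x) f

/-- The germs `(X, x)` and `(Y, y)` are biholomorphic. -/
def GermIso (O : FunctionSheaf X) (x : X) (O' : FunctionSheaf Y) (y : Y) : Prop :=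
  ∃ e : OpenPartialHomeomorph X Y, x ∈ e.source ∧ e x = y ∧ IsBihol O O' e

/-- `p` is locally biholomorphic. -/
def IsLocalBihol (O : FunctionSheaf X) (O' : FunctionSheaf Y) (p : X → Y) : Prop :=
  ∀ x, ∃ e : OpenPartialHomeomorph X Y, x ∈ e.source ∧ EqOn e p e.source ∧ IsBihol O O' e

/-- `A` is an analytic subset of the open set `D ⊆ ℂ^N`: near every point of `D` it is the common
zero set of finitely many holomorphic functions. -/
def IsAnalyticSubset {N : ℕ} (D A : Set (Fin N → ℂ)) : Prop :=
  IsOpen D ∧ A ⊆ D ∧ ∀ p ∈ D, ∃ V : Set (Fin N → ℂ), IsOpen V ∧ p ∈ V ∧ V ⊆ D ∧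
    ∃ (m : ℕ) (g : Fin m → (Fin N → ℂ) → ℂ), (∀ i, ∀ z ∈ V, AnalyticAt ℂ (g i) z) ∧
      ∀ z ∈ V, z ∈ A ↔ ∀ i, g i z = 0

/-- A local embedding near `x`: a biholomorphic map from an open neighbourhood of `x` onto (an
open piece of) an analytic subset `A` of an open set `D ⊆ ℂ^N`. -/
structure LocalEmbedding (O : FunctionSheaf X) (x : X) where
  N : ℕ
  D : Set (Fin N → ℂ)
  A : Set (Fin N → ℂ)
  analytic : IsAnalyticSubset D A
  e : OpenPartialHomeomorph X A
  mem_source : x ∈ e.source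
  bihol : IsBihol O (subSheaf A) e

/-- Reduced complex spaces: Hausdorff spaces with countable topology and a sheaf of functions,
locally isomorphic to analytic subsets of open subsets of some `ℂ^N`. -/
structure IsComplexSpace (O : FunctionSheaf X) : Prop where
  t2 : T2Space X
  secondCountable : SecondCountableTopology X
  locallyEmbeddable : ∀ x, Nonempty (LocalEmbedding O x)

/-- A regular chart: a biholomorphic map between an open subset of `X` and an open subset of
`ℂ^k`. -/
structure RegularChart (O : FunctionSheaf X) (x : X) (k : ℕ) where
  e : OpenPartialHomeomorph X (Fin k → ℂ)
  mem_source : x ∈ e.source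
  bihol : IsBihol O (affineSheaf (Fin k → ℂ)) e

/-- `x ∈ X_reg`. -/
def IsRegularPt (O : FunctionSheaf X) (x : X) : Prop := ∃ k, Nonempty (RegularChart O x k)

/-- `X` has pure dimension `n`, i.e. `X_reg` has dimension `n` at each of its points. -/
def HasPureDim (O : FunctionSheaf X) (n : ℕ) : Prop :=
  ∀ x k, Nonempty (RegularChart O x k) → k = n

/-- `X` is irreducible at `x`: the ring of germs of holomorphic functions at `x` has no zero
divisors. -/
def IsIrreducibleAt (O : FunctionSheaf X) (x : X) : Prop :=
  ∀ f g : X → ℂ, O.holAt x f → O.holAt x g → (∀ᶠ y in 𝓝 x, f y * g y = 0) →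
    (∀ᶠ y in 𝓝 x, f y = 0) ∨ ∀ᶠ y in 𝓝 x, g y = 0

def IsLocallyIrreducible (O : FunctionSheaf X) : Prop := ∀ x, IsIrreducibleAt O x

end Spaces

/-! ### The form `i∂∂̄u`, smooth and strongly plurisubharmonic functions -/

/-- The real `(1,1)`-form `i∂∂̄u` on `ℂ^k` at the point `z`, evaluated on the tangent vectors `ξ`
and `η`; for `k = 1` and `u = |z|²` it is `2 dx ∧ dy`. -/
def ddbar {k : ℕ} (u : (Fin k → ℂ) → ℝ) (z ξ η : Fin k → ℂ) : ℝ :=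
  (fderiv ℝ (fderiv ℝ u) z η (Complex.I • ξ) - fderiv ℝ (fderiv ℝ u) z ξ (Complex.I • η)) / 2

section Functions

variable {X : Type*} [TopologicalSpace X]

/-- Near `x`, `φ` is the restriction of a smooth function under some local embedding. -/
def IsSmoothAt (O : FunctionSheaf X) (φ : X → ℝ) (x : X) : Prop :=
  ∃ (c : LocalEmbedding O x) (W : Set (Fin c.N → ℂ)) (F : (Fin c.N → ℂ) → ℝ),
    IsOpen W ∧ (c.e x : Fin c.N → ℂ) ∈ W ∧ ContDiffOn ℝ (⊤ : ℕ∞) F W ∧ ∀ᶠ y in 𝓝 x, φ y = F (c.e y)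

/-- Near `x`, `φ` is the restriction under some local embedding of a smooth function `F` which is
strongly plurisubharmonic, i.e. whose Levi form is positive definite. -/
def IsSmoothStronglyPshAt (O : FunctionSheaf X) (φ : X → ℝ) (x : X) : Prop :=
  ∃ (c : LocalEmbedding O x) (W : Set (Fin c.N → ℂ)) (F : (Fin c.N → ℂ) → ℝ),
    IsOpen W ∧ (c.e x : Fin c.N → ℂ) ∈ W ∧ ContDiffOn ℝ (⊤ : ℕ∞) F W ∧
    (∀ z ∈ W, ∀ ξ, ξ ≠ 0 → 0 < ddbar F z ξ (Complex.I • ξ)) ∧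
    ∀ᶠ y in 𝓝 x, φ y = F (c.e y)

/-- The identity `a · i∂∂̄φ = b · i∂∂̄ψ` at the point `x`, computed in regular charts. At singular
points it says nothing. -/
def DdbarEqAt (O : FunctionSheaf X) (x : X) (a : ℝ) (φ : X → ℝ) (b : ℝ) (ψ : X → ℝ) : Prop :=
  ∀ (k : ℕ) (c : RegularChart O x k) (ξ η : Fin k → ℂ),
    a * ddbar (φ ∘ c.e.symm) (c.e x) ξ η = b * ddbar (ψ ∘ c.e.symm) (c.e x) ξ η

/-- `f - g` is locally constant on `U`. -/
def LocConstDiffOn {R : Type*} [Sub R] (U : Set X) (f g : X → R) : Prop :=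
  ∀ x ∈ U, ∀ᶠ y in 𝓝 x, f y - g y = f x - g x

theorem IsSmoothAt.continuousAt {O : FunctionSheaf X} {φ : X → ℝ} {x : X}
    (h : IsSmoothAt O φ x) : ContinuousAt φ x := by
  obtain ⟨c, W, F, hW, hx, hF, heq⟩ := h
  have h1 : ContinuousAt (fun y => F (c.e y)) x := by
    have h2 : ContinuousAt F (c.e x : Fin c.N → ℂ) := hF.continuousOn.continuousAt (hW.mem_nhds hx)
    have h3 : ContinuousAt (fun y => (c.e y : Fin c.N → ℂ)) x :=
      continuous_subtype_val.continuousAt.comp (c.e.continuousAt c.mem_source)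
    exact ContinuousAt.comp (f := fun y => (c.e y : Fin c.N → ℂ)) h2 h3
  exact h1.congr (heq.mono fun _ h => h.symm)

end Functions

/-! ### Topologically closed 1-forms

Families indexed by a covering are written as sets of pairs or triples `(U, φ)`, `(U, φ, f)`; the
functions are total and only their restrictions to `U` matter. -/

section OneForms

variable (X : Type*) [TopologicalSpace X]

/-- The families `(U_α, f_α)` with `U_α` an open covering, `f_α : U_α → ℂ` continuous and
`f_α - f_β` locally constant on `U_α ∩ U_β`. -/
structure IsZ1Family (S : Set (Opens X × (X → ℂ))) : Prop where
  cover : ∀ x, ∃ a ∈ S, x ∈ a.1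
  continuous : ∀ a ∈ S, ContinuousOn a.2 a.1
  compat : ∀ a ∈ S, ∀ b ∈ S, LocConstDiffOn ((a.1 : Set X) ∩ b.1) a.2 b.2

/-- Two families are equivalent if their union is again such a family. -/
instance z1Setoid : Setoid {S : Set (Opens X × (X → ℂ)) // IsZ1Family X S} where
  r S T := IsZ1Family X (S.1 ∪ T.1)
  iseqv := by
    refine ⟨fun S => by simpa using S.2, fun h => by simpa [union_comm] using h, ?_⟩
    intro S T R h1 h2
    have key : ∀ a ∈ S.1, ∀ b ∈ R.1, LocConstDiffOn ((a.1 : Set X) ∩ b.1) a.2 b.2 := by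
      intro a ha b hb x hx
      obtain ⟨c, hc, hxc⟩ := T.2.cover x
      filter_upwards [h1.compat a (Or.inl ha) c (Or.inr hc) x ⟨hx.1, hxc⟩,
        h2.compat c (Or.inl hc) b (Or.inr hb) x ⟨hxc, hx.2⟩] with y e1 e2
      linear_combination e1 + e2
    refine ⟨fun x => ?_, ?_, ?_⟩
    · obtain ⟨a, ha, hx⟩ := S.2.cover x
      exact ⟨a, Or.inl ha, hx⟩
    · rintro a (ha | ha)
      exacts [S.2.continuous a ha, R.2.continuous a ha]
    · rintro a (ha | ha) b (hb | hb)
      · exact S.2.compat a ha b hb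
      · exact key a ha b hb
      · intro x hx
        filter_upwards [key b hb a ha x ⟨hx.2, hx.1⟩] with y e
        linear_combination -e
      · exact R.2.compat a ha b hb

/-- The space `Z¹(X)` of topologically closed 1-forms. -/
def ClosedOneForm : Type _ := Quotient (z1Setoid X)

variable {X}

/-- The exact form `df` of a continuous function `f : X → ℂ`. -/
def ClosedOneForm.d (f : X → ℂ) (hf : Continuous f) : ClosedOneForm X :=
  Quotient.mk (z1Setoid X) ⟨{(⊤, f)}, by
    refine ⟨fun x => ⟨_, rfl, trivial⟩, ?_, ?_⟩
    · rintro a rfl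
      exact hf.continuousOn
    · rintro a rfl b rfl x _
      simp⟩

def ClosedOneForm.IsExact (θ : ClosedOneForm X) : Prop :=
  ∃ (f : X → ℂ) (hf : Continuous f), θ = ClosedOneForm.d f hf

end OneForms

/-! ### Kähler and lcK metrics -/

section Metrics

variable {X : Type*} [TopologicalSpace X] (O : FunctionSheaf X)

/-- The families `(U_α, φ_α)` with `U_α` an open covering, `φ_α` smooth and strongly psh on `U_α`
and `i∂∂̄(φ_α - φ_β) = 0` on `U_α ∩ U_β ∩ X_reg`. -/
structure IsKahlerFamily (S : Set (Opens X × (X → ℝ))) : Prop where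
  cover : ∀ x, ∃ a ∈ S, x ∈ a.1
  spsh : ∀ a ∈ S, ∀ x ∈ a.1, IsSmoothStronglyPshAt O a.2 x
  compat : ∀ a ∈ S, ∀ b ∈ S, ∀ x ∈ a.1, x ∈ b.1 → DdbarEqAt O x 1 a.2 1 b.2

instance kahlerSetoid : Setoid {S : Set (Opens X × (X → ℝ)) // IsKahlerFamily O S} where
  r S T := IsKahlerFamily O (S.1 ∪ T.1)
  iseqv := by
    refine ⟨fun S => by simpa using S.2, fun h => by simpa [union_comm] using h, ?_⟩
    intro S T R h1 h2
    have key : ∀ a ∈ S.1, ∀ b ∈ R.1, ∀ x ∈ a.1, x ∈ b.1 → DdbarEqAt O x 1 a.2 1 b.2 := by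
      intro a ha b hb x hx hx' k e ξ η
      obtain ⟨c, hc, hxc⟩ := T.2.cover x
      exact (h1.compat a (Or.inl ha) c (Or.inr hc) x hx hxc k e ξ η).trans
        (h2.compat c (Or.inl hc) b (Or.inr hb) x hxc hx' k e ξ η)
    refine ⟨fun x => ?_, ?_, ?_⟩
    · obtain ⟨a, ha, hx⟩ := S.2.cover x
      exact ⟨a, Or.inl ha, hx⟩
    · rintro a (ha | ha)
      exacts [S.2.spsh a ha, R.2.spsh a ha]
    · rintro a (ha | ha) b (hb | hb)
      · exact S.2.compat a ha b hb
      · exact key a ha b hb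
      · exact fun x hx hx' k e ξ η => (key b hb a ha x hx' hx k e ξ η).symm
      · exact R.2.compat a ha b hb

/-- The Kähler metrics (Kähler forms) on `X`. -/
def KahlerMetric : Type _ := Quotient (kahlerSetoid O)

/-- The families `(U_α, φ_α, f_α)` with `U_α` an open covering, `φ_α` smooth and strongly psh on
`U_α`, `f_α` smooth on `U_α`, and `e^{f_α} i∂∂̄φ_α = e^{f_β} i∂∂̄φ_β` on `U_α ∩ U_β ∩ X_reg`.
The last field says that the `f_α` define a topologically closed 1-form; it is automatic if all
regular points of `X` have dimension at least two. -/
structure IsLcKFamily (S : Set (Opens X × (X → ℝ) × (X → ℝ))) : Prop where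
  cover : ∀ x, ∃ a ∈ S, x ∈ a.1
  spsh : ∀ a ∈ S, ∀ x ∈ a.1, IsSmoothStronglyPshAt O a.2.1 x
  smooth : ∀ a ∈ S, ∀ x ∈ a.1, IsSmoothAt O a.2.2 x
  compat : ∀ a ∈ S, ∀ b ∈ S, ∀ x ∈ a.1, x ∈ b.1 →
    DdbarEqAt O x (Real.exp (a.2.2 x)) a.2.1 (Real.exp (b.2.2 x)) b.2.1
  closed : ∀ a ∈ S, ∀ b ∈ S, LocConstDiffOn ((a.1 : Set X) ∩ b.1) a.2.2 b.2.2

instance lcKSetoid :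
    Setoid {S : Set (Opens X × (X → ℝ) × (X → ℝ)) // IsLcKFamily O S} where
  r S T := IsLcKFamily O (S.1 ∪ T.1)
  iseqv := by
    refine ⟨fun S => by simpa using S.2, fun h => by simpa [union_comm] using h, ?_⟩
    intro S T R h1 h2
    have key : ∀ a ∈ S.1, ∀ b ∈ R.1, ∀ x ∈ a.1, x ∈ b.1 →
        DdbarEqAt O x (Real.exp (a.2.2 x)) a.2.1 (Real.exp (b.2.2 x)) b.2.1 := by
      intro a ha b hb x hx hx' k e ξ η
      obtain ⟨c, hc, hxc⟩ := T.2.cover x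
      exact (h1.compat a (Or.inl ha) c (Or.inr hc) x hx hxc k e ξ η).trans
        (h2.compat c (Or.inl hc) b (Or.inr hb) x hxc hx' k e ξ η)
    have key' : ∀ a ∈ S.1, ∀ b ∈ R.1,
        LocConstDiffOn ((a.1 : Set X) ∩ b.1) a.2.2 b.2.2 := by
      intro a ha b hb x hx
      obtain ⟨c, hc, hxc⟩ := T.2.cover x
      filter_upwards [h1.closed a (Or.inl ha) c (Or.inr hc) x ⟨hx.1, hxc⟩,
        h2.closed c (Or.inl hc) b (Or.inr hb) x ⟨hxc, hx.2⟩] with y e1 e2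
      linear_combination e1 + e2
    refine ⟨fun x => ?_, ?_, ?_, ?_, ?_⟩
    · obtain ⟨a, ha, hx⟩ := S.2.cover x
      exact ⟨a, Or.inl ha, hx⟩
    · rintro a (ha | ha)
      exacts [S.2.spsh a ha, R.2.spsh a ha]
    · rintro a (ha | ha)
      exacts [S.2.smooth a ha, R.2.smooth a ha]
    · rintro a (ha | ha) b (hb | hb)
      · exact S.2.compat a ha b hb
      · exact key a ha b hb
      · exact fun x hx hx' k e ξ η => (key b hb a ha x hx' hx k e ξ η).symm
      · exact R.2.compat a ha b hb
    · rintro a (ha | ha) b (hb | hb)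
      · exact S.2.closed a ha b hb
      · exact key' a ha b hb
      · intro x hx
        filter_upwards [key' b hb a ha x ⟨hx.2, hx.1⟩] with y e
        linear_combination -e
      · exact R.2.closed a ha b hb

/-- The lcK metrics (lcK forms) on `X`. -/
def LcKMetric : Type _ := Quotient (lcKSetoid O)

variable {O}

/-- The family `(U_α, f_α)` underlying `(U_α, φ_α, f_α)`. -/
def leeFamily (S : Set (Opens X × (X → ℝ) × (X → ℝ))) : Set (Opens X × (X → ℂ)) :=
  (fun a => (a.1, fun x => (a.2.2 x : ℂ))) '' S

theorem IsLcKFamily.isZ1Family {S : Set (Opens X × (X → ℝ) × (X → ℝ))}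
    (h : IsLcKFamily O S) : IsZ1Family X (leeFamily S) := by
  refine ⟨fun x => ?_, ?_, ?_⟩
  · obtain ⟨a, ha, hx⟩ := h.cover x
    exact ⟨_, ⟨a, ha, rfl⟩, hx⟩
  · rintro _ ⟨a, ha, rfl⟩ x hx
    exact (Complex.continuous_ofReal.continuousAt.comp
      (h.smooth a ha x hx).continuousAt).continuousWithinAt
  · rintro _ ⟨a, ha, rfl⟩ _ ⟨b, hb, rfl⟩ x hx
    filter_upwards [h.closed a ha b hb x hx] with y e
    exact_mod_cast congrArg (fun t : ℝ => (t : ℂ)) e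

/-- The Lee form of an lcK metric. -/
def LcKMetric.leeForm (ω : LcKMetric O) : ClosedOneForm X :=
  Quotient.map' (s₁ := lcKSetoid O) (s₂ := z1Setoid X)
    (fun S => ⟨leeFamily S.1, S.2.isZ1Family⟩)
    (fun S T h => by
      have h' : IsLcKFamily O (S.1 ∪ T.1) := h
      have := h'.isZ1Family
      rw [leeFamily, image_union] at this
      exact this) ω

/-- An lcK metric is globally conformally Kähler (gcK) if its Lee form is exact. -/
def LcKMetric.IsGcK (ω : LcKMetric O) : Prop := ω.leeForm.IsExact

/-- The family `S` represents the Kähler metric `ω`. -/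
def KahlerMetric.IsRep (ω : KahlerMetric O) (S : Set (Opens X × (X → ℝ))) : Prop :=
  ∃ h : IsKahlerFamily O S, ω = Quotient.mk (kahlerSetoid O) ⟨S, h⟩

/-- The family `S` represents the lcK metric `ω`. -/
def LcKMetric.IsRep (ω : LcKMetric O) (S : Set (Opens X × (X → ℝ) × (X → ℝ))) : Prop :=
  ∃ h : IsLcKFamily O S, ω = Quotient.mk (lcKSetoid O) ⟨S, h⟩

/-- The pull-back `(p⁻¹ U_α, φ_α ∘ p)` of a family `(U_α, φ_α)`. -/
def pullbackFamily {Y : Type*} [TopologicalSpace Y] (p : C(Y, X))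
    (S : Set (Opens X × (X → ℝ))) : Set (Opens Y × (Y → ℝ)) :=
  (fun a => (Opens.comap p a.1, a.2 ∘ p)) '' S

end Metrics

/-! ### Projective space -/

/-- Complex projective space of dimension `n`. -/
def CP (n : ℕ) : Type := Projectivization ℂ (Fin (n + 1) → ℂ)

/-- The projection `ℂ^{n+1} ∖ 0 → ℙ^n`. -/
def CP.mk {n : ℕ} (z : ({z | z ≠ 0} : Set (Fin (n + 1) → ℂ))) : CP n :=
  Projectivization.mk' ℂ z

/-- The quotient topology. -/
instance (n : ℕ) : TopologicalSpace (CP n) := TopologicalSpace.coinduced CP.mk inferInstance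

theorem CP.continuous_mk {n : ℕ} : Continuous (CP.mk (n := n)) := continuous_coinduced_rng

/-- A function on an open set of `ℙ^n` is holomorphic if and only if its pull-back to
`ℂ^{n+1} ∖ 0` is holomorphic. -/
def CP.sheaf (n : ℕ) : FunctionSheaf (CP n) :=
  quotientSheaf (subSheaf {z : Fin (n + 1) → ℂ | z ≠ 0}) CP.mk CP.continuous_mk

open Classical in
/-- The pull-back of a function from `ℙ^n` to `ℂ^{n+1} ∖ 0`, extended by zero. -/
def CP.lift {n : ℕ} (g : CP n → ℝ) (z : Fin (n + 1) → ℂ) : ℝ :=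
  if h : z ≠ 0 then g (CP.mk ⟨z, h⟩) else 0

/-- The identity `a · i∂∂̄g = b · ω_FS` at the point `[z]`, where `ω_FS` is the Fubini-Study form,
whose pull-back to `ℂ^{n+1} ∖ 0` is `i∂∂̄ log ‖z‖²`. -/
def CP.EqFSAt {n : ℕ} (z : ({z | z ≠ 0} : Set (Fin (n + 1) → ℂ))) (a : ℝ) (g : CP n → ℝ)
    (b : ℝ) : Prop :=
  ∀ ξ η : Fin (n + 1) → ℂ, a * ddbar (CP.lift g) z ξ η =
    b * ddbar (fun z' : Fin (n + 1) → ℂ => Real.log (∑ i, ‖z' i‖ ^ 2)) z ξ η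

/-! ### Projective space with two points identified, and its universal covering -/

variable {n : ℕ}

/-- `X = ℙ^n / (v ∼ w)`, with the quotient topology. -/
def GluedCP (v w : CP n) : Type := Quot (fun a b : CP n => a = v ∧ b = w)

instance (v w : CP n) : TopologicalSpace (GluedCP v w) :=
  inferInstanceAs (TopologicalSpace (Quot _))

/-- The projection `ℙ^n → X`. -/
def GluedCP.mk (v w : CP n) (z : CP n) : GluedCP v w := Quot.mk _ z

theorem GluedCP.continuous_mk (v w : CP n) : Continuous (GluedCP.mk v w) := continuous_quot_mk

/-- The quotient complex structure on `X`. -/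
def GluedCP.sheaf (v w : CP n) : FunctionSheaf (GluedCP v w) :=
  quotientSheaf (CP.sheaf n) (GluedCP.mk v w) (GluedCP.continuous_mk v w)

/-- The chain of projective spaces `X̃ = ℙ^n × ℤ / ∼`, where `(w, k) ∼ (v, k + 1)`. -/
def ChainCP (v w : CP n) : Type :=
  Quot (fun a b : CP n × ℤ => ∃ k : ℤ, a = (w, k) ∧ b = (v, k + 1))

instance (v w : CP n) : TopologicalSpace (ChainCP v w) :=
  inferInstanceAs (TopologicalSpace (Quot _))

/-- The projection `ℙ^n × ℤ → X̃`, `(z, k) ↦ [z, k]`. -/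
def ChainCP.mk (v w : CP n) (a : CP n × ℤ) : ChainCP v w := Quot.mk _ a

theorem ChainCP.continuous_mk (v w : CP n) : Continuous (ChainCP.mk v w) := continuous_quot_mk

/-- The quotient complex structure on `X̃`. -/
def ChainCP.sheaf (v w : CP n) : FunctionSheaf (ChainCP v w) :=
  quotientSheaf (copiesSheaf (CP.sheaf n)) (ChainCP.mk v w) (ChainCP.continuous_mk v w)

/-- The map `X̃ → X`, `[z, k] ↦ [z]`. -/
def ChainCP.proj (v w : CP n) : C(ChainCP v w, GluedCP v w) where
  toFun := Quot.lift (fun a => GluedCP.mk v w a.1) (by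
    rintro _ _ ⟨k, rfl, rfl⟩
    exact (Quot.sound ⟨rfl, rfl⟩).symm)
  continuous_toFun := continuous_quot_lift _
    ((GluedCP.continuous_mk v w).comp continuous_fst)

/-- The shift `[z, k] ↦ [z, k + j]`. -/
def ChainCP.shiftFun (v w : CP n) (j : ℤ) : ChainCP v w → ChainCP v w :=
  Quot.lift (fun a => ChainCP.mk v w (a.1, a.2 + j)) (by
    rintro _ _ ⟨k, rfl, rfl⟩
    exact Quot.sound ⟨k + j, rfl, by simp [add_right_comm]⟩)

theorem ChainCP.continuous_shiftFun (v w : CP n) (j : ℤ) :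
    Continuous (ChainCP.shiftFun v w j) :=
  continuous_quot_lift _ ((ChainCP.continuous_mk v w).comp (by fun_prop))

/-- The deck transformation `γ[z, k] = [z, k + 1]`. -/
def ChainCP.shift (v w : CP n) : ChainCP v w ≃ₜ ChainCP v w where
  toFun := ChainCP.shiftFun v w 1
  invFun := ChainCP.shiftFun v w (-1)
  left_inv := by
    rintro ⟨z, k⟩
    simp [ChainCP.shiftFun, ChainCP.mk]
    rfl
  right_inv := by
    rintro ⟨z, k⟩
    simp [ChainCP.shiftFun, ChainCP.mk]
    rfl
  continuous_toFun := ChainCP.continuous_shiftFun v w 1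
  continuous_invFun := ChainCP.continuous_shiftFun v w (-1)

/-- The Kähler metric `ω` on `X̃` restricts to `c k • ω_FS` on the component `X̃_k`. -/
def ChainCP.RestrictsToFS {v w : CP n} (ω : KahlerMetric (ChainCP.sheaf v w)) (c : ℤ → ℝ) : Prop :=
  ∃ S, ω.IsRep S ∧ ∀ a ∈ S, ∀ (k : ℤ) (z : ({z | z ≠ 0} : Set (Fin (n + 1) → ℂ))),
    ChainCP.mk v w (CP.mk z, k) ∈ a.1 →
      CP.EqFSAt z 1 (fun y => a.2 (ChainCP.mk v w (y, k))) (c k)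

/-- The Kähler metric `ω` on `X` pulls back to the Kähler metric `ω'` on `X̃`. -/
def ChainCP.IsPullback {v w : CP n} (ω : KahlerMetric (GluedCP.sheaf v w))
    (ω' : KahlerMetric (ChainCP.sheaf v w)) : Prop :=
  ∃ S, ω.IsRep S ∧ ω'.IsRep (pullbackFamily (ChainCP.proj v w) S)

/-- The Kähler metric `ω'` on `X̃` induces the lcK metric `ω` on `X`: for some smooth function
`F : X̃ → ℝ`, the pull-back of `ω` to `X̃` is `e^F ω'` and that of its Lee form is `dF`. -/
def ChainCP.Induces {v w : CP n} (ω' : KahlerMetric (ChainCP.sheaf v w))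
    (ω : LcKMetric (GluedCP.sheaf v w)) : Prop :=
  ∃ (S : Set (Opens (GluedCP v w) × (GluedCP v w → ℝ) × (GluedCP v w → ℝ)))
    (T : Set (Opens (ChainCP v w) × (ChainCP v w → ℝ))) (F : ChainCP v w → ℝ),
    ω.IsRep S ∧ ω'.IsRep T ∧ (∀ x, IsSmoothAt (ChainCP.sheaf v w) F x) ∧
    (∀ a ∈ S, LocConstDiffOn (ChainCP.proj v w ⁻¹' a.1) F (a.2.2 ∘ ChainCP.proj v w)) ∧
    ∀ a ∈ S, ∀ b ∈ T, ∀ x ∈ b.1, ChainCP.proj v w x ∈ a.1 →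
      DdbarEqAt (ChainCP.sheaf v w) x (Real.exp (a.2.2 (ChainCP.proj v w x)))
        (a.2.1 ∘ ChainCP.proj v w) (Real.exp (F x)) b.2

/-- The union of two `n`-dimensional coordinate planes `{(z, t) ∈ ℂ^n × ℂ^n | z = 0 or t = 0}`. -/
def crossSet (n : ℕ) : Set ((Fin n → ℂ) × (Fin n → ℂ)) := {p | p.1 = 0 ∨ p.2 = 0}

/-- The origin of `crossSet n`. -/
def crossOrigin (n : ℕ) : crossSet n := ⟨0, Or.inl rfl⟩

/-- The assertion of the Vaisman theorem without the hypothesis of local irreducibility, for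
compact connected complex spaces of pure dimension `n`: if `Y` admits a Kähler metric, then every
lcK metric on `Y` is gcK. -/
def VaismanWithoutIrreducibility (n : ℕ) : Prop :=
  ∀ (Y : Type) [TopologicalSpace Y] (O : FunctionSheaf Y), IsComplexSpace O → CompactSpace Y →
    ConnectedSpace Y → HasPureDim O n → Nonempty (KahlerMetric O) → ∀ ω : LcKMetric O, ω.IsGcK

end LcKSpace

end

/-!
The chain `X̃` of projective spaces maps to `X = ℙ^n / (v ∼ w)`, and almost everything is proved
on `X̃` and then carried over to `X`, or conversely.

*Complex structure.* Both quotient maps are closed with finite fibres. Hence a function on the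
quotient is holomorphic near a point if and only if its pull-back is holomorphic at each point of
the fibre. Away from the nodes `[w, k] = [v, k + 1]`, affine coordinates on the components are
regular charts. Near a node, affine coordinates at `w` and at `v` combine to a chart with values
in the union of the two planes `z = 0` and `t = 0` (`ChainCP.nodeChart`). A function on this union
is holomorphic as soon as its two restrictions are, since it is then the restriction of `f(z, 0) +
f(0, t) - f(0, 0)`. The same decomposition shows that a function on `X̃` is smooth, or smooth and
strongly psh, if its restrictions to the components are
(`ChainCP.isSmoothStronglyPshAt_of_components`). A node is not a regular point, because the local
ring there has zero divisors.

*Covering.* Let `χ` be a smooth function on `ℙ^n` with `χ v = 0` and `χ w = 1`. The height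
function `[z, k] ↦ k + χ z` on `X̃` is continuous, and the generator of the action of `ℤ` by
shifts increases it by `1`. So this action is properly discontinuous and `X̃ → X` is its quotient
map (`ChainCP.isAddQuotientCoveringMap`). Simple connectivity of `ℙ^n` and of `X̃` is derived from
one criterion: it suffices to choose homotopy classes of paths from a base point to all points,
compatible with short paths (`simplyConnectedSpace_of_local`). On `ℙ^n` they run inside the affine
charts, on `X̃` they run through the components one after the other.

*Metrics.* Any positive weights `c k` give a Kähler metric on `X̃` which restricts to `c k • ω_FS`
on the `k`-th component (`ChainCP.potMetric`): its local potentials are all functions whose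
restrictions to the components are, up to constants, `c k` times the standard potentials of
`ω_FS`. They exist because potentials on the two branches at a node can be added up, and they are
compatible because at a node there is nothing to check. The weights `1` are invariant under the
shift, which gives the Kähler metric on `X`. For the weights `2 ^ k` the shift multiplies the
metric by `2`, so that `2 ^ (-height)` times the metric is invariant and defines an lcK metric on
`X`. If it were gcK, the function `-log 2 * height` would differ by a constant from a function
which is invariant under the shift, a contradiction (`GluedCP.exists_lcKMetric`).
-/

noncomputable section

namespace LcKSpace

/-! ### Calculus of the form `i∂∂̄u` -/

section Ddbar

variable {k m : ℕ} {u v : (Fin k → ℂ) → ℝ} {z : Fin k → ℂ}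

theorem differentiableAt_fderiv_of_contDiffAt (hu : ContDiffAt ℝ 2 u z) :
    DifferentiableAt ℝ (fderiv ℝ u) z :=
  (hu.fderiv_right (m := 1) (by norm_num)).differentiableAt (by norm_num)

theorem eventually_differentiableAt_of_contDiffAt (hu : ContDiffAt ℝ 2 u z) :
    ∀ᶠ x in 𝓝 z, DifferentiableAt ℝ u x :=
  (hu.eventually (by simp)).mono fun _ hx => hx.differentiableAt (by norm_num)

theorem fderiv_fderiv_apply (hu : DifferentiableAt ℝ (fderiv ℝ u) z) (a b : Fin k → ℂ) :
    fderiv ℝ (fderiv ℝ u) z a b = fderiv ℝ (fun x => fderiv ℝ u x b) z a := by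
  rw [fderiv_clm_apply hu (differentiableAt_const b)]
  simp

theorem ddbar_congr (h : u =ᶠ[𝓝 z] v) (ξ η : Fin k → ℂ) : ddbar u z ξ η = ddbar v z ξ η := by
  unfold ddbar
  rw [h.fderiv.fderiv_eq]

theorem ddbar_add (hu : ContDiffAt ℝ 2 u z) (hv : ContDiffAt ℝ 2 v z) (ξ η : Fin k → ℂ) :
    ddbar (fun x => u x + v x) z ξ η = ddbar u z ξ η + ddbar v z ξ η := by
  have h : fderiv ℝ (fun x => u x + v x) =ᶠ[𝓝 z] fun x => fderiv ℝ u x + fderiv ℝ v x := by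
    filter_upwards [eventually_differentiableAt_of_contDiffAt hu,
      eventually_differentiableAt_of_contDiffAt hv] with x h1 h2 using fderiv_fun_add h1 h2
  unfold ddbar
  rw [h.fderiv_eq, fderiv_fun_add (differentiableAt_fderiv_of_contDiffAt hu)
    (differentiableAt_fderiv_of_contDiffAt hv)]
  simp only [add_apply]
  ring

theorem ddbar_const_mul (hu : ContDiffAt ℝ 2 u z) (c : ℝ) (ξ η : Fin k → ℂ) :
    ddbar (fun x => c * u x) z ξ η = c * ddbar u z ξ η := by
  have h : fderiv ℝ (fun x => c * u x) =ᶠ[𝓝 z] fun x => c • fderiv ℝ u x := by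
    filter_upwards [eventually_differentiableAt_of_contDiffAt hu] with x h1
      using fderiv_const_mul h1 c
  unfold ddbar
  rw [h.fderiv_eq, fderiv_fun_const_smul (differentiableAt_fderiv_of_contDiffAt hu)]
  simp only [smul_apply, smul_eq_mul]
  ring

theorem ddbar_add_const (u : (Fin k → ℂ) → ℝ) (c : ℝ) (z ξ η : Fin k → ℂ) :
    ddbar (fun x => u x + c) z ξ η = ddbar u z ξ η := by
  have h : fderiv ℝ (fun x => u x + c) = fderiv ℝ u := by
    funext x
    exact fderiv_add_const c
  unfold ddbar
  rw [h]

/-- The form `i∂∂̄u` is natural with respect to `ℂ`-affine maps. -/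
theorem ddbar_comp_affine (L : (Fin m → ℂ) →L[ℂ] (Fin k → ℂ)) (c : Fin k → ℂ) {x : Fin m → ℂ}
    (hu : ContDiffAt ℝ 2 u (L x + c)) (ξ η : Fin m → ℂ) :
    ddbar (fun y => u (L y + c)) x ξ η = ddbar u (L x + c) (L ξ) (L η) := by
  have hA : ∀ y, HasFDerivAt (fun y => L y + c) (L.restrictScalars ℝ) y := fun y =>
    ((L.restrictScalars ℝ).hasFDerivAt).add_const c
  have hc : ContDiffAt ℝ 2 (fun y => u (L y + c)) x :=
    ContDiffAt.comp x hu (((L.restrictScalars ℝ).contDiff.add contDiff_const).contDiffAt)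
  have key : ∀ a b : Fin m → ℂ, fderiv ℝ (fderiv ℝ (fun y => u (L y + c))) x a b =
      fderiv ℝ (fderiv ℝ u) (L x + c) (L a) (L b) := by
    intro a b
    rw [fderiv_fderiv_apply (differentiableAt_fderiv_of_contDiffAt hc),
      fderiv_fderiv_apply (differentiableAt_fderiv_of_contDiffAt hu)]
    have h : (fun y => fderiv ℝ (fun y => u (L y + c)) y b) =ᶠ[𝓝 x]
        fun y => fderiv ℝ u (L y + c) (L b) := by
      filter_upwards [(hA x).continuousAt.eventually
        (eventually_differentiableAt_of_contDiffAt hu)] with y hy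
      have := (hy.hasFDerivAt.comp y (hA y)).fderiv
      have h2 : fderiv ℝ (fun y => u (L y + c)) y =
        (fderiv ℝ u (L y + c)).comp (L.restrictScalars ℝ) := this
      rw [h2]
      rfl
    rw [h.fderiv_eq]
    have h3 : DifferentiableAt ℝ (fun w => fderiv ℝ u w (L b)) (L x + c) :=
      (differentiableAt_fderiv_of_contDiffAt hu).clm_apply (differentiableAt_const _)
    have h4 := (h3.hasFDerivAt.comp x (hA x)).fderiv
    have h5 : fderiv ℝ (fun y => fderiv ℝ u (L y + c) (L b)) x =
      (fderiv ℝ (fun w => fderiv ℝ u w (L b)) (L x + c)).comp (L.restrictScalars ℝ) := h4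
    rw [h5]
    rfl
  unfold ddbar
  rw [key, key, L.map_smul, L.map_smul]

/-- Real parts of holomorphic functions are pluriharmonic. -/
theorem ddbar_re {H : (Fin k → ℂ) → ℂ} (hH : AnalyticAt ℂ H z) (ξ η : Fin k → ℂ) :
    ddbar (fun x => (H x).re) z ξ η = 0 := by
  have key : ∀ a b : Fin k → ℂ, fderiv ℝ (fderiv ℝ (fun x => (H x).re)) z a b =
      (fderiv ℂ (fderiv ℂ H) z a b).re := by
    intro a b
    have hre : ∀ {f : (Fin k → ℂ) → ℂ} {y : Fin k → ℂ}, DifferentiableAt ℂ f y →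
        ∀ b, fderiv ℝ (fun x => (f x).re) y b = (fderiv ℂ f y b).re := by
      intro f y hf b
      have h1 : HasFDerivAt f ((fderiv ℂ f y).restrictScalars ℝ) y :=
        hf.hasFDerivAt.restrictScalars ℝ
      have h2 : HasFDerivAt (fun x => (f x).re) (Complex.reCLM.comp
        ((fderiv ℂ f y).restrictScalars ℝ)) y := Complex.reCLM.hasFDerivAt.comp y h1
      rw [h2.fderiv]
      rfl
    have hc : ContDiffAt ℝ 2 (fun x => (H x).re) z :=
      Complex.reCLM.contDiff.contDiffAt.comp z (hH.contDiffAt.restrict_scalars ℝ)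
    have hd : DifferentiableAt ℂ (fderiv ℂ H) z := hH.fderiv.differentiableAt
    rw [fderiv_fderiv_apply (differentiableAt_fderiv_of_contDiffAt hc)]
    have h : (fun y => fderiv ℝ (fun x => (H x).re) y b) =ᶠ[𝓝 z]
        fun y => (fderiv ℂ H y b).re := by
      filter_upwards [hH.eventually_analyticAt] with y hy using hre hy.differentiableAt b
    rw [h.fderiv_eq, hre (hd.clm_apply (differentiableAt_const _)),
      fderiv_clm_apply hd (differentiableAt_const b)]
    simp
  have hs : IsSymmSndFDerivAt ℂ H z := (hH.contDiffAt (n := 2)).isSymmSndFDerivAt (by simp)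
  unfold ddbar
  rw [key, key, map_smul, map_smul, hs.eq η ξ]
  simp

/-- The function `log |h|²` is pluriharmonic where `h` is holomorphic without zeros. -/
theorem ddbar_log_normSq {h : (Fin k → ℂ) → ℂ} (hh : AnalyticAt ℂ h z) (h0 : h z ≠ 0)
    (ξ η : Fin k → ℂ) : ddbar (fun x => Real.log (‖h x‖ ^ 2)) z ξ η = 0 := by
  -- a branch of `2 log (h / h z)` exists near `z` because `h / h z` is close to `1`
  have hq : AnalyticAt ℂ (fun x => h x / h z) z := hh.div analyticAt_const h0
  have hs : h z / h z ∈ Complex.slitPlane := by rw [div_self h0]; simp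
  have hH : AnalyticAt ℂ (fun x => 2 * Complex.log (h x / h z)) z :=
    analyticAt_const.mul (hq.clog hs)
  have hev : (fun x => Real.log (‖h x‖ ^ 2)) =ᶠ[𝓝 z]
      fun x => (2 * Complex.log (h x / h z)).re + Real.log (‖h z‖ ^ 2) := by
    filter_upwards [hh.continuousAt.eventually_ne h0] with x hx
    have h1 : (2 * Complex.log (h x / h z)).re = 2 * Real.log ‖h x / h z‖ := by
      simp [Complex.log_re]
    rw [h1, norm_div, Real.log_div (norm_ne_zero_iff.2 hx) (norm_ne_zero_iff.2 h0),
      Real.log_pow, Real.log_pow]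
    push_cast
    ring
  rw [ddbar_congr hev, ddbar_add_const, ddbar_re hH]

/-- The potential `log (1 + |x|²)` of the Fubini-Study form in affine coordinates. -/
def fsPotential (k : ℕ) (x : Fin k → ℂ) : ℝ := Real.log (1 + ∑ i, ‖x i‖ ^ 2)

theorem one_add_sum_normSq_pos (x : Fin k → ℂ) : 0 < 1 + ∑ i, ‖x i‖ ^ 2 := by positivity

theorem contDiff_normSq_coord (i : Fin k) : ContDiff ℝ (⊤ : ℕ∞) fun x : Fin k → ℂ => ‖x i‖ ^ 2 :=
  ContDiff.norm_sq ℂ (contDiff_apply ℝ ℂ i)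

theorem contDiff_fsPotential (k : ℕ) : ContDiff ℝ (⊤ : ℕ∞) (fsPotential k) := by
  refine ContDiff.log ?_ fun x => (one_add_sum_normSq_pos x).ne'
  exact contDiff_const.add (ContDiff.sum fun i _ => contDiff_normSq_coord i)

/-- The real part of the standard Hermitian product, as a bilinear form. -/
def reHerm (k : ℕ) : (Fin k → ℂ) →L[ℝ] (Fin k → ℂ) →L[ℝ] ℝ :=
  ∑ i, (innerSL ℝ (E := ℂ)).bilinearComp (ContinuousLinearMap.proj i) (ContinuousLinearMap.proj i)

theorem reHerm_apply (x ξ : Fin k → ℂ) :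
    reHerm k x ξ = (∑ i, star (x i) * ξ i).re := by
  simp [reHerm, Complex.inner]
  exact Finset.sum_congr rfl fun i _ => by ring

theorem hasFDerivAt_sum_normSq (x : Fin k → ℂ) :
    HasFDerivAt (fun x : Fin k → ℂ => 1 + ∑ i, ‖x i‖ ^ 2) ((2 : ℝ) • reHerm k x) x := by
  have h : ∀ i ∈ (Finset.univ : Finset (Fin k)), HasFDerivAt (fun x : Fin k → ℂ => ‖x i‖ ^ 2)
      ((2 : ℝ) • (innerSL ℝ (x i)).comp
        (ContinuousLinearMap.proj (R := ℝ) (φ := fun _ : Fin k => ℂ) i)) x :=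
    fun i _ => by
      have := ((ContinuousLinearMap.proj (R := ℝ) (φ := fun _ : Fin k => ℂ) i).hasFDerivAt
        (x := x)).norm_sq
      simpa [two_smul] using this
  have h2 := (HasFDerivAt.fun_sum h).const_add 1
  convert! h2 using 1
  ext ξ
  simp [reHerm, Finset.mul_sum]

theorem fderiv_fsPotential (x : Fin k → ℂ) :
    fderiv ℝ (fsPotential k) x = (1 + ∑ i, ‖x i‖ ^ 2)⁻¹ • ((2 : ℝ) • reHerm k x) :=
  ((hasFDerivAt_sum_normSq x).log (one_add_sum_normSq_pos x).ne').fderiv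

theorem fderiv_fderiv_fsPotential (x a b : Fin k → ℂ) :
    fderiv ℝ (fderiv ℝ (fsPotential k)) x a b =
      2 * reHerm k a b / (1 + ∑ i, ‖x i‖ ^ 2) -
        4 * reHerm k x a * reHerm k x b / (1 + ∑ i, ‖x i‖ ^ 2) ^ 2 := by
  have hq := (one_add_sum_normSq_pos x).ne'
  rw [funext fderiv_fsPotential]
  have h1 : HasFDerivAt (fun x : Fin k → ℂ => (1 + ∑ i, ‖x i‖ ^ 2)⁻¹)
      (-((1 + ∑ i, ‖x i‖ ^ 2) ^ 2)⁻¹ • ((2 : ℝ) • reHerm k x)) x :=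
    (hasDerivAt_inv hq).comp_hasFDerivAt x (hasFDerivAt_sum_normSq x)
  have h2 : HasFDerivAt (fun x : Fin k → ℂ => (2 : ℝ) • reHerm k x) ((2 : ℝ) • reHerm k) x :=
    (reHerm k).hasFDerivAt.const_smul (2 : ℝ)
  rw [show fderiv ℝ (fun x : Fin k → ℂ => (1 + ∑ i, ‖x i‖ ^ 2)⁻¹ • (2 : ℝ) • reHerm k x) x = _ from
    (h1.smul h2).fderiv]
  simp
  field_simp
  ring

theorem ddbar_smul_I (u : (Fin k → ℂ) → ℝ) (z ξ : Fin k → ℂ) :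
    ddbar u z ξ (Complex.I • ξ) = (fderiv ℝ (fderiv ℝ u) z (Complex.I • ξ) (Complex.I • ξ) +
      fderiv ℝ (fderiv ℝ u) z ξ ξ) / 2 := by
  unfold ddbar
  rw [smul_smul, Complex.I_mul_I, neg_one_smul, map_neg, sub_neg_eq_add]

theorem sum_star_mul_self (ξ : Fin k → ℂ) :
    (∑ i, star (ξ i) * ξ i) = ((∑ i, ‖ξ i‖ ^ 2 : ℝ) : ℂ) := by
  push_cast
  refine Finset.sum_congr rfl fun i _ => ?_
  simpa using Complex.conj_mul' (ξ i)

/-- The function `log (1 + |x|²)` is strongly plurisubharmonic: by the Cauchy-Schwarz inequality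
its Levi form is at least `2 |ξ|² / (1 + |x|²)²`. -/
theorem ddbar_fsPotential_pos (x ξ : Fin k → ℂ) (hξ : ξ ≠ 0) :
    0 < ddbar (fsPotential k) x ξ (Complex.I • ξ) := by
  have hq := one_add_sum_normSq_pos x
  rw [ddbar_smul_I, fderiv_fderiv_fsPotential, fderiv_fderiv_fsPotential]
  set q := 1 + ∑ i, ‖x i‖ ^ 2 with hqdef
  set s : ℂ := ∑ i, star (x i) * ξ i with hs
  have hn : reHerm k ξ ξ = ∑ i, ‖ξ i‖ ^ 2 := by
    rw [reHerm_apply, sum_star_mul_self, Complex.ofReal_re]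
  have hnI : reHerm k (Complex.I • ξ) (Complex.I • ξ) = ∑ i, ‖ξ i‖ ^ 2 := by
    rw [reHerm_apply, sum_star_mul_self, Complex.ofReal_re]
    simp
  have h1 : reHerm k x ξ = s.re := reHerm_apply x ξ
  have h2 : reHerm k x (Complex.I • ξ) = -s.im := by
    rw [reHerm_apply]
    have : ∑ i, star (x i) * (Complex.I • ξ) i = Complex.I * s := by
      rw [hs, Finset.mul_sum]
      refine Finset.sum_congr rfl fun i _ => ?_
      simp
      ring
    rw [this]
    simp
  rw [hn, hnI, h1, h2]
  have hpos : 0 < ∑ i, ‖ξ i‖ ^ 2 := by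
    obtain ⟨i, hi⟩ := Function.ne_iff.1 hξ
    exact Finset.sum_pos' (fun _ _ => by positivity)
      ⟨i, Finset.mem_univ i, by have := norm_pos_iff.2 hi; positivity⟩
  have hcs : s.re ^ 2 + s.im ^ 2 ≤ (∑ i, ‖x i‖ ^ 2) * ∑ i, ‖ξ i‖ ^ 2 := by
    have e : s.re ^ 2 + s.im ^ 2 = ‖s‖ ^ 2 := by
      rw [← Complex.normSq_eq_norm_sq, Complex.normSq_apply]; ring
    have e2 : ‖s‖ ≤ ∑ i, ‖x i‖ * ‖ξ i‖ := by
      refine (norm_sum_le _ _).trans_eq ?_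
      simp
    rw [e]
    exact (pow_le_pow_left₀ (norm_nonneg _) e2 2).trans (Finset.sum_mul_sq_le_sq_mul_sq _ _ _)
  have hlt : s.re ^ 2 + s.im ^ 2 < q * ∑ i, ‖ξ i‖ ^ 2 := by
    rw [hqdef]; nlinarith
  have e : ((2 * ∑ i, ‖ξ i‖ ^ 2) / q - 4 * -s.im * -s.im / q ^ 2 +
      (2 * (∑ i, ‖ξ i‖ ^ 2) / q - 4 * s.re * s.re / q ^ 2)) / 2 =
      2 * (q * (∑ i, ‖ξ i‖ ^ 2) - (s.re ^ 2 + s.im ^ 2)) / q ^ 2 := by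
    field_simp
    ring
  rw [e]
  have : 0 < q * (∑ i, ‖ξ i‖ ^ 2) - (s.re ^ 2 + s.im ^ 2) := sub_pos.2 hlt
  positivity

end Ddbar

/-! ### Projective space: topology and affine charts -/

namespace CP

variable {n : ℕ}

theorem mk_surjective : Function.Surjective (CP.mk (n := n)) := fun y => by
  induction y using Projectivization.ind with
  | h z hz => exact ⟨⟨z, hz⟩, rfl⟩

theorem mk_eq_iff (a b : ({z | z ≠ 0} : Set (Fin (n + 1) → ℂ))) :
    CP.mk a = CP.mk b ↔ ∃ c : ℂˣ, c • (b : Fin (n + 1) → ℂ) = a :=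
  Projectivization.mk_eq_mk_iff ℂ _ _ a.2 b.2

theorem continuous_coord (i : Fin (n + 1)) :
    Continuous fun z : ({z | z ≠ 0} : Set (Fin (n + 1) → ℂ)) => z.1 i :=
  (continuous_apply i).comp continuous_subtype_val

theorem continuous_sum_normSq :
    Continuous fun z : ({z | z ≠ 0} : Set (Fin (n + 1) → ℂ)) => ∑ i, ‖z.1 i‖ ^ 2 :=
  continuous_finsetSum _ fun i _ => (continuous_coord i).norm.pow 2

theorem isOpenMap_mk : IsOpenMap (CP.mk (n := n)) := by
  intro U hU
  have hq : IsQuotientMap (CP.mk (n := n)) := ⟨⟨rfl⟩, mk_surjective⟩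
  rw [← hq.isOpen_preimage]
  have : CP.mk ⁻¹' (CP.mk '' U) = ⋃ c : ℂˣ, (fun z : ({z | z ≠ 0} : Set (Fin (n + 1) → ℂ)) =>
      (⟨c • (z : Fin (n + 1) → ℂ), (smul_ne_zero_iff_ne c).2 z.2⟩ :
        ({z | z ≠ 0} : Set (Fin (n + 1) → ℂ)))) ⁻¹' U := by
    ext z
    simp only [mem_preimage, mem_image, mem_iUnion]
    constructor
    · rintro ⟨u, hu, h⟩
      obtain ⟨c, hc⟩ := (mk_eq_iff _ _).1 h
      refine ⟨c, ?_⟩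
      convert hu
    · rintro ⟨c, hc⟩
      exact ⟨_, hc, (mk_eq_iff _ _).2 ⟨c, rfl⟩⟩
  rw [this]
  exact isOpen_iUnion fun c => hU.preimage
    ((continuous_subtype_val.const_smul c).subtype_mk _)

theorem isOpenQuotientMap_mk : IsOpenQuotientMap (CP.mk (n := n)) :=
  ⟨mk_surjective, continuous_mk, isOpenMap_mk⟩

/-- The point `[1 : … : 1]`. -/
def ones (n : ℕ) : CP n := CP.mk ⟨fun _ => 1, fun h => one_ne_zero (congrFun h 0)⟩

instance pathConnectedSpace : PathConnectedSpace (CP n) := by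
  have h1 : IsPathConnected ({z | z ≠ 0} : Set (Fin (n + 1) → ℂ)) := by
    refine isPathConnected_compl_singleton_of_one_lt_rank ?_ 0
    have : Module.rank ℝ (Fin (n + 1) → ℂ) = ((n + 1) * 2 : ℕ) := by
      rw [← Module.finrank_eq_rank, ← Module.finrank_mul_finrank ℝ ℂ (Fin (n + 1) → ℂ)]
      simp [mul_comm]
    rw [this]
    exact_mod_cast (by omega : 1 < (n + 1) * 2)
  have h2 : PathConnectedSpace ({z | z ≠ 0} : Set (Fin (n + 1) → ℂ)) :=
    isPathConnected_iff_pathConnectedSpace.1 h1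
  exact mk_surjective.pathConnectedSpace continuous_mk

instance compactSpace : CompactSpace (CP n) := by
  have h0 : ∀ z : Metric.sphere (0 : Fin (n + 1) → ℂ) 1, (z : Fin (n + 1) → ℂ) ≠ 0 := fun z h => by
    have := z.2
    simp [h] at this
  let f : Metric.sphere (0 : Fin (n + 1) → ℂ) 1 → CP n := fun z => CP.mk ⟨z, h0 z⟩
  have hf : Continuous f := continuous_mk.comp (continuous_subtype_val.subtype_mk _)
  have : CompactSpace (Metric.sphere (0 : Fin (n + 1) → ℂ) 1) :=
    isCompact_iff_compactSpace.1 (isCompact_sphere _ _)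
  refine ⟨?_⟩
  have hs : f '' univ = univ := by
    rw [image_univ, range_eq_univ]
    intro y
    obtain ⟨z, rfl⟩ := mk_surjective y
    have hz : ‖(z : Fin (n + 1) → ℂ)‖ ≠ 0 := norm_ne_zero_iff.2 z.2
    refine ⟨⟨(‖(z : Fin (n + 1) → ℂ)‖⁻¹ : ℂ) • (z : Fin (n + 1) → ℂ), ?_⟩, ?_⟩
    · simp [norm_smul, hz]
    · exact (mk_eq_iff _ _).2 ⟨Units.mk0 (‖(z : Fin (n + 1) → ℂ)‖⁻¹ : ℂ) (by simpa using hz), rfl⟩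
  rw [← hs]
  exact isCompact_univ.image hf

theorem sum_normSq_pos {z : Fin (n + 1) → ℂ} (hz : z ≠ 0) : 0 < ∑ i, ‖z i‖ ^ 2 := by
  obtain ⟨i, hi⟩ := Function.ne_iff.1 hz
  exact Finset.sum_pos' (fun _ _ => by positivity)
    ⟨i, Finset.mem_univ i, by have := norm_pos_iff.2 hi; positivity⟩

/-- The functions `z_i z̄_j / |z|²` separate the points of projective space. -/
instance t2Space : T2Space (CP n) := by
  let F : ({z | z ≠ 0} : Set (Fin (n + 1) → ℂ)) → Fin (n + 1) → Fin (n + 1) → ℂ := fun z i j =>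
    z.1 i * star (z.1 j) / ((∑ l, ‖z.1 l‖ ^ 2 : ℝ) : ℂ)
  have hF : Continuous F := by
    refine continuous_pi fun i => continuous_pi fun j => Continuous.div ?_ ?_ fun z => ?_
    · exact (continuous_coord i).mul (continuous_coord j).star
    · exact Complex.continuous_ofReal.comp continuous_sum_normSq
    · exact_mod_cast (sum_normSq_pos z.2).ne'
  have hinv : ∀ a b : ({z | z ≠ 0} : Set (Fin (n + 1) → ℂ)), CP.mk a = CP.mk b → F a = F b := by
    intro a b h
    obtain ⟨c, hc⟩ := (mk_eq_iff _ _).1 h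
    funext i j
    have hb : ((∑ l, ‖b.1 l‖ ^ 2 : ℝ) : ℂ) ≠ 0 := by exact_mod_cast (sum_normSq_pos b.2).ne'
    have ha : ((∑ l, ‖a.1 l‖ ^ 2 : ℝ) : ℂ) = (c : ℂ) * star (c : ℂ) *
        ((∑ l, ‖b.1 l‖ ^ 2 : ℝ) : ℂ) := by
      have hcc : (c : ℂ) * star (c : ℂ) = ((‖(c : ℂ)‖ ^ 2 : ℝ) : ℂ) := by
        simpa using Complex.mul_conj' (c : ℂ)
      rw [hcc, ← Complex.ofReal_mul, Finset.mul_sum, ← hc]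
      simp [Units.smul_def, mul_pow]
    have hc0 : (c : ℂ) * star (c : ℂ) ≠ 0 := mul_ne_zero c.ne_zero (star_ne_zero.2 c.ne_zero)
    change a.1 i * star (a.1 j) / _ = b.1 i * star (b.1 j) / _
    rw [ha, ← hc, div_eq_div_iff (mul_ne_zero hc0 hb) hb]
    simp only [Units.smul_def, Pi.smul_apply, smul_eq_mul, star_mul']
    ring
  let G : CP n → Fin (n + 1) → Fin (n + 1) → ℂ := fun y => F (Function.surjInv mk_surjective y)
  have hG : G ∘ CP.mk = F := funext fun z => hinv _ _ (Function.surjInv_eq mk_surjective _)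
  have hGc : Continuous G := isOpenQuotientMap_mk.continuous_comp_iff.1 (hG ▸ hF)
  refine T2Space.of_injective_continuous (f := G) (fun y y' h => ?_) hGc
  obtain ⟨a, rfl⟩ := mk_surjective y
  obtain ⟨b, rfl⟩ := mk_surjective y'
  have h : F a = F b := by rw [← hG]; exact h
  have hb : ((∑ l, ‖b.1 l‖ ^ 2 : ℝ) : ℂ) ≠ 0 := by exact_mod_cast (sum_normSq_pos b.2).ne'
  have ha : ((∑ l, ‖a.1 l‖ ^ 2 : ℝ) : ℂ) ≠ 0 := by exact_mod_cast (sum_normSq_pos a.2).ne'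
  obtain ⟨j, hj⟩ := Function.ne_iff.1 b.2
  have hj : b.1 j ≠ 0 := hj
  have hij : ∀ i, a.1 i * star (a.1 j) * ((∑ l, ‖b.1 l‖ ^ 2 : ℝ) : ℂ) =
      b.1 i * star (b.1 j) * ((∑ l, ‖a.1 l‖ ^ 2 : ℝ) : ℂ) := fun i => by
    have := congrFun (congrFun h i) j
    exact (div_eq_div_iff ha hb).1 this
  have haj : a.1 j ≠ 0 := by
    intro h0
    have := hij j
    rw [h0, zero_mul, zero_mul] at this
    exact mul_ne_zero (mul_ne_zero hj (star_ne_zero.2 hj)) ha this.symm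
  rw [mk_eq_iff]
  refine ⟨Units.mk0 (a.1 j / b.1 j) (div_ne_zero haj hj), ?_⟩
  funext i
  have e1 := hij i
  have e2 := hij j
  have hs := star_ne_zero.2 haj
  have key : a.1 i * b.1 j = b.1 i * a.1 j := by
    have : (a.1 i * b.1 j - b.1 i * a.1 j) * (star (a.1 j) * ((∑ l, ‖b.1 l‖ ^ 2 : ℝ) : ℂ)) = 0 := by
      linear_combination b.1 j * e1 - b.1 i * e2
    exact sub_eq_zero.1 ((mul_eq_zero.1 this).resolve_right (mul_ne_zero hs hb))
  simp only [Units.smul_def, Units.val_mk0, Pi.smul_apply, smul_eq_mul]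
  field_simp
  linear_combination -key

/-- The ratios `z_l / z_i` of homogeneous coordinates. -/
def ratio (i : Fin (n + 1)) : CP n → Fin (n + 1) → ℂ :=
  Projectivization.lift (fun z l => z.1 l / z.1 i) (by
    intro a b t h
    have ht : t ≠ 0 := by
      rintro rfl
      exact a.2 (by simpa using h)
    funext l
    simp only [h, Pi.smul_apply, smul_eq_mul]
    exact mul_div_mul_left _ _ ht)

@[simp]
theorem ratio_mk (i : Fin (n + 1)) (z : ({z | z ≠ 0} : Set (Fin (n + 1) → ℂ))) (l : Fin (n + 1)) :
    ratio i (CP.mk z) l = z.1 l / z.1 i := rfl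

/-- The domain `z_i ≠ 0` of the `i`-th affine chart. -/
def dom (i : Fin (n + 1)) : Set (CP n) := {y | ratio i y i ≠ 0}

@[simp]
theorem mk_mem_dom {i : Fin (n + 1)} {z : ({z | z ≠ 0} : Set (Fin (n + 1) → ℂ))} :
    CP.mk z ∈ dom i ↔ z.1 i ≠ 0 := by
  by_cases h : z.1 i = 0 <;> simp [dom, h]

theorem exists_mem_dom (y : CP n) : ∃ i, y ∈ dom i := by
  obtain ⟨z, rfl⟩ := mk_surjective y
  obtain ⟨i, hi⟩ := Function.ne_iff.1 z.2
  exact ⟨i, mk_mem_dom.2 hi⟩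

theorem ones_mem_dom (i : Fin (n + 1)) : ones n ∈ dom i := mk_mem_dom.2 one_ne_zero

theorem isOpen_dom (i : Fin (n + 1)) : IsOpen (dom (n := n) i) := by
  rw [← isOpenQuotientMap_mk.isQuotientMap.isOpen_preimage]
  have : CP.mk ⁻¹' dom (n := n) i = {z | z.1 i ≠ 0} := by
    ext z
    simp
  rw [this]
  exact isOpen_ne_fun (continuous_coord i) continuous_const

/-- The affine coordinates on `z_i ≠ 0`. -/
def affine (i : Fin (n + 1)) (y : CP n) : Fin n → ℂ := fun j => ratio i y (i.succAbove j)

theorem continuousAt_affine {i : Fin (n + 1)} {y : CP n} (hy : y ∈ dom i) :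
    ContinuousAt (affine i) y := by
  obtain ⟨z, rfl⟩ := mk_surjective y
  rw [← isOpenQuotientMap_mk.continuousAt_comp_iff]
  refine continuousAt_pi.2 fun j => ?_
  exact ContinuousAt.div (continuous_coord _).continuousAt (continuous_coord i).continuousAt
    (mk_mem_dom.1 hy)

/-- The point with the given affine coordinates. -/
def ofAffine (i : Fin (n + 1)) (x : Fin n → ℂ) : CP n :=
  CP.mk ⟨i.insertNth (α := fun _ => ℂ) 1 x, fun h => by simpa using congrFun h i⟩

theorem continuous_insertNth_one (i : Fin (n + 1)) :
    Continuous fun x : Fin n → ℂ => i.insertNth (α := fun _ => ℂ) 1 x := by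
  refine continuous_pi fun l => ?_
  obtain rfl | ⟨j, rfl⟩ := Fin.eq_self_or_eq_succAbove i l
  · simpa using continuous_const
  · simpa using continuous_apply j

theorem continuous_ofAffine (i : Fin (n + 1)) : Continuous (ofAffine (n := n) i) :=
  continuous_mk.comp ((continuous_insertNth_one i).subtype_mk _)

theorem ofAffine_mem_dom (i : Fin (n + 1)) (x : Fin n → ℂ) : ofAffine i x ∈ dom i := by
  simp [ofAffine]

@[simp]
theorem affine_ofAffine (i : Fin (n + 1)) (x : Fin n → ℂ) : affine i (ofAffine i x) = x := by
  funext j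
  simp [affine, ofAffine]

theorem ofAffine_affine {i : Fin (n + 1)} {y : CP n} (hy : y ∈ dom i) :
    ofAffine i (affine i y) = y := by
  obtain ⟨z, rfl⟩ := mk_surjective y
  rw [mk_mem_dom] at hy
  refine (mk_eq_iff _ _).2 ⟨Units.mk0 (z.1 i)⁻¹ (inv_ne_zero hy), ?_⟩
  funext l
  obtain rfl | ⟨j, rfl⟩ := Fin.eq_self_or_eq_succAbove i l
  · simp [Units.smul_def, hy]
  · simp [Units.smul_def, affine, div_eq_inv_mul]

/-- The `i`-th affine chart, with the point of affine coordinates `c` moved to the origin. -/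
def chart (i : Fin (n + 1)) (c : Fin n → ℂ) : OpenPartialHomeomorph (CP n) (Fin n → ℂ) where
  toFun y := affine i y - c
  invFun x := ofAffine i (x + c)
  source := dom i
  target := univ
  map_source' _ _ := trivial
  map_target' x _ := ofAffine_mem_dom i _
  left_inv' y hy := by rw [sub_add_cancel, ofAffine_affine hy]
  right_inv' x _ := by rw [affine_ofAffine, add_sub_cancel_right]
  open_source := isOpen_dom i
  open_target := isOpen_univ
  continuousOn_toFun _ hy := ((continuousAt_affine hy).sub continuousAt_const).continuousWithinAt
  continuousOn_invFun := ((continuous_ofAffine i).comp (by fun_prop)).continuousOn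

theorem analyticAt_insertNth_one (i : Fin (n + 1)) (c x : Fin n → ℂ) :
    AnalyticAt ℂ (fun x : Fin n → ℂ => i.insertNth (α := fun _ => ℂ) 1 (x + c)) x := by
  refine AnalyticAt.pi fun l => ?_
  obtain rfl | ⟨j, rfl⟩ := Fin.eq_self_or_eq_succAbove i l
  · simpa using analyticAt_const
  · simp only [Fin.insertNth_apply_succAbove, Pi.add_apply]
    exact ((ContinuousLinearMap.proj (R := ℂ) (φ := fun _ : Fin n => ℂ) j).analyticAt x).add
      analyticAt_const

/-- Holomorphic functions on projective space are those which are holomorphic in affine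
coordinates. -/
theorem holAt_iff_chart {i : Fin (n + 1)} (c : Fin n → ℂ) {y : CP n} (hy : y ∈ dom i)
    (f : CP n → ℂ) :
    (CP.sheaf n).holAt y f ↔ AnalyticAt ℂ (f ∘ (chart i c).symm) (chart i c y) := by
  constructor
  · rintro ⟨U, hU, hyU, H⟩
    have hy' : ofAffine i (chart i c y + c) = y := (chart i c).left_inv hy
    obtain ⟨g, hg, hfg⟩ := H ⟨i.insertNth (α := fun _ => ℂ) 1 (chart i c y + c),
      fun h => by simpa using congrFun h i⟩ (by change ofAffine i (chart i c y + c) ∈ U; rwa [hy'])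
    have h1 : AnalyticAt ℂ (fun x => g (i.insertNth (α := fun _ => ℂ) 1 (x + c))) (chart i c y) :=
      AnalyticAt.comp (g := g) (f := fun x : Fin n → ℂ =>
        i.insertNth (α := fun _ => ℂ) 1 (x + c)) hg (analyticAt_insertNth_one i c _)
    refine h1.congr ?_
    have hc : Continuous fun x : Fin n → ℂ => (⟨i.insertNth (α := fun _ => ℂ) 1 (x + c),
      fun h => by simpa using congrFun h i⟩ : ({z | z ≠ 0} : Set (Fin (n + 1) → ℂ))) :=
      ((continuous_insertNth_one i).comp (by fun_prop)).subtype_mk _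
    exact (hc.continuousAt.eventually hfg).mono fun x hx => hx.symm
  · intro h
    -- near points of the preimage of the domain, `f` is a function of the ratios `z_j / z_i`
    have hev := h.eventually_analyticAt
    obtain ⟨V, hV, hVo, hyV⟩ := eventually_nhds_iff.1 hev
    refine ⟨_, (chart i c).isOpen_inter_preimage hVo, ⟨hy, hyV⟩, ?_⟩
    rintro z ⟨hz, hzV⟩
    have hzi : z.1 i ≠ 0 := mk_mem_dom.1 hz
    have hz' : (fun j => z.1 (i.succAbove j) / z.1 i - c j) ∈ V := hzV
    have han : AnalyticAt ℂ (fun (z : Fin (n + 1) → ℂ) (j : Fin n) =>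
        z (i.succAbove j) / z i - c j) z.1 := by
      have hp : ∀ l, AnalyticAt ℂ (fun z : Fin (n + 1) → ℂ => z l) z.1 := fun l =>
        (ContinuousLinearMap.proj (R := ℂ) (φ := fun _ : Fin (n + 1) => ℂ) l).analyticAt _
      exact AnalyticAt.pi fun j => ((hp _).div (hp i) hzi).sub analyticAt_const
    refine ⟨_, (hV _ hz').fun_comp han, ?_⟩
    have hne : ∀ᶠ z' : ({z | z ≠ 0} : Set (Fin (n + 1) → ℂ)) in 𝓝 z, CP.mk z' ∈ dom i :=
      continuous_mk.continuousAt.eventually ((isOpen_dom i).mem_nhds hz)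
    filter_upwards [hne] with z' hz'
    exact congrArg f ((chart i c).left_inv hz').symm

theorem isBihol_chart (i : Fin (n + 1)) (c : Fin n → ℂ) :
    IsBihol (CP.sheaf n) (affineSheaf (Fin n → ℂ)) (chart i c) := by
  intro y hy f
  rw [holAt_iff_chart c hy]
  have : (f ∘ chart i c) ∘ (chart i c).symm = f :=
    funext fun x => congrArg f ((chart i c).right_inv (mem_univ x))
  rw [this]
  rfl

/-- The potential `log (|z|² / |z_i|²)` of the Fubini-Study form on `z_i ≠ 0`. -/
def pot (i : Fin (n + 1)) (y : CP n) : ℝ := fsPotential n (affine i y)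

theorem pot_mk {i : Fin (n + 1)} {z : ({z | z ≠ 0} : Set (Fin (n + 1) → ℂ))} (hz : z.1 i ≠ 0) :
    pot i (CP.mk z) = Real.log (∑ l, ‖z.1 l‖ ^ 2) - Real.log (‖z.1 i‖ ^ 2) := by
  have h1 : (∑ l, ‖z.1 l‖ ^ 2) = ‖z.1 i‖ ^ 2 * (1 + ∑ j, ‖affine i (CP.mk z) j‖ ^ 2) := by
    rw [Fin.sum_univ_succAbove _ i, mul_add, mul_one, Finset.mul_sum]
    congr 1
    refine Finset.sum_congr rfl fun j _ => ?_
    have := norm_ne_zero_iff.2 hz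
    simp only [affine, ratio_mk, norm_div]
    field_simp
  have h2 : ‖z.1 i‖ ^ 2 ≠ 0 := pow_ne_zero _ (norm_ne_zero_iff.2 hz)
  rw [h1, Real.log_mul h2 (one_add_sum_normSq_pos _).ne']
  unfold pot fsPotential
  ring

/-- The potentials of the Fubini-Study form differ by pluriharmonic functions. -/
theorem pot_eq_add {i j : Fin (n + 1)} {y : CP n} (hi : y ∈ dom i) (hj : y ∈ dom j) :
    pot j y = pot i y + Real.log (‖ratio j y i‖ ^ 2) := by
  obtain ⟨z, rfl⟩ := mk_surjective y
  rw [mk_mem_dom] at hi hj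
  rw [pot_mk hi, pot_mk hj, ratio_mk, norm_div, div_pow, Real.log_div]
  · ring
  · exact pow_ne_zero _ (norm_ne_zero_iff.2 hi)
  · exact pow_ne_zero _ (norm_ne_zero_iff.2 hj)

/-- Two different points are separated by a smooth function `|ℓ(z)|² / |z|²`. -/
theorem exists_smooth_separating {v w : CP n} (hvw : v ≠ w) :
    ∃ χ : CP n → ℝ, Continuous χ ∧ χ v = 0 ∧ χ w = 1 ∧
      ∀ i, ∃ G : (Fin n → ℂ) → ℝ, ContDiff ℝ (⊤ : ℕ∞) G ∧ ∀ y ∈ dom i, χ y = G (affine i y) := by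
  obtain ⟨a, rfl⟩ := mk_surjective v
  obtain ⟨b, rfl⟩ := mk_surjective w
  have hex : ∃ p q, a.1 p * b.1 q - a.1 q * b.1 p ≠ 0 := by
    by_contra! h
    obtain ⟨p, hp⟩ := Function.ne_iff.1 a.2
    have hp : a.1 p ≠ 0 := hp
    have hb : b.1 p ≠ 0 := by
      intro h0
      refine b.2 (funext fun q => ?_)
      have := h p q
      rw [h0, mul_zero, sub_zero] at this
      exact (mul_eq_zero.1 this).resolve_left hp
    refine hvw ((mk_eq_iff _ _).2
      ⟨Units.mk0 (a.1 p / b.1 p) (div_ne_zero hp hb), funext fun q => ?_⟩)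
    simp only [Units.smul_def, Units.val_mk0, Pi.smul_apply, smul_eq_mul]
    have := h p q
    field_simp
    linear_combination this
  obtain ⟨p, q, hpq⟩ := hex
  let l : (Fin (n + 1) → ℂ) → ℂ := fun z => a.1 p * z q - a.1 q * z p
  have hls : ∀ (c : ℂ) z, l (c • z) = c * l z := fun c z => by
    simp only [l, Pi.smul_apply, smul_eq_mul]; ring
  let C : ℝ := (∑ i, ‖b.1 i‖ ^ 2) / ‖l b.1‖ ^ 2
  have hlb : ‖l b.1‖ ^ 2 ≠ 0 := pow_ne_zero _ (norm_ne_zero_iff.2 hpq)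
  let f : (Fin (n + 1) → ℂ) → ℝ := fun z => C * ‖l z‖ ^ 2 / ∑ i, ‖z i‖ ^ 2
  have hfs : ∀ (c : ℂ) z, c ≠ 0 → f (c • z) = f z := fun c z hc => by
    have hc' : ‖c‖ ^ 2 ≠ 0 := pow_ne_zero _ (norm_ne_zero_iff.2 hc)
    simp only [f, hls, Pi.smul_apply, smul_eq_mul, norm_mul, mul_pow, ← Finset.mul_sum]
    rw [show C * (‖c‖ ^ 2 * ‖l z‖ ^ 2) = ‖c‖ ^ 2 * (C * ‖l z‖ ^ 2) by ring,
      mul_div_mul_left _ _ hc']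
  let χ : CP n → ℝ := Projectivization.lift (fun z => f z.1) (by
    intro a b t h
    have ht : t ≠ 0 := by
      rintro rfl
      exact a.2 (by simpa using h)
    change f a.1 = f b.1
    rw [h, hfs t _ ht])
  have hχ : ∀ z, χ (CP.mk z) = f z.1 := fun z => rfl
  refine ⟨χ, ?_, ?_, ?_, fun i => ⟨fun x => f (i.insertNth (α := fun _ => ℂ) 1 x), ?_, ?_⟩⟩
  · rw [← isOpenQuotientMap_mk.continuous_comp_iff]
    refine Continuous.div ?_ ?_ fun z => (sum_normSq_pos z.2).ne'
    · exact continuous_const.mul (((continuous_const.mul (continuous_coord q)).sub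
        (continuous_const.mul (continuous_coord p))).norm.pow 2)
    · exact continuous_sum_normSq
  · have : l a.1 = 0 := by simp only [l]; ring
    rw [hχ]
    simp [f, this]
  · rw [hχ]
    simp only [f, C]
    rw [div_mul_cancel₀ _ hlb, div_self (sum_normSq_pos b.2).ne']
  · have hins : ∀ m, ContDiff ℝ (⊤ : ℕ∞) fun x : Fin n → ℂ =>
        i.insertNth (α := fun _ => ℂ) 1 x m := fun m => by
      obtain rfl | ⟨j, rfl⟩ := Fin.eq_self_or_eq_succAbove i m
      · simpa using contDiff_const
      · simpa using contDiff_apply ℝ ℂ j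
    refine ContDiff.div (contDiff_const.mul (ContDiff.norm_sq ℂ ?_))
      (ContDiff.sum fun m _ => ContDiff.norm_sq ℂ (hins m)) fun x => ?_
    · exact (contDiff_const.mul (hins q)).sub (contDiff_const.mul (hins p))
    · exact (sum_normSq_pos fun h => by simpa using congrFun h i).ne'
  · intro y hy
    exact congrArg χ (ofAffine_affine hy).symm

end CP

/-! ### Biholomorphic maps and transport of structure -/

section Transport

variable {X Y Z : Type*} [TopologicalSpace X] [TopologicalSpace Y] [TopologicalSpace Z]
  {O : FunctionSheaf X} {O' : FunctionSheaf Y} {O'' : FunctionSheaf Z}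

theorem FunctionSheaf.holAt_congr (O : FunctionSheaf X) {x : X} {f g : X → ℂ} (h : f =ᶠ[𝓝 x] g) :
    O.holAt x f ↔ O.holAt x g :=
  ⟨O.congr h, O.congr h.symm⟩

theorem IsBihol.symm {e : OpenPartialHomeomorph X Y} (h : IsBihol O O' e) :
    IsBihol O' O e.symm := by
  intro y hy f
  have h1 := h (e.symm y) (e.map_target hy) (f ∘ e.symm)
  rw [e.right_inv hy] at h1
  rw [← h1]
  refine O.holAt_congr ?_
  filter_upwards [e.open_source.mem_nhds (e.map_target hy)] with x hx
    using congrArg f (e.left_inv hx)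

theorem IsBihol.trans {e : OpenPartialHomeomorph X Y} {e' : OpenPartialHomeomorph Y Z}
    (h : IsBihol O O' e) (h' : IsBihol O' O'' e') : IsBihol O O'' (e.trans e') := by
  intro x hx f
  rw [OpenPartialHomeomorph.trans_source] at hx
  exact (h x hx.1 (f ∘ e')).trans (h' (e x) hx.2 f)

/-- Local embeddings are pulled back by biholomorphic maps. -/
def LocalEmbedding.comp {e : OpenPartialHomeomorph X Y} (h : IsBihol O O' e) {x : X}
    (hx : x ∈ e.source) (c : LocalEmbedding O' (e x)) : LocalEmbedding O x where
  N := c.N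
  D := c.D
  A := c.A
  analytic := c.analytic
  e := e.trans c.e
  mem_source := by
    rw [OpenPartialHomeomorph.trans_source]
    exact ⟨hx, c.mem_source⟩
  bihol := h.trans c.bihol

/-- Regular charts are pulled back by biholomorphic maps. -/
def RegularChart.comp {e : OpenPartialHomeomorph X Y} (h : IsBihol O O' e) {x : X}
    (hx : x ∈ e.source) {k : ℕ} (c : RegularChart O' (e x) k) : RegularChart O x k where
  e := e.trans c.e
  mem_source := by
    rw [OpenPartialHomeomorph.trans_source]
    exact ⟨hx, c.mem_source⟩
  bihol := h.trans c.bihol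

theorem IsSmoothAt.congr {φ ψ : X → ℝ} {x : X} (h : IsSmoothAt O φ x) (e : φ =ᶠ[𝓝 x] ψ) :
    IsSmoothAt O ψ x := by
  obtain ⟨c, W, F, hW, hx, hF, hφ⟩ := h
  exact ⟨c, W, F, hW, hx, hF, by filter_upwards [hφ, e] with y h1 h2 using h2 ▸ h1⟩

theorem IsSmoothStronglyPshAt.congr {φ ψ : X → ℝ} {x : X} (h : IsSmoothStronglyPshAt O φ x)
    (e : φ =ᶠ[𝓝 x] ψ) : IsSmoothStronglyPshAt O ψ x := by
  obtain ⟨c, W, F, hW, hx, hF, hL, hφ⟩ := h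
  exact ⟨c, W, F, hW, hx, hF, hL, by filter_upwards [hφ, e] with y h1 h2 using h2 ▸ h1⟩

theorem IsSmoothAt.comp {e : OpenPartialHomeomorph X Y} (h : IsBihol O O' e) {x : X}
    (hx : x ∈ e.source) {φ : Y → ℝ} (hφ : IsSmoothAt O' φ (e x)) : IsSmoothAt O (φ ∘ e) x := by
  obtain ⟨c, W, F, hW, hxW, hF, hφ⟩ := hφ
  exact ⟨c.comp h hx, W, F, hW, hxW, hF, (e.continuousAt hx).eventually hφ⟩

theorem IsSmoothStronglyPshAt.comp {e : OpenPartialHomeomorph X Y} (h : IsBihol O O' e) {x : X}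
    (hx : x ∈ e.source) {φ : Y → ℝ} (hφ : IsSmoothStronglyPshAt O' φ (e x)) :
    IsSmoothStronglyPshAt O (φ ∘ e) x := by
  obtain ⟨c, W, F, hW, hxW, hF, hL, hφ⟩ := hφ
  exact ⟨c.comp h hx, W, F, hW, hxW, hF, hL, (e.continuousAt hx).eventually hφ⟩

theorem eventuallyEq_comp_symm {e : OpenPartialHomeomorph X Y} {x : X} (hx : x ∈ e.source)
    {R : Type*} (φ : Y → R) : (φ ∘ e) ∘ e.symm =ᶠ[𝓝 (e x)] φ := by
  filter_upwards [e.open_target.mem_nhds (e.map_source hx)] with y hy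
    using congrArg φ (e.right_inv hy)

theorem IsSmoothAt.of_comp {e : OpenPartialHomeomorph X Y} (h : IsBihol O O' e) {x : X}
    (hx : x ∈ e.source) {φ : Y → ℝ} (hφ : IsSmoothAt O (φ ∘ e) x) : IsSmoothAt O' φ (e x) := by
  refine IsSmoothAt.congr (IsSmoothAt.comp h.symm (e.map_source hx) (φ := φ ∘ e) ?_)
    (eventuallyEq_comp_symm hx φ)
  rwa [e.left_inv hx]

theorem IsSmoothStronglyPshAt.of_comp {e : OpenPartialHomeomorph X Y} (h : IsBihol O O' e) {x : X}
    (hx : x ∈ e.source) {φ : Y → ℝ} (hφ : IsSmoothStronglyPshAt O (φ ∘ e) x) :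
    IsSmoothStronglyPshAt O' φ (e x) := by
  refine IsSmoothStronglyPshAt.congr (IsSmoothStronglyPshAt.comp h.symm (e.map_source hx)
    (φ := φ ∘ e) ?_) (eventuallyEq_comp_symm hx φ)
  rwa [e.left_inv hx]

theorem DdbarEqAt.of_comp {e : OpenPartialHomeomorph X Y} (h : IsBihol O O' e) {x : X}
    (hx : x ∈ e.source) {φ ψ : Y → ℝ} {a b : ℝ} (hφ : DdbarEqAt O x a (φ ∘ e) b (ψ ∘ e)) :
    DdbarEqAt O' (e x) a φ b ψ := by
  intro k c ξ η
  have key := hφ k (c.comp h hx) ξ η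
  have hev : ∀ φ : Y → ℝ, (φ ∘ e) ∘ (c.comp h hx).e.symm =ᶠ[𝓝 (c.e (e x))] φ ∘ c.e.symm := by
    intro φ
    have h1 : Tendsto c.e.symm (𝓝 (c.e (e x))) (𝓝 (e x)) := by
      have := c.e.symm.continuousAt (c.e.map_source c.mem_source)
      rwa [ContinuousAt, c.e.left_inv c.mem_source] at this
    exact h1.eventually (eventuallyEq_comp_symm hx φ)
  have hx' : (c.comp h hx).e x = c.e (e x) := rfl
  rw [hx', ddbar_congr (hev φ), ddbar_congr (hev ψ)] at key
  exact key

theorem DdbarEqAt.congr {φ φ' ψ ψ' : X → ℝ} {x : X} {a b : ℝ} (h : DdbarEqAt O x a φ b ψ)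
    (h1 : φ =ᶠ[𝓝 x] φ') (h2 : ψ =ᶠ[𝓝 x] ψ') : DdbarEqAt O x a φ' b ψ' := by
  intro k c ξ η
  have ht : Tendsto c.e.symm (𝓝 (c.e x)) (𝓝 x) := by
    have := c.e.symm.continuousAt (c.e.map_source c.mem_source)
    rwa [ContinuousAt, c.e.left_inv c.mem_source] at this
  rw [← ddbar_congr (u := φ ∘ c.e.symm) (v := φ' ∘ c.e.symm) (ht.eventually h1),
    ← ddbar_congr (u := ψ ∘ c.e.symm) (v := ψ' ∘ c.e.symm) (ht.eventually h2)]
  exact h k c ξ η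

end Transport

/-! ### Regular points -/

section Regular

variable {X : Type*} [TopologicalSpace X] {O : FunctionSheaf X} {x : X}

/-- Holomorphic functions are analytic in regular charts. -/
theorem RegularChart.analyticAt {k : ℕ} (c : RegularChart O x k) {f : X → ℂ} (hf : O.holAt x f) :
    AnalyticAt ℂ (f ∘ c.e.symm) (c.e x) := by
  refine (c.bihol x c.mem_source (f ∘ c.e.symm)).1 (O.congr ?_ hf)
  filter_upwards [c.e.open_source.mem_nhds c.mem_source] with y hy
    using (congrArg f (c.e.left_inv hy)).symm

theorem RegularChart.differentiableAt_transition {k m : ℕ} (c : RegularChart O x k)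
    (c' : RegularChart O x m) : DifferentiableAt ℂ (c'.e ∘ c.e.symm) (c.e x) := by
  refine differentiableAt_pi.2 fun j => AnalyticAt.differentiableAt ?_
  refine c.analyticAt (f := fun y => c'.e y j) ?_
  exact (c'.bihol x c'.mem_source (fun z => z j)).2
    ((ContinuousLinearMap.proj (R := ℂ) (φ := fun _ : Fin m => ℂ) j).analyticAt _)

/-- The dimension of a complex space at a regular point is well defined: the derivatives of the
two transition maps are inverse to each other. -/
theorem RegularChart.dim_eq {k m : ℕ} (c : RegularChart O x k) (c' : RegularChart O x m) :
    k = m := by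
  have key : ∀ {k m : ℕ} (c : RegularChart O x k) (c' : RegularChart O x m),
      (fderiv ℂ (c.e ∘ c'.e.symm) (c'.e x)).comp (fderiv ℂ (c'.e ∘ c.e.symm) (c.e x)) =
        ContinuousLinearMap.id ℂ _ := by
    intro k m c c'
    have hx : (c'.e ∘ c.e.symm) (c.e x) = c'.e x := congrArg c'.e (c.e.left_inv c.mem_source)
    have h1 := (c.differentiableAt_transition c').hasFDerivAt
    have h2 := (c'.differentiableAt_transition c).hasFDerivAt
    rw [← hx] at h2
    have h3 := h2.comp _ h1
    rw [hx] at h3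
    refine h3.unique ((hasFDerivAt_id _).congr_of_eventuallyEq ?_)
    have ht : Tendsto c.e.symm (𝓝 (c.e x)) (𝓝 x) := by
      have := c.e.symm.continuousAt (c.e.map_source c.mem_source)
      rwa [ContinuousAt, c.e.left_inv c.mem_source] at this
    filter_upwards [ht.eventually (c'.e.open_source.mem_nhds c'.mem_source),
      c.e.open_target.mem_nhds (c.e.map_source c.mem_source)] with z h1 h2
    change c.e (c'.e.symm (c'.e (c.e.symm z))) = z
    rw [c'.e.left_inv h1, c.e.right_inv h2]
  have e : (Fin k → ℂ) ≃ₗ[ℂ] (Fin m → ℂ) :=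
    { (fderiv ℂ (c'.e ∘ c.e.symm) (c.e x)).toLinearMap with
      invFun := fderiv ℂ (c.e ∘ c'.e.symm) (c'.e x)
      left_inv := fun ξ => DFunLike.congr_fun (key c c') ξ
      right_inv := fun ξ => DFunLike.congr_fun (key c' c) ξ }
  simpa using e.finrank_eq

/-- By the identity theorem, a complex space is irreducible at its regular points. -/
theorem RegularChart.isIrreducibleAt {k : ℕ} (c : RegularChart O x k) : IsIrreducibleAt O x := by
  intro f g hf hg hfg
  have ht : Tendsto c.e.symm (𝓝 (c.e x)) (𝓝 x) := by
    have := c.e.symm.continuousAt (c.e.map_source c.mem_source)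
    rwa [ContinuousAt, c.e.left_inv c.mem_source] at this
  have back : ∀ {f : X → ℂ}, (∀ᶠ z in 𝓝 (c.e x), (f ∘ c.e.symm) z = 0) → ∀ᶠ y in 𝓝 x, f y = 0 := by
    intro f h
    filter_upwards [(c.e.continuousAt c.mem_source).eventually h,
      c.e.open_source.mem_nhds c.mem_source] with y h1 h2
    rwa [Function.comp_apply, c.e.left_inv h2] at h1
  have hF := c.analyticAt hf
  have hG := c.analyticAt hg
  have hev := (hF.eventually_analyticAt.and hG.eventually_analyticAt).and (ht.eventually hfg)
  obtain ⟨r, hr, H⟩ := Metric.eventually_nhds_iff_ball.1 hev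
  by_cases h0 : ∀ᶠ z in 𝓝 (c.e x), (f ∘ c.e.symm) z = 0
  · exact Or.inl (back h0)
  -- `f` does not vanish near some point `z` of the ball, so `g` vanishes near `z`
  right
  obtain ⟨z, hz, hzr⟩ := ((not_eventually.1 h0).and_eventually (Metric.ball_mem_nhds _ hr)).exists
  have hgz : (g ∘ c.e.symm) =ᶠ[𝓝 z] 0 := by
    filter_upwards [(H z hzr).1.1.continuousAt.eventually_ne hz,
      Metric.isOpen_ball.mem_nhds hzr] with y h1 h2
    exact (mul_eq_zero.1 (H y h2).2).resolve_left h1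
  have := AnalyticOnNhd.eqOn_zero_of_preconnected_of_eventuallyEq_zero
    (f := g ∘ c.e.symm) (U := Metric.ball (c.e x) r) (fun y hy => (H y hy).1.2)
    (convex_ball _ _).isPreconnected hzr hgz
  exact back (mem_of_superset (Metric.ball_mem_nhds _ hr) this)

/-- A regular chart is a local embedding. -/
def RegularChart.localEmbedding {k : ℕ} (c : RegularChart O x k) : LocalEmbedding O x where
  N := k
  D := univ
  A := univ
  analytic := ⟨isOpen_univ, subset_rfl, fun p _ => ⟨univ, isOpen_univ, trivial, subset_rfl, 0,
    fun _ _ => 0, fun i => i.elim0, fun z _ => by simp⟩⟩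
  e := c.e.trans (Homeomorph.Set.univ (Fin k → ℂ)).symm.toOpenPartialHomeomorph
  mem_source := by simpa using c.mem_source
  bihol := by
    refine c.bihol.trans fun z _ f => ?_
    have hs : ContinuousAt (fun z : Fin k → ℂ => (⟨z, trivial⟩ : (univ : Set (Fin k → ℂ)))) z :=
      (continuous_id.subtype_mk _).continuousAt
    constructor
    · intro h
      exact ⟨_, h, Eventually.of_forall fun y => rfl⟩
    · rintro ⟨g, hg, h⟩
      exact AnalyticAt.congr hg ((hs.eventually h).mono fun y hy => hy.symm)

theorem isSmoothAt_of_regularChart {k : ℕ} (c : RegularChart O x k) {φ : X → ℝ}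
    {G : (Fin k → ℂ) → ℝ} (hG : ContDiff ℝ (⊤ : ℕ∞) G) (h : ∀ᶠ y in 𝓝 x, φ y = G (c.e y)) :
    IsSmoothAt O φ x :=
  ⟨c.localEmbedding, univ, G, isOpen_univ, trivial, hG.contDiffOn, h⟩

theorem isSmoothStronglyPshAt_of_regularChart {k : ℕ} (c : RegularChart O x k) {φ : X → ℝ}
    {G : (Fin k → ℂ) → ℝ} (hG : ContDiff ℝ (⊤ : ℕ∞) G)
    (hL : ∀ z ξ, ξ ≠ 0 → 0 < ddbar G z ξ (Complex.I • ξ)) (h : ∀ᶠ y in 𝓝 x, φ y = G (c.e y)) :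
    IsSmoothStronglyPshAt O φ x :=
  ⟨c.localEmbedding, univ, G, isOpen_univ, trivial, hG.contDiffOn, fun z _ => hL z, h⟩

theorem secondCountableTopology_of_localEmbedding [SigmaCompactSpace X]
    (h : ∀ x, Nonempty (LocalEmbedding O x)) : SecondCountableTopology X := by
  let c := fun x => (h x).some
  obtain ⟨s, hs, hU⟩ := countable_cover_nhds_of_sigmaCompact
    (f := fun x => (c x).e.source) fun x => (c x).e.open_source.mem_nhds (c x).mem_source
  have : Countable s := hs.to_subtype
  have : ∀ x : s, SecondCountableTopology ((c x).e.source) := fun x =>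
    (c x).e.secondCountableTopology_source
  refine secondCountableTopology_of_countable_cover (fun x : s => (c x).e.open_source) ?_
  rwa [iUnion_coe_set]

end Regular

/-! ### Quotients by closed maps -/

section ClosedQuotient

variable {X Y : Type*} [TopologicalSpace X] [TopologicalSpace Y] {q : Y → X}

theorem eventually_of_fiber (hc : IsClosedMap q) (hs : Function.Surjective q) {x : X} {P : X → Prop}
    (h : ∀ y, q y = x → ∀ᶠ z in 𝓝 y, P (q z)) : ∀ᶠ x' in 𝓝 x, P x' := by
  filter_upwards [hc.eventually_nhds_fiber x (p := fun z => P (q z)) h] with x' hx'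
  obtain ⟨y, rfl⟩ := hs x'
  exact hx' y rfl

theorem quotientSheaf_holAt_iff (O : FunctionSheaf Y) (hq : Continuous q) (hc : IsClosedMap q)
    {x : X} {f : X → ℂ} :
    (quotientSheaf O q hq).holAt x f ↔ ∀ y, q y = x → O.holAt y (f ∘ q) := by
  constructor
  · rintro ⟨U, hU, hx, H⟩ y rfl
    exact H y hx
  · intro h
    have := hc.eventually_nhds_fiber x (p := fun z => O.holAt z (f ∘ q))
      fun y hy => O.eventually (h y hy)
    obtain ⟨V, hV, hVo, hxV⟩ := eventually_nhds_iff.1 this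
    exact ⟨V, hVo, hxV, fun y hy => hV _ hy y rfl⟩

theorem t2Space_of_isClosedMap [T2Space Y] (hc : IsClosedMap q)
    (hs : Function.Surjective q) (hf : ∀ x, IsCompact (q ⁻¹' {x})) : T2Space X := by
  refine t2Space_iff_disjoint_nhds.2 fun x x' hxx' => ?_
  have hd : Disjoint (q ⁻¹' {x}) (q ⁻¹' {x'}) :=
    disjoint_singleton.2 hxx' |>.preimage q
  obtain ⟨U, U', hU, hU', hxU, hxU', hUU'⟩ := SeparatedNhds.of_isCompact_isCompact (hf x) (hf x') hd
  have h1 := hc.eventually_nhds_fiber x (p := fun z => z ∈ U) fun y hy => hU.mem_nhds (hxU hy)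
  have h2 := hc.eventually_nhds_fiber x' (p := fun z => z ∈ U') fun y hy => hU'.mem_nhds (hxU' hy)
  refine Filter.disjoint_iff.2 ⟨_, h1, _, h2, ?_⟩
  rw [Set.disjoint_left]
  intro a ha ha'
  obtain ⟨y, rfl⟩ := hs a
  exact Set.disjoint_left.1 hUU' (ha y rfl) (ha' y rfl)

end ClosedQuotient

/-! ### The union of two coordinate planes -/

section Cross

variable {n : ℕ}

/-- The points of the plane `t = 0`. -/
def crossLeft (a : Fin n → ℂ) : crossSet n := ⟨(a, 0), Or.inr rfl⟩

/-- The points of the plane `z = 0`. -/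
def crossRight (b : Fin n → ℂ) : crossSet n := ⟨(0, b), Or.inl rfl⟩

theorem continuous_crossLeft : Continuous (crossLeft (n := n)) :=
  (Continuous.prodMk_left 0).subtype_mk _

theorem continuous_crossRight : Continuous (crossRight (n := n)) :=
  (Continuous.prodMk_right 0).subtype_mk _

theorem crossLeft_zero : crossLeft (0 : Fin n → ℂ) = crossOrigin n := rfl

theorem crossRight_zero : crossRight (0 : Fin n → ℂ) = crossOrigin n := rfl

theorem crossLeft_eq {p : crossSet n} (h : p.1.2 = 0) : crossLeft p.1.1 = p :=
  Subtype.ext (Prod.ext rfl h.symm)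

theorem crossRight_eq {p : crossSet n} (h : p.1.1 = 0) : crossRight p.1.2 = p :=
  Subtype.ext (Prod.ext h.symm rfl)

theorem continuous_cross_fst : Continuous fun p : crossSet n => p.1.1 :=
  continuous_fst.comp continuous_subtype_val

theorem continuous_cross_snd : Continuous fun p : crossSet n => p.1.2 :=
  continuous_snd.comp continuous_subtype_val

/-- A function on the union of the two planes is holomorphic if and only if both of its
restrictions are: at the origin it is then the restriction of `f(z, 0) + f(0, t) - f(0, 0)`. -/
theorem cross_holAt_iff {p : crossSet n} {f : crossSet n → ℂ} :
    (subSheaf (crossSet n)).holAt p f ↔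
      (p.1.2 = 0 → AnalyticAt ℂ (f ∘ crossLeft) p.1.1) ∧
      (p.1.1 = 0 → AnalyticAt ℂ (f ∘ crossRight) p.1.2) := by
  constructor
  · rintro ⟨g, hg, h⟩
    constructor
    · intro hp
      have hp' := crossLeft_eq hp
      have h1 : AnalyticAt ℂ (fun a => g (a, 0)) p.1.1 := by
        refine AnalyticAt.fun_comp (g := g) (f := fun a : Fin n → ℂ => (a, (0 : Fin n → ℂ))) ?_
          (analyticAt_id.prod analyticAt_const)
        have : (p.1.1, (0 : Fin n → ℂ)) = p.1 := congrArg Subtype.val hp'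
        rwa [this]
      refine h1.congr ?_
      rw [← hp'] at h
      exact (continuous_crossLeft.continuousAt.eventually h).mono fun a ha => ha.symm
    · intro hp
      have hp' := crossRight_eq hp
      have h1 : AnalyticAt ℂ (fun a => g (0, a)) p.1.2 := by
        refine AnalyticAt.fun_comp (g := g) (f := fun a : Fin n → ℂ => ((0 : Fin n → ℂ), a)) ?_
          (analyticAt_const.prod analyticAt_id)
        have : ((0 : Fin n → ℂ), p.1.2) = p.1 := congrArg Subtype.val hp'
        rwa [this]
      refine h1.congr ?_
      rw [← hp'] at h
      exact (continuous_crossRight.continuousAt.eventually h).mono fun a ha => ha.symm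
  · rintro ⟨h1, h2⟩
    have hfst : AnalyticAt ℂ (fun p : (Fin n → ℂ) × (Fin n → ℂ) => p.1) p.1 := analyticAt_fst
    have hsnd : AnalyticAt ℂ (fun p : (Fin n → ℂ) × (Fin n → ℂ) => p.2) p.1 := analyticAt_snd
    by_cases hz : p.1.1 = 0
    · by_cases ht : p.1.2 = 0
      · refine ⟨fun y => f (crossLeft y.1) + f (crossRight y.2) - f (crossOrigin n),
          (((h1 ht).fun_comp hfst).add ((h2 hz).fun_comp hsnd)).sub analyticAt_const,
          Eventually.of_forall fun y => ?_⟩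
        rcases y.2 with h | h
        · simp only [crossRight_eq h, h, crossLeft_zero]
          ring
        · simp only [crossLeft_eq h, h, crossRight_zero]
          ring
      · refine ⟨fun y => f (crossRight y.2), (h2 hz).fun_comp hsnd, ?_⟩
        filter_upwards [continuous_cross_snd.continuousAt.eventually_ne ht] with y hy
        rw [crossRight_eq (y.2.resolve_right hy)]
    · have ht : p.1.2 = 0 := p.2.resolve_left hz
      refine ⟨fun y => f (crossLeft y.1), (h1 ht).fun_comp hfst, ?_⟩
      filter_upwards [continuous_cross_fst.continuousAt.eventually_ne hz] with y hy
      rw [crossLeft_eq (y.2.resolve_left hy)]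

/-- A linear identification of `ℂ^n × ℂ^n` with `ℂ^{2n}`. -/
def crossCoord (n : ℕ) : ((Fin n → ℂ) × (Fin n → ℂ)) ≃L[ℂ] (Fin (n + n) → ℂ) :=
  ContinuousLinearEquiv.ofFinrankEq (by simp)

/-- The image of the union of the two planes in `ℂ^{2n}`. -/
def crossHomeo (n : ℕ) : crossSet n ≃ₜ (crossCoord n '' crossSet n) :=
  (crossCoord n).toHomeomorph.image (crossSet n)

theorem isBihol_crossHomeo :
    IsBihol (subSheaf (crossSet n)) (subSheaf (crossCoord n '' crossSet n))
      (crossHomeo n).toOpenPartialHomeomorph := by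
  intro p _ f
  set h := crossHomeo n
  constructor
  · rintro ⟨g, hg, hfg⟩
    refine ⟨g ∘ (crossCoord n).symm, ?_, ?_⟩
    · refine AnalyticAt.comp ?_ ((crossCoord n).symm.toContinuousLinearMap.analyticAt _)
      change AnalyticAt ℂ g ((crossCoord n).symm (crossCoord n p.1))
      rwa [ContinuousLinearEquiv.symm_apply_apply]
    · have h1 : Tendsto h.symm (𝓝 (h p)) (𝓝 p) := by
        have := h.symm.continuous.tendsto (h p)
        rwa [h.symm_apply_apply] at this
      filter_upwards [h1.eventually hfg] with y hy
      obtain ⟨y, rfl⟩ := h.surjective y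
      rw [h.symm_apply_apply] at hy
      change f (h y) = g ((crossCoord n).symm (crossCoord n y.1))
      rw [ContinuousLinearEquiv.symm_apply_apply]
      exact hy
  · rintro ⟨g, hg, hfg⟩
    refine ⟨g ∘ crossCoord n,
      AnalyticAt.comp hg ((crossCoord n).toContinuousLinearMap.analyticAt _),
      ?_⟩
    exact (h.continuous.tendsto p).eventually hfg

theorem isAnalyticSubset_cross :
    IsAnalyticSubset (univ : Set (Fin (n + n) → ℂ)) (crossCoord n '' crossSet n) := by
  refine ⟨isOpen_univ, subset_univ _, fun p _ => ⟨univ, isOpen_univ, trivial, subset_rfl, n * n,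
    fun ij z => ((crossCoord n).symm z).1 (finProdFinEquiv.symm ij).1 *
      ((crossCoord n).symm z).2 (finProdFinEquiv.symm ij).2, fun ij z _ => ?_, fun z _ => ?_⟩⟩
  · have h := (crossCoord n).symm.toContinuousLinearMap.analyticAt z
    exact (((ContinuousLinearMap.proj (R := ℂ) (φ := fun _ : Fin n => ℂ) _).comp
      ((ContinuousLinearMap.fst ℂ _ _).comp (crossCoord n).symm.toContinuousLinearMap)).analyticAt
        z).mul (((ContinuousLinearMap.proj (R := ℂ) (φ := fun _ : Fin n => ℂ) _).comp
      ((ContinuousLinearMap.snd ℂ _ _).comp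
        (crossCoord n).symm.toContinuousLinearMap)).analyticAt z)
  · constructor
    · rintro ⟨y, hy, rfl⟩ ij
      simp only [ContinuousLinearEquiv.symm_apply_apply]
      rcases hy with h | h <;> simp [h]
    · intro h
      refine ⟨(crossCoord n).symm z, ?_, ContinuousLinearEquiv.apply_symm_apply _ _⟩
      by_contra hne
      obtain ⟨h1, h2⟩ := not_or.1 hne
      obtain ⟨i, hi⟩ := Function.ne_iff.1 h1
      obtain ⟨j, hj⟩ := Function.ne_iff.1 h2
      have := h (finProdFinEquiv (i, j))
      simp only [Equiv.symm_apply_apply] at this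
      exact mul_ne_zero hi hj this

variable {X : Type*} [TopologicalSpace X] {O : FunctionSheaf X} {x : X}
  {e : OpenPartialHomeomorph X (crossSet n)}

/-- A chart with values in the union of two coordinate planes is a local embedding. -/
def crossEmbedding (he : IsBihol O (subSheaf (crossSet n)) e) (hx : x ∈ e.source) :
    LocalEmbedding O x where
  N := n + n
  D := univ
  A := crossCoord n '' crossSet n
  analytic := isAnalyticSubset_cross
  e := e.trans (crossHomeo n).toOpenPartialHomeomorph
  mem_source := by
    rw [OpenPartialHomeomorph.trans_source]
    exact ⟨hx, trivial⟩
  bihol := he.trans isBihol_crossHomeo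

/-- The function `G₁(z) + G₂(t)`, in the coordinates of `ℂ^{2n}`. -/
def crossSum (G₁ G₂ : (Fin n → ℂ) → ℝ) (x : Fin (n + n) → ℂ) : ℝ :=
  G₁ ((crossCoord n).symm x).1 + G₂ ((crossCoord n).symm x).2

theorem contDiff_crossSum {G₁ G₂ : (Fin n → ℂ) → ℝ} (h₁ : ContDiff ℝ (⊤ : ℕ∞) G₁)
    (h₂ : ContDiff ℝ (⊤ : ℕ∞) G₂) : ContDiff ℝ (⊤ : ℕ∞) (crossSum G₁ G₂) := by
  have h : ContDiff ℝ (⊤ : ℕ∞) (crossCoord n).symm :=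
    ((crossCoord n).symm.toContinuousLinearMap.restrictScalars ℝ).contDiff
  exact (h₁.comp (contDiff_fst.comp h)).add (h₂.comp (contDiff_snd.comp h))

theorem ddbar_crossSum_pos {G₁ G₂ : (Fin n → ℂ) → ℝ} (h₁ : ContDiff ℝ (⊤ : ℕ∞) G₁)
    (h₂ : ContDiff ℝ (⊤ : ℕ∞) G₂) (hL₁ : ∀ z ξ, ξ ≠ 0 → 0 < ddbar G₁ z ξ (Complex.I • ξ))
    (hL₂ : ∀ z ξ, ξ ≠ 0 → 0 < ddbar G₂ z ξ (Complex.I • ξ)) (z ξ : Fin (n + n) → ℂ) (hξ : ξ ≠ 0) :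
    0 < ddbar (crossSum G₁ G₂) z ξ (Complex.I • ξ) := by
  let L₁ : (Fin (n + n) → ℂ) →L[ℂ] (Fin n → ℂ) :=
    (ContinuousLinearMap.fst ℂ _ _).comp (crossCoord n).symm.toContinuousLinearMap
  let L₂ : (Fin (n + n) → ℂ) →L[ℂ] (Fin n → ℂ) :=
    (ContinuousLinearMap.snd ℂ _ _).comp (crossCoord n).symm.toContinuousLinearMap
  have hs : ∀ {G : (Fin n → ℂ) → ℝ} (_ : ContDiff ℝ (⊤ : ℕ∞) G) (w), ContDiffAt ℝ 2 G w :=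
    fun hG w => (contDiff_infty.1 hG 2).contDiffAt
  have hsum : crossSum G₁ G₂ = fun x => G₁ (L₁ x + 0) + G₂ (L₂ x + 0) := by
    funext x
    simp [crossSum, L₁, L₂]
  have hc : ∀ {G : (Fin n → ℂ) → ℝ} (_ : ContDiff ℝ (⊤ : ℕ∞) G)
      (L : (Fin (n + n) → ℂ) →L[ℂ] (Fin n → ℂ)), ContDiffAt ℝ 2 (fun x => G (L x + 0)) z :=
    fun hG L => (hs hG _).comp z
      (((L.restrictScalars ℝ).contDiff.add contDiff_const).contDiffAt)
  rw [hsum, ddbar_add (hc h₁ L₁) (hc h₂ L₂), ddbar_comp_affine L₁ 0 (hs h₁ _),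
    ddbar_comp_affine L₂ 0 (hs h₂ _), L₁.map_smul, L₂.map_smul]
  have hnn : ∀ {G : (Fin n → ℂ) → ℝ} (_ : ∀ z ξ, ξ ≠ 0 → 0 < ddbar G z ξ (Complex.I • ξ)) (w ξ),
      0 ≤ ddbar G w ξ (Complex.I • ξ) := by
    intro G hG w ξ
    by_cases h0 : ξ = 0
    · simp [h0, ddbar]
    · exact (hG w ξ h0).le
  by_cases h0 : L₁ ξ = 0
  · refine add_pos_of_nonneg_of_pos (hnn hL₁ _ _) (hL₂ _ _ fun h0' => hξ ?_)
    have : (crossCoord n).symm ξ = 0 := Prod.ext h0 h0'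
    simpa using this
  · exact add_pos_of_pos_of_nonneg (hL₁ _ _ h0) (hnn hL₂ _ _)

theorem isSmoothAt_of_crossChart (he : IsBihol O (subSheaf (crossSet n)) e) (hx : x ∈ e.source)
    {φ : X → ℝ} {G₁ G₂ : (Fin n → ℂ) → ℝ} (h₁ : ContDiff ℝ (⊤ : ℕ∞) G₁)
    (h₂ : ContDiff ℝ (⊤ : ℕ∞) G₂) (h : ∀ᶠ y in 𝓝 x, φ y = G₁ (e y).1.1 + G₂ (e y).1.2) :
    IsSmoothAt O φ x := by
  refine ⟨crossEmbedding he hx, univ, crossSum G₁ G₂, isOpen_univ, trivial,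
    (contDiff_crossSum h₁ h₂).contDiffOn, h.mono fun y hy => ?_⟩
  change φ y = G₁ ((crossCoord n).symm (crossCoord n (e y).1)).1 +
    G₂ ((crossCoord n).symm (crossCoord n (e y).1)).2
  rw [hy, ContinuousLinearEquiv.symm_apply_apply]

theorem isSmoothStronglyPshAt_of_crossChart (he : IsBihol O (subSheaf (crossSet n)) e)
    (hx : x ∈ e.source) {φ : X → ℝ} {G₁ G₂ : (Fin n → ℂ) → ℝ} (h₁ : ContDiff ℝ (⊤ : ℕ∞) G₁)
    (h₂ : ContDiff ℝ (⊤ : ℕ∞) G₂) (hL₁ : ∀ z ξ, ξ ≠ 0 → 0 < ddbar G₁ z ξ (Complex.I • ξ))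
    (hL₂ : ∀ z ξ, ξ ≠ 0 → 0 < ddbar G₂ z ξ (Complex.I • ξ))
    (h : ∀ᶠ y in 𝓝 x, φ y = G₁ (e y).1.1 + G₂ (e y).1.2) : IsSmoothStronglyPshAt O φ x := by
  refine ⟨crossEmbedding he hx, univ, crossSum G₁ G₂, isOpen_univ, trivial,
    (contDiff_crossSum h₁ h₂).contDiffOn, fun z _ => ddbar_crossSum_pos h₁ h₂ hL₁ hL₂ z,
    h.mono fun y hy => ?_⟩
  change φ y = G₁ ((crossCoord n).symm (crossCoord n (e y).1)).1 +
    G₂ ((crossCoord n).symm (crossCoord n (e y).1)).2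
  rw [hy, ContinuousLinearEquiv.symm_apply_apply]

/-- The union of two planes is reducible at the origin, as `z_i t_i = 0` on it. -/
theorem not_isIrreducibleAt_of_crossChart (hn : 0 < n) (he : IsBihol O (subSheaf (crossSet n)) e)
    (hx : x ∈ e.source) (hx0 : e x = crossOrigin n) : ¬ IsIrreducibleAt O x := by
  intro hirr
  let i : Fin n := ⟨0, hn⟩
  have hp := fun (p : Fin n → ℂ) =>
    (ContinuousLinearMap.proj (R := ℂ) (φ := fun _ : Fin n => ℂ) i).analyticAt p
  have hf : O.holAt x ((fun p : crossSet n => p.1.1 i) ∘ e) :=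
    (he x hx _).2 (cross_holAt_iff.2 ⟨fun _ => hp _, fun _ => analyticAt_const⟩)
  have hg : O.holAt x ((fun p : crossSet n => p.1.2 i) ∘ e) :=
    (he x hx _).2 (cross_holAt_iff.2 ⟨fun _ => analyticAt_const, fun _ => hp _⟩)
  have hback : Tendsto e.symm (𝓝 (crossOrigin n)) (𝓝 x) := by
    have := e.symm.continuousAt (e.map_source hx)
    rwa [ContinuousAt, e.left_inv hx, hx0] at this
  have htgt : ∀ᶠ p in 𝓝 (crossOrigin n), p ∈ e.target :=
    e.open_target.mem_nhds (hx0 ▸ e.map_source hx)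
  have hno : ∀ (ι : (Fin n → ℂ) → crossSet n) (π : crossSet n → Fin n → ℂ), Continuous ι →
      ι 0 = crossOrigin n → (∀ a, π (ι a) = a) → ¬ ∀ᶠ y in 𝓝 x, π (e y) i = 0 := by
    intro ι π hι hι0 hπ h
    have h1 : ∀ᶠ p in 𝓝 (crossOrigin n), π p i = 0 := by
      filter_upwards [hback.eventually h, htgt] with p h1 h2
      rwa [e.right_inv h2] at h1
    have h2 : ∀ᶠ a in 𝓝 (0 : Fin n → ℂ), a i = 0 := by
      rw [← hι0] at h1
      filter_upwards [hι.continuousAt.eventually h1] with a ha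
      rwa [hπ] at ha
    have h3 : Tendsto (fun s : ℝ => fun _ : Fin n => (s : ℂ)) (𝓝[≠] 0) (𝓝 0) := by
      have : Continuous fun s : ℝ => fun _ : Fin n => (s : ℂ) := by fun_prop
      have := this.tendsto 0
      simp only [Complex.ofReal_zero] at this
      exact this.mono_left nhdsWithin_le_nhds
    obtain ⟨s, hs, hs0⟩ := ((h3.eventually h2).and self_mem_nhdsWithin).exists
    exact hs0 (Complex.ofReal_eq_zero.1 hs)
  rcases hirr _ _ hf hg (Eventually.of_forall fun y => by
    rcases (e y).2 with h | h <;> simp [h]) with h | h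
  · exact hno crossLeft (fun p => p.1.1) continuous_crossLeft rfl (fun _ => rfl) h
  · exact hno crossRight (fun p => p.1.2) continuous_crossRight rfl (fun _ => rfl) h

end Cross

/-! ### The chain of projective spaces -/

theorem isClosed_singleton_prod_int {Y : Type*} [TopologicalSpace Y] [T1Space Y] (y : Y)
    (P : ℤ → Prop) : IsClosed {a : Y × ℤ | a.1 = y ∧ P a.2} :=
  (isClosed_singleton (x := y)).prod (isClosed_discrete {k | P k})

namespace ChainCP

variable {n : ℕ} {v w : CP n}

theorem mk_surjective : Function.Surjective (ChainCP.mk v w) := Quot.mk_surjective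

theorem mk_node (k : ℤ) : ChainCP.mk v w (w, k) = ChainCP.mk v w (v, k + 1) :=
  Quot.sound ⟨k, rfl, rfl⟩

/-- The points `(v, k + 1)` and `(w, k)` are the only ones which are identified. -/
theorem mk_eq_iff (hvw : v ≠ w) {a b : CP n × ℤ} : ChainCP.mk v w a = ChainCP.mk v w b ↔
    a = b ∨ (∃ k, a = (w, k) ∧ b = (v, k + 1)) ∨ ∃ k, b = (w, k) ∧ a = (v, k + 1) := by
  constructor
  · intro h
    classical
    -- the map replacing `(v, k + 1)` by `(w, k)` is constant on the fibres of the projection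
    let N : CP n × ℤ → CP n × ℤ := fun a => if a.1 = v then (w, a.2 - 1) else a
    have hN : N a = N b := congrArg (Quot.lift N (by
      rintro _ _ ⟨k, rfl, rfl⟩
      simp [N, hvw.symm])) h
    obtain ⟨z, k⟩ := a
    obtain ⟨z', k'⟩ := b
    by_cases h1 : z = v <;> by_cases h2 : z' = v
    · left
      simpa [N, h1, h2] using hN
    · right; right
      refine ⟨k - 1, ?_, ?_⟩
      · simpa [N, h1, h2] using hN.symm
      · simp [h1]
    · right; left
      refine ⟨k' - 1, ?_, ?_⟩
      · simpa [N, h1, h2] using hN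
      · simp [h2]
    · left
      simpa [N, h1, h2] using hN
  · rintro (rfl | ⟨k, rfl, rfl⟩ | ⟨k, rfl, rfl⟩)
    exacts [rfl, mk_node k, (mk_node k).symm]

theorem mk_eq_iff_of_ne (hvw : v ≠ w) {z : CP n} {k : ℤ} (hz : z ≠ v ∧ z ≠ w) {a : CP n × ℤ} :
    ChainCP.mk v w a = ChainCP.mk v w (z, k) ↔ a = (z, k) := by
  rw [mk_eq_iff hvw]
  refine ⟨?_, Or.inl⟩
  rintro (h | ⟨j, -, h⟩ | ⟨j, h, -⟩)
  exacts [h, absurd (congrArg Prod.fst h) hz.1, absurd (congrArg Prod.fst h) hz.2]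

theorem mk_eq_node_iff (hvw : v ≠ w) {k : ℤ} {a : CP n × ℤ} :
    ChainCP.mk v w a = ChainCP.mk v w (w, k) ↔ a = (w, k) ∨ a = (v, k + 1) := by
  rw [mk_eq_iff hvw]
  constructor
  · rintro (h | ⟨j, -, h⟩ | ⟨j, h, h'⟩)
    · exact Or.inl h
    · exact absurd (congrArg Prod.fst h) hvw.symm
    · obtain rfl : k = j := congrArg Prod.snd h
      exact Or.inr h'
  · rintro (h | h)
    exacts [Or.inl h, Or.inr (Or.inr ⟨k, rfl, h⟩)]

theorem exists_rep (x : ChainCP v w) :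
    (∃ (z : CP n) (k : ℤ), (z ≠ v ∧ z ≠ w) ∧ x = ChainCP.mk v w (z, k)) ∨
      ∃ k : ℤ, x = ChainCP.mk v w (w, k) := by
  obtain ⟨⟨z, k⟩, rfl⟩ := mk_surjective x
  by_cases hv : z = v
  · right
    refine ⟨k - 1, ?_⟩
    rw [mk_node, hv, sub_add_cancel]
  · by_cases hw : z = w
    · exact Or.inr ⟨k, by rw [hw]⟩
    · exact Or.inl ⟨z, k, ⟨hv, hw⟩, rfl⟩

theorem isClosedMap_mk (hvw : v ≠ w) : IsClosedMap (ChainCP.mk v w) := by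
  intro A hA
  have hq : IsQuotientMap (ChainCP.mk v w) := isQuotientMap_quot_mk
  rw [← hq.isClosed_preimage]
  have : ChainCP.mk v w ⁻¹' (ChainCP.mk v w '' A) = A ∪ {a | a.1 = w ∧ (v, a.2 + 1) ∈ A} ∪
      {a | a.1 = v ∧ (w, a.2 - 1) ∈ A} := by
    ext a
    constructor
    · rintro ⟨b, hb, h⟩
      rcases (mk_eq_iff hvw).1 h with rfl | ⟨k, rfl, rfl⟩ | ⟨k, rfl, rfl⟩
      · exact Or.inl (Or.inl hb)
      · exact Or.inr ⟨rfl, by simpa using hb⟩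
      · exact Or.inl (Or.inr ⟨rfl, hb⟩)
    · obtain ⟨z, k⟩ := a
      rintro ((h | ⟨rfl, h⟩) | ⟨rfl, h⟩)
      · exact ⟨_, h, rfl⟩
      · exact ⟨_, h, (mk_node k).symm⟩
      · exact ⟨_, h, by rw [mk_node, sub_add_cancel]⟩
  rw [this]
  exact (hA.union (isClosed_singleton_prod_int w fun k => (v, k + 1) ∈ A)).union
    (isClosed_singleton_prod_int v fun k => (w, k - 1) ∈ A)

theorem t2Space (hvw : v ≠ w) : T2Space (ChainCP v w) := by
  refine t2Space_of_isClosedMap (isClosedMap_mk hvw) mk_surjective fun x => Set.Finite.isCompact ?_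
  rcases exists_rep x with ⟨z, k, hz, rfl⟩ | ⟨k, rfl⟩
  · exact (finite_singleton (z, k)).subset fun a ha => (mk_eq_iff_of_ne hvw hz).1 ha
  · exact ((finite_singleton (v, k + 1)).insert (w, k)).subset fun a ha =>
      (mk_eq_node_iff hvw).1 ha

theorem sigmaCompactSpace : SigmaCompactSpace (ChainCP v w) := by
  rw [← isSigmaCompact_univ_iff, ← mk_surjective.range_eq]
  exact isSigmaCompact_range (continuous_mk v w)

theorem holAt_iff (hvw : v ≠ w) {x : ChainCP v w} {f : ChainCP v w → ℂ} :
    (ChainCP.sheaf v w).holAt x f ↔ ∀ z k, ChainCP.mk v w (z, k) = x →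
      (CP.sheaf n).holAt z (fun y => f (ChainCP.mk v w (y, k))) :=
  (quotientSheaf_holAt_iff _ (continuous_mk v w) (isClosedMap_mk hvw)).trans Prod.forall

theorem eventually_nhds (hvw : v ≠ w) {x : ChainCP v w} {P : ChainCP v w → Prop}
    (h : ∀ z k, ChainCP.mk v w (z, k) = x → ∀ᶠ y in 𝓝 z, P (ChainCP.mk v w (y, k))) :
    ∀ᶠ x' in 𝓝 x, P x' := by
  refine eventually_of_fiber (isClosedMap_mk hvw) mk_surjective ?_
  rintro ⟨z, k⟩ hzk
  have h2 : ∀ᶠ j : ℤ in 𝓝 k, j = k := by simp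
  rw [nhds_prod_eq]
  filter_upwards [(h z k hzk).prod_mk h2] with a ha
  obtain ⟨h1, h2⟩ := ha
  rw [← h2] at h1
  exact h1

/-- The inclusion of the component `X̃_k`. -/
def incl (v w : CP n) (k : ℤ) (z : CP n) : ChainCP v w := ChainCP.mk v w (z, k)

theorem continuous_incl (k : ℤ) : Continuous (incl v w k) :=
  (continuous_mk v w).comp (Continuous.prodMk_left k)

/-- The retraction of `X̃` to the component `X̃_k` which collapses the components on both sides of
it to the points `v` and `w`. -/
def retraction (v w : CP n) (k : ℤ) : ChainCP v w → CP n :=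
  Quot.lift (fun a => if a.2 = k then a.1 else if a.2 < k then v else w) (by
    rintro _ _ ⟨j, rfl, rfl⟩
    rcases lt_trichotomy j k with h | h | h
    · by_cases h' : j + 1 = k
      · simp [h, h.ne, h']
      · simp [h, h.ne, h', (by omega : j + 1 < k)]
    · simp [h]
    · have h1 : j + 1 ≠ k := by omega
      have h2 : ¬ j + 1 < k := by omega
      simp [h.ne', h.not_gt, h1, h2])

@[simp]
theorem retraction_incl (k : ℤ) (z : CP n) : retraction v w k (incl v w k z) = z := by
  simp [retraction, incl, ChainCP.mk]

theorem continuous_retraction (k : ℤ) : Continuous (retraction v w k) := by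
  refine continuous_quot_lift _ (continuous_prod_of_discrete_right.2 fun j => ?_)
  by_cases h : j = k
  · simpa [h] using! continuous_id (X := CP n)
  · by_cases h' : j < k <;> simpa [h, h'] using continuous_const

/-- The interior of a component, as an open subset of projective space and of `X̃`. -/
def interior (v w : CP n) (k : ℤ) : OpenPartialHomeomorph (CP n) (ChainCP v w) where
  toFun := incl v w k
  invFun := retraction v w k
  source := {v, w}ᶜ
  target := {x | Quot.lift (fun a : CP n × ℤ => a.1 ∈ ({v, w}ᶜ : Set (CP n)) ∧ a.2 = k) (by
    rintro _ _ ⟨j, rfl, rfl⟩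
    simp) x}
  map_source' _ hz := ⟨hz, rfl⟩
  map_target' := by
    rintro ⟨z, j⟩ ⟨hz, hj⟩
    obtain rfl : j = k := hj
    change retraction v w j (incl v w j z) ∈ _
    rwa [retraction_incl]
  left_inv' z _ := retraction_incl k z
  right_inv' := by
    rintro ⟨z, j⟩ ⟨hz, hj⟩
    obtain rfl : j = k := hj
    change incl v w j (retraction v w j (incl v w j z)) = incl v w j z
    rw [retraction_incl]
  open_source := (toFinite {v, w}).isClosed.isOpen_compl
  open_target := by
    have hq : IsQuotientMap (ChainCP.mk v w) := isQuotientMap_quot_mk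
    rw [← hq.isOpen_preimage]
    exact ((toFinite {v, w}).isClosed.isOpen_compl).prod (isOpen_discrete {k})
  continuousOn_toFun := (continuous_incl k).continuousOn
  continuousOn_invFun := (continuous_retraction k).continuousOn

theorem mem_interior_source {k : ℤ} {z : CP n} :
    z ∈ (interior v w k).source ↔ z ≠ v ∧ z ≠ w := by
  simp [interior]

theorem isBihol_interior (hvw : v ≠ w) (k : ℤ) :
    IsBihol (CP.sheaf n) (ChainCP.sheaf v w) (interior v w k) := by
  intro z hz f
  rw [mem_interior_source] at hz
  rw [holAt_iff hvw]
  constructor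
  · intro h z' k' h'
    obtain ⟨rfl, rfl⟩ := Prod.mk.inj ((mk_eq_iff_of_ne hvw hz).1 h')
    exact h
  · intro h
    exact h z k rfl

/-- A regular chart of `X̃` given by affine coordinates on a component. -/
def regularChart (hvw : v ≠ w) {z : CP n} (k : ℤ) (hz : z ≠ v ∧ z ≠ w) {i : Fin (n + 1)}
    (hi : z ∈ CP.dom i) : RegularChart (ChainCP.sheaf v w) (ChainCP.mk v w (z, k)) n where
  e := (interior v w k).symm.trans (CP.chart i 0)
  mem_source := by
    have hz' := mem_interior_source (k := k).2 hz
    rw [OpenPartialHomeomorph.trans_source]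
    refine ⟨(interior v w k).map_source hz', ?_⟩
    change retraction v w k (incl v w k z) ∈ CP.dom i
    rwa [retraction_incl]
  bihol := (isBihol_interior hvw k).symm.trans (CP.isBihol_chart i 0)

end ChainCP

/-- The polydisc of radius `r` around `y` in the `i`-th affine chart. -/
def CP.polydisc {n : ℕ} (i : Fin (n + 1)) (y : CP n) (r : ℝ) : Set (CP n) :=
  {z | z ∈ CP.dom i ∧ ‖CP.affine i z - CP.affine i y‖ < r}

theorem CP.isOpen_polydisc {n : ℕ} (i : Fin (n + 1)) (y : CP n) (r : ℝ) :
    IsOpen (CP.polydisc i y r) := by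
  have := (CP.chart i (CP.affine i y)).isOpen_inter_preimage (Metric.isOpen_ball (x := 0) (ε := r))
  convert! this using 1
  ext z
  rw [mem_inter_iff, mem_preimage, mem_ball_zero_iff]
  rfl

theorem CP.self_mem_polydisc {n : ℕ} {i : Fin (n + 1)} {y : CP n} (hy : y ∈ CP.dom i) {r : ℝ}
    (hr : 0 < r) : y ∈ CP.polydisc i y r :=
  ⟨hy, by simpa using hr⟩

theorem CP.ofAffine_mem_polydisc {n : ℕ} {i : Fin (n + 1)} {y : CP n} {r : ℝ} {x : Fin n → ℂ} :
    CP.ofAffine i (x + CP.affine i y) ∈ CP.polydisc i y r ↔ ‖x‖ < r := by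
  simp [polydisc, ofAffine_mem_dom]

theorem CP.exists_notMem_polydisc {n : ℕ} (i : Fin (n + 1)) {y y' : CP n} (hy : y ∈ CP.dom i)
    (h : y ≠ y') : ∃ r > 0, y' ∉ CP.polydisc i y r := by
  by_cases hy' : y' ∈ CP.dom i
  · refine ⟨‖CP.affine i y' - CP.affine i y‖, ?_, fun h => lt_irrefl _ h.2⟩
    refine norm_pos_iff.2 (sub_ne_zero.2 fun h' => h ?_)
    rw [← CP.ofAffine_affine hy, ← h', CP.ofAffine_affine hy']
  · exact ⟨1, one_pos, fun h => hy' h.1⟩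

theorem CP.polydisc_mono {n : ℕ} (i : Fin (n + 1)) (y : CP n) {r s : ℝ} (h : r ≤ s) :
    CP.polydisc i y r ⊆ CP.polydisc i y s :=
  fun _ hz => ⟨hz.1, hz.2.trans_le h⟩

theorem CP.dim_pos_of_ne {n : ℕ} {v w : CP n} (hvw : v ≠ w) : 0 < n := by
  rcases Nat.eq_zero_or_pos n with rfl | h
  · refine absurd ?_ hvw
    obtain ⟨i, hi⟩ := CP.exists_mem_dom v
    obtain ⟨j, hj⟩ := CP.exists_mem_dom w
    obtain rfl : i = j := Fin.ext (by omega)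
    rw [← CP.ofAffine_affine hi, ← CP.ofAffine_affine hj]
    exact congrArg _ (Subsingleton.elim _ _)
  · exact h

/-- Affine charts at `w` and `v`, together with a radius such that the polydiscs of this radius
around `w` and `v` do not contain the other point. -/
structure NodeData {n : ℕ} (v w : CP n) where
  i : Fin (n + 1)
  j : Fin (n + 1)
  r : ℝ
  r_pos : 0 < r
  w_mem : w ∈ CP.dom i
  v_mem : v ∈ CP.dom j
  v_notMem : v ∉ CP.polydisc i w r
  w_notMem : w ∉ CP.polydisc j v r

theorem exists_nodeData {n : ℕ} {v w : CP n} (hvw : v ≠ w) {i j : Fin (n + 1)} (hi : w ∈ CP.dom i)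
    (hj : v ∈ CP.dom j) : ∃ d : NodeData v w, d.i = i ∧ d.j = j := by
  obtain ⟨r, hr, h⟩ := CP.exists_notMem_polydisc i hi hvw.symm
  obtain ⟨s, hs, h'⟩ := CP.exists_notMem_polydisc j hj hvw
  exact ⟨⟨i, j, min r s, lt_min hr hs, hi, hj,
    fun hh => h (CP.polydisc_mono _ _ (min_le_left r s) hh),
    fun hh => h' (CP.polydisc_mono _ _ (min_le_right r s) hh)⟩, rfl, rfl⟩

namespace ChainCP

variable {n : ℕ} {v w : CP n}

section Node

variable (d : NodeData v w) (k : ℤ)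

open Classical in
/-- The coordinates near the node `[w, k] = [v, k + 1]`: the first plane is the component `X̃_k`,
the second one is `X̃_{k + 1}`. -/
def nodeFun : ChainCP v w → crossSet n :=
  Quot.lift (fun a => if a.2 = k ∧ a.1 ∈ CP.polydisc d.i w d.r then
      crossLeft (CP.affine d.i a.1 - CP.affine d.i w)
    else if a.2 = k + 1 ∧ a.1 ∈ CP.polydisc d.j v d.r then
      crossRight (CP.affine d.j a.1 - CP.affine d.j v)
    else crossOrigin n) (by
    rintro _ _ ⟨m, rfl, rfl⟩
    simp only [d.v_notMem, d.w_notMem, and_false, if_false, sub_self, crossLeft_zero,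
      crossRight_zero, ite_self])

/-- The neighbourhood of the node on which the coordinates are used. -/
def nodeSource : Set (ChainCP v w) :=
  {x | Quot.lift (fun a => (a.2 = k ∧ a.1 ∈ CP.polydisc d.i w d.r) ∨
    (a.2 = k + 1 ∧ a.1 ∈ CP.polydisc d.j v d.r)) (by
    rintro _ _ ⟨m, rfl, rfl⟩
    simp [d.v_notMem, d.w_notMem, CP.self_mem_polydisc d.w_mem d.r_pos,
      CP.self_mem_polydisc d.v_mem d.r_pos]) x}

open Classical in
/-- The inverse of the coordinates near a node. -/
def nodeInv (p : crossSet n) : ChainCP v w :=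
  if p.1.2 = 0 then ChainCP.mk v w (CP.ofAffine d.i (p.1.1 + CP.affine d.i w), k)
  else ChainCP.mk v w (CP.ofAffine d.j (p.1.2 + CP.affine d.j v), k + 1)

theorem mk_mem_nodeSource {z : CP n} {m : ℤ} : ChainCP.mk v w (z, m) ∈ nodeSource d k ↔
    (m = k ∧ z ∈ CP.polydisc d.i w d.r) ∨ (m = k + 1 ∧ z ∈ CP.polydisc d.j v d.r) := Iff.rfl

theorem nodeFun_left {z : CP n} (hz : z ∈ CP.polydisc d.i w d.r) :
    nodeFun d k (ChainCP.mk v w (z, k)) = crossLeft (CP.affine d.i z - CP.affine d.i w) :=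
  if_pos ⟨rfl, hz⟩

theorem nodeFun_right {z : CP n} (hz : z ∈ CP.polydisc d.j v d.r) :
    nodeFun d k (ChainCP.mk v w (z, k + 1)) = crossRight (CP.affine d.j z - CP.affine d.j v) := by
  have h : ¬ (k + 1 = k ∧ z ∈ CP.polydisc d.i w d.r) := fun h => by omega
  exact (if_neg h).trans (if_pos ⟨rfl, hz⟩)

theorem nodeInv_left (a : Fin n → ℂ) : nodeInv d k (crossLeft a) =
    ChainCP.mk v w (CP.ofAffine d.i (a + CP.affine d.i w), k) :=
  if_pos rfl

theorem nodeInv_right (b : Fin n → ℂ) : nodeInv d k (crossRight b) =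
    ChainCP.mk v w (CP.ofAffine d.j (b + CP.affine d.j v), k + 1) := by
  by_cases hb : b = 0
  · refine (if_pos hb).trans ?_
    change ChainCP.mk v w (CP.ofAffine d.i (0 + _), k) = _
    rw [hb, zero_add, zero_add, CP.ofAffine_affine d.w_mem, CP.ofAffine_affine d.v_mem, mk_node]
  · exact if_neg hb

theorem continuous_nodeInv : Continuous (nodeInv d k) := by
  have h1 : ContinuousOn (nodeInv d k) {p | p.1.2 = 0} := by
    refine ContinuousOn.congr (f := fun p : crossSet n =>
      ChainCP.mk v w (CP.ofAffine d.i (p.1.1 + CP.affine d.i w), k)) ?_ fun p hp => if_pos hp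
    exact ((continuous_incl k).comp ((CP.continuous_ofAffine _).comp
      (continuous_cross_fst.add continuous_const))).continuousOn
  have h2 : ContinuousOn (nodeInv d k) {p | p.1.1 = 0} := by
    refine ContinuousOn.congr (f := fun p : crossSet n =>
      ChainCP.mk v w (CP.ofAffine d.j (p.1.2 + CP.affine d.j v), k + 1)) ?_ fun p hp => ?_
    · exact ((continuous_incl (k + 1)).comp ((CP.continuous_ofAffine _).comp
        (continuous_cross_snd.add continuous_const))).continuousOn
    · have := nodeInv_right d k p.1.2
      rwa [crossRight_eq hp] at this
  have h := h2.union_of_isClosed h1 (isClosed_eq continuous_cross_fst continuous_const)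
    (isClosed_eq continuous_cross_snd continuous_const)
  have hu : ({p | p.1.1 = 0} ∪ {p | p.1.2 = 0} : Set (crossSet n)) = univ :=
    eq_univ_of_forall fun p => p.2
  rwa [hu, continuousOn_univ] at h

/-- Coordinates near the node `[w, k] = [v, k + 1]`, with values in the union of two planes. -/
def nodeChart (hvw : v ≠ w) : OpenPartialHomeomorph (ChainCP v w) (crossSet n) where
  toFun := nodeFun d k
  invFun := nodeInv d k
  source := nodeSource d k
  target := {p | ‖p.1.1‖ < d.r ∧ ‖p.1.2‖ < d.r}
  map_source' := by
    rintro ⟨z, m⟩ (⟨hm, hz⟩ | ⟨hm, hz⟩)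
    · obtain rfl : m = k := hm
      change nodeFun d m (ChainCP.mk v w (z, m)) ∈ _
      rw [nodeFun_left d m hz]
      exact ⟨hz.2, by simpa [crossLeft] using d.r_pos⟩
    · obtain rfl : m = k + 1 := hm
      change nodeFun d k (ChainCP.mk v w (z, k + 1)) ∈ _
      rw [nodeFun_right d k hz]
      exact ⟨by simpa [crossRight] using d.r_pos, hz.2⟩
  map_target' := by
    rintro p ⟨h1, h2⟩
    rcases p.2 with h | h
    · rw [← crossRight_eq h, nodeInv_right]
      exact Or.inr ⟨rfl, CP.ofAffine_mem_polydisc.2 h2⟩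
    · rw [← crossLeft_eq h, nodeInv_left]
      exact Or.inl ⟨rfl, CP.ofAffine_mem_polydisc.2 h1⟩
  left_inv' := by
    rintro ⟨z, m⟩ (⟨hm, hz⟩ | ⟨hm, hz⟩)
    · obtain rfl : m = k := hm
      change nodeInv d m (nodeFun d m (ChainCP.mk v w (z, m))) = ChainCP.mk v w (z, m)
      rw [nodeFun_left d m hz, nodeInv_left, sub_add_cancel, CP.ofAffine_affine hz.1]
    · obtain rfl : m = k + 1 := hm
      change nodeInv d k (nodeFun d k (ChainCP.mk v w (z, k + 1))) = ChainCP.mk v w (z, k + 1)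
      rw [nodeFun_right d k hz, nodeInv_right, sub_add_cancel, CP.ofAffine_affine hz.1]
  right_inv' := by
    rintro p ⟨h1, h2⟩
    rcases p.2 with h | h
    · rw [← crossRight_eq h, nodeInv_right, nodeFun_right d k (CP.ofAffine_mem_polydisc.2 h2),
        CP.affine_ofAffine, add_sub_cancel_right]
    · rw [← crossLeft_eq h, nodeInv_left, nodeFun_left d k (CP.ofAffine_mem_polydisc.2 h1),
        CP.affine_ofAffine, add_sub_cancel_right]
  open_source := by
    have hq : IsQuotientMap (ChainCP.mk v w) := isQuotientMap_quot_mk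
    rw [← hq.isOpen_preimage]
    refine IsOpen.union ?_ ?_
    · exact ((isOpen_discrete {k}).preimage continuous_snd).inter
        ((CP.isOpen_polydisc d.i w d.r).preimage continuous_fst)
    · exact ((isOpen_discrete {k + 1}).preimage continuous_snd).inter
        ((CP.isOpen_polydisc d.j v d.r).preimage continuous_fst)
  open_target := (isOpen_lt continuous_cross_fst.norm continuous_const).inter
    (isOpen_lt continuous_cross_snd.norm continuous_const)
  continuousOn_toFun := by
    intro x hx
    refine ContinuousAt.continuousWithinAt fun N hN => eventually_nhds hvw ?_
    rintro z m rfl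
    rcases (mk_mem_nodeSource d k).1 hx with ⟨rfl, hz⟩ | ⟨rfl, hz⟩
    · have hc : ContinuousAt (fun y => crossLeft (CP.affine d.i y - CP.affine d.i w)) z :=
        continuous_crossLeft.continuousAt.comp
          ((CP.continuousAt_affine hz.1).sub continuousAt_const)
      rw [nodeFun_left d m hz] at hN
      filter_upwards [hc hN, (CP.isOpen_polydisc d.i w d.r).mem_nhds hz] with y h1 h2
      rw [nodeFun_left d m h2]
      exact h1
    · have hc : ContinuousAt (fun y => crossRight (CP.affine d.j y - CP.affine d.j v)) z :=
        continuous_crossRight.continuousAt.comp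
          ((CP.continuousAt_affine hz.1).sub continuousAt_const)
      rw [nodeFun_right d k hz] at hN
      filter_upwards [hc hN, (CP.isOpen_polydisc d.j v d.r).mem_nhds hz] with y h1 h2
      rw [nodeFun_right d k h2]
      exact h1
  continuousOn_invFun := (continuous_nodeInv d k).continuousOn

@[simp]
theorem coe_nodeChart (hvw : v ≠ w) : ⇑(nodeChart d k hvw) = nodeFun d k := rfl

theorem node_mem_source : ChainCP.mk v w (w, k) ∈ nodeSource d k :=
  Or.inl ⟨rfl, CP.self_mem_polydisc d.w_mem d.r_pos⟩

theorem nodeFun_node : nodeFun d k (ChainCP.mk v w (w, k)) = crossOrigin n := by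
  rw [nodeFun_left d k (CP.self_mem_polydisc d.w_mem d.r_pos), sub_self, crossLeft_zero]

theorem isBihol_nodeChart (hvw : v ≠ w) :
    IsBihol (ChainCP.sheaf v w) (subSheaf (crossSet n)) (nodeChart d k hvw) := by
  have hleft : ∀ (f : crossSet n → ℂ) {z : CP n}, z ∈ CP.polydisc d.i w d.r →
      ((CP.sheaf n).holAt z (fun y => f (nodeFun d k (ChainCP.mk v w (y, k)))) ↔
        AnalyticAt ℂ (f ∘ crossLeft) (CP.affine d.i z - CP.affine d.i w)) := by
    intro f z hz
    refine Iff.trans ?_ (CP.isBihol_chart d.i (CP.affine d.i w) z hz.1 (f ∘ crossLeft))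
    refine FunctionSheaf.holAt_congr _ ?_
    filter_upwards [(CP.isOpen_polydisc d.i w d.r).mem_nhds hz] with y hy
    rw [nodeFun_left d k hy]
    rfl
  have hright : ∀ (f : crossSet n → ℂ) {z : CP n}, z ∈ CP.polydisc d.j v d.r →
      ((CP.sheaf n).holAt z (fun y => f (nodeFun d k (ChainCP.mk v w (y, k + 1)))) ↔
        AnalyticAt ℂ (f ∘ crossRight) (CP.affine d.j z - CP.affine d.j v)) := by
    intro f z hz
    refine Iff.trans ?_ (CP.isBihol_chart d.j (CP.affine d.j v) z hz.1 (f ∘ crossRight))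
    refine FunctionSheaf.holAt_congr _ ?_
    filter_upwards [(CP.isOpen_polydisc d.j v d.r).mem_nhds hz] with y hy
    rw [nodeFun_right d k hy]
    rfl
  intro x hx f
  rw [holAt_iff hvw, cross_holAt_iff, coe_nodeChart]
  have hinv : nodeInv d k (nodeFun d k x) = x := (nodeChart d k hvw).left_inv hx
  have htgt : ‖(nodeFun d k x).1.1‖ < d.r ∧ ‖(nodeFun d k x).1.2‖ < d.r :=
    (nodeChart d k hvw).map_source hx
  constructor
  · intro H
    constructor
    · intro h0
      have hx' := hinv
      rw [← crossLeft_eq h0, nodeInv_left] at hx'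
      have := (hleft f (CP.ofAffine_mem_polydisc.2 htgt.1)).1 (H _ _ hx')
      rwa [CP.affine_ofAffine, add_sub_cancel_right] at this
    · intro h0
      have hx' := hinv
      rw [← crossRight_eq h0, nodeInv_right] at hx'
      have := (hright f (CP.ofAffine_mem_polydisc.2 htgt.2)).1 (H _ _ hx')
      rwa [CP.affine_ofAffine, add_sub_cancel_right] at this
  · rintro ⟨H1, H2⟩ z m rfl
    rcases (mk_mem_nodeSource d k).1 hx with ⟨rfl, hz⟩ | ⟨rfl, hz⟩
    · rw [nodeFun_left d m hz] at H1
      exact (hleft f hz).2 (H1 rfl)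
    · rw [nodeFun_right d k hz] at H2
      exact (hright f hz).2 (H2 rfl)

end Node

theorem exists_localEmbedding (hvw : v ≠ w) (x : ChainCP v w) :
    Nonempty (LocalEmbedding (ChainCP.sheaf v w) x) := by
  rcases exists_rep x with ⟨z, k, hz, rfl⟩ | ⟨k, rfl⟩
  · obtain ⟨i, hi⟩ := CP.exists_mem_dom z
    exact ⟨(regularChart hvw k hz hi).localEmbedding⟩
  · obtain ⟨i, hi⟩ := CP.exists_mem_dom w
    obtain ⟨j, hj⟩ := CP.exists_mem_dom v
    obtain ⟨d, -, -⟩ := exists_nodeData hvw hi hj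
    exact ⟨crossEmbedding (isBihol_nodeChart d k hvw) (node_mem_source d k)⟩

theorem isComplexSpace (hvw : v ≠ w) : IsComplexSpace (ChainCP.sheaf v w) where
  t2 := t2Space hvw
  secondCountable := by
    have := sigmaCompactSpace (v := v) (w := w)
    exact secondCountableTopology_of_localEmbedding (exists_localEmbedding hvw)
  locallyEmbeddable := exists_localEmbedding hvw

theorem nodal_not_isIrreducibleAt (hvw : v ≠ w) (k : ℤ) :
    ¬ IsIrreducibleAt (ChainCP.sheaf v w) (ChainCP.mk v w (w, k)) := by
  obtain ⟨i, hi⟩ := CP.exists_mem_dom w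
  obtain ⟨j, hj⟩ := CP.exists_mem_dom v
  obtain ⟨d, -, -⟩ := exists_nodeData hvw hi hj
  exact not_isIrreducibleAt_of_crossChart (CP.dim_pos_of_ne hvw) (isBihol_nodeChart d k hvw)
    (node_mem_source d k)
    (nodeFun_node d k)

/-- Let `P` be a class of functions on `ℂ^n` which is invariant under translations and under the
addition of constants. If the restriction of `φ` to each component of `X̃` through `x` is
of class `P` in affine coordinates, then `φ` is of class `P` in a regular chart, or of the form
`G₁(z) + G₂(t)` with `G₁`, `G₂` of class `P` near a node. -/
theorem exists_local_form (hvw : v ≠ w) (P : ((Fin n → ℂ) → ℝ) → Prop)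
    (hP : ∀ G c d, P G → P fun x => G (x + c) + d) {φ : ChainCP v w → ℝ} {x : ChainCP v w}
    (h : ∀ z k, ChainCP.mk v w (z, k) = x → ∃ i, z ∈ CP.dom i ∧ ∃ G, P G ∧
      ∀ᶠ y in 𝓝 z, φ (ChainCP.mk v w (y, k)) = G (CP.affine i y)) :
    (∃ c : RegularChart (ChainCP.sheaf v w) x n, ∃ G, P G ∧ ∀ᶠ y in 𝓝 x, φ y = G (c.e y)) ∨
    ∃ e : OpenPartialHomeomorph (ChainCP v w) (crossSet n), x ∈ e.source ∧
      IsBihol (ChainCP.sheaf v w) (subSheaf (crossSet n)) e ∧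
      ∃ G₁ G₂, P G₁ ∧ P G₂ ∧ ∀ᶠ y in 𝓝 x, φ y = G₁ (e y).1.1 + G₂ (e y).1.2 := by
  rcases exists_rep x with ⟨z, k, hz, rfl⟩ | ⟨k, rfl⟩
  · left
    obtain ⟨i, hi, G, hG, hφ⟩ := h z k rfl
    refine ⟨regularChart hvw k hz hi, G, hG, eventually_nhds hvw ?_⟩
    intro z' k' h'
    obtain ⟨rfl, rfl⟩ := Prod.mk.inj ((mk_eq_iff_of_ne hvw hz).1 h')
    filter_upwards [hφ] with y hy
    rw [hy]
    congr 1
    change _ = CP.affine i (retraction v w k' (incl v w k' y)) - 0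
    rw [retraction_incl, sub_zero]
  · right
    obtain ⟨i, hi, G, hG, hφ⟩ := h w k rfl
    obtain ⟨j, hj, G', hG', hφ'⟩ := h v (k + 1) (mk_node k).symm
    obtain ⟨d, rfl, rfl⟩ := exists_nodeData hvw hi hj
    have hw := hφ.self_of_nhds
    have hv := hφ'.self_of_nhds
    rw [← mk_node] at hv
    refine ⟨nodeChart d k hvw, node_mem_source d k, isBihol_nodeChart d k hvw,
      fun x => G (x + CP.affine d.i w) + 0,
      fun x => G' (x + CP.affine d.j v) + (- φ (ChainCP.mk v w (w, k))), hP _ _ _ hG, hP _ _ _ hG',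
      eventually_nhds hvw ?_⟩
    intro z k' h'
    rw [coe_nodeChart]
    rcases (mk_eq_node_iff hvw).1 h' with h' | h' <;> obtain ⟨rfl, rfl⟩ := Prod.mk.inj h'
    · filter_upwards [hφ, (CP.isOpen_polydisc d.i z d.r).mem_nhds
        (CP.self_mem_polydisc d.w_mem d.r_pos)] with y hy hy'
      rw [nodeFun_left d k' hy', hy]
      simp only [crossLeft, sub_add_cancel, zero_add]
      rw [← hv]
      ring
    · filter_upwards [hφ', (CP.isOpen_polydisc d.j z d.r).mem_nhds
        (CP.self_mem_polydisc d.v_mem d.r_pos)] with y hy hy'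
      rw [nodeFun_right d k hy', hy]
      simp only [crossRight, sub_add_cancel, zero_add]
      rw [← hw]
      ring

/-- A function on `X̃` is smooth if its restrictions to the components are. -/
theorem isSmoothAt_of_components (hvw : v ≠ w) {φ : ChainCP v w → ℝ} {x : ChainCP v w}
    (h : ∀ z k, ChainCP.mk v w (z, k) = x → ∃ i, z ∈ CP.dom i ∧ ∃ G, ContDiff ℝ (⊤ : ℕ∞) G ∧
      ∀ᶠ y in 𝓝 z, φ (ChainCP.mk v w (y, k)) = G (CP.affine i y)) :
    IsSmoothAt (ChainCP.sheaf v w) φ x := by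
  rcases exists_local_form hvw (fun G => ContDiff ℝ (⊤ : ℕ∞) G)
    (fun G c d hG => (hG.comp (contDiff_id.add contDiff_const)).add contDiff_const) h with
    ⟨c, G, hG, hφ⟩ | ⟨e, hx, he, G₁, G₂, h₁, h₂, hφ⟩
  · exact isSmoothAt_of_regularChart c hG hφ
  · exact isSmoothAt_of_crossChart he hx h₁ h₂ hφ

/-- A function on `X̃` is smooth and strongly plurisubharmonic if its restrictions to the
components are. -/
theorem isSmoothStronglyPshAt_of_components (hvw : v ≠ w) {φ : ChainCP v w → ℝ} {x : ChainCP v w}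
    (h : ∀ z k, ChainCP.mk v w (z, k) = x → ∃ i, z ∈ CP.dom i ∧ ∃ G, (ContDiff ℝ (⊤ : ℕ∞) G ∧
      ∀ z ξ, ξ ≠ 0 → 0 < ddbar G z ξ (Complex.I • ξ)) ∧
      ∀ᶠ y in 𝓝 z, φ (ChainCP.mk v w (y, k)) = G (CP.affine i y)) :
    IsSmoothStronglyPshAt (ChainCP.sheaf v w) φ x := by
  rcases exists_local_form hvw (fun G => ContDiff ℝ (⊤ : ℕ∞) G ∧
      ∀ z ξ, ξ ≠ 0 → 0 < ddbar G z ξ (Complex.I • ξ)) (by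
    rintro G c d ⟨hG, hL⟩
    refine ⟨(hG.comp (contDiff_id.add contDiff_const)).add contDiff_const, fun z ξ hξ => ?_⟩
    rw [ddbar_add_const]
    have := ddbar_comp_affine (ContinuousLinearMap.id ℂ (Fin n → ℂ)) c (x := z)
      (u := G) (contDiff_infty.1 hG 2).contDiffAt ξ (Complex.I • ξ)
    exact (hL (z + c) ξ hξ).trans_eq this.symm) h with
    ⟨c, G, ⟨hG, hL⟩, hφ⟩ | ⟨e, hx, he, G₁, G₂, ⟨h₁, hL₁⟩, ⟨h₂, hL₂⟩, hφ⟩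
  · exact isSmoothStronglyPshAt_of_regularChart c hG hL hφ
  · exact isSmoothStronglyPshAt_of_crossChart he hx h₁ h₂ hL₁ hL₂ hφ

end ChainCP

/-! ### The glued projective space -/

namespace GluedCP

variable {n : ℕ} {v w : CP n}

theorem mk_surjective : Function.Surjective (GluedCP.mk v w) := Quot.mk_surjective

theorem mk_node : GluedCP.mk v w v = GluedCP.mk v w w := Quot.sound ⟨rfl, rfl⟩

theorem mk_eq_iff (hvw : v ≠ w) {a b : CP n} : GluedCP.mk v w a = GluedCP.mk v w b ↔
    a = b ∨ (a = v ∧ b = w) ∨ (a = w ∧ b = v) := by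
  constructor
  · intro h
    classical
    let N : CP n → CP n := fun a => if a = v then w else a
    have hN : N a = N b := congrArg (Quot.lift N (by
      rintro _ _ ⟨rfl, rfl⟩
      simp [N])) h
    by_cases h1 : a = v <;> by_cases h2 : b = v
    · exact Or.inl (h1.trans h2.symm)
    · exact Or.inr (Or.inl ⟨h1, by simpa [N, h1, h2] using hN.symm⟩)
    · exact Or.inr (Or.inr ⟨by simpa [N, h1, h2] using hN, h2⟩)
    · left
      simpa [N, h1, h2] using hN
  · rintro (rfl | ⟨rfl, rfl⟩ | ⟨rfl, rfl⟩)
    exacts [rfl, mk_node, mk_node.symm]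

theorem mk_eq_node_iff (hvw : v ≠ w) {a : CP n} :
    GluedCP.mk v w a = GluedCP.mk v w v ↔ a = v ∨ a = w := by
  rw [mk_eq_iff hvw]
  constructor
  · rintro (h | ⟨-, h⟩ | ⟨h, -⟩)
    exacts [Or.inl h, absurd h hvw, Or.inr h]
  · rintro (h | h)
    exacts [Or.inl h, Or.inr (Or.inr ⟨h, rfl⟩)]

theorem isClosedMap_mk (hvw : v ≠ w) : IsClosedMap (GluedCP.mk v w) := by
  intro A hA
  have hq : IsQuotientMap (GluedCP.mk v w) := isQuotientMap_quot_mk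
  rw [← hq.isClosed_preimage]
  have : GluedCP.mk v w ⁻¹' (GluedCP.mk v w '' A) = A ∪ {a | a = w ∧ v ∈ A} ∪
      {a | a = v ∧ w ∈ A} := by
    ext a
    constructor
    · rintro ⟨b, hb, h⟩
      rcases (mk_eq_iff hvw).1 h with rfl | ⟨rfl, rfl⟩ | ⟨rfl, rfl⟩
      · exact Or.inl (Or.inl hb)
      · exact Or.inl (Or.inr ⟨rfl, hb⟩)
      · exact Or.inr ⟨rfl, hb⟩
    · rintro ((h | ⟨rfl, h⟩) | ⟨rfl, h⟩)
      exacts [⟨_, h, rfl⟩, ⟨_, h, mk_node⟩, ⟨_, h, mk_node.symm⟩]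
  rw [this]
  exact (hA.union ((finite_singleton w).subset fun a ha => ha.1).isClosed).union
    ((finite_singleton v).subset fun a ha => ha.1).isClosed

theorem t2Space (hvw : v ≠ w) : T2Space (GluedCP v w) := by
  refine t2Space_of_isClosedMap (isClosedMap_mk hvw) mk_surjective fun x => Set.Finite.isCompact ?_
  obtain ⟨z, rfl⟩ := mk_surjective x
  refine (((finite_singleton w).insert v).insert z).subset fun a ha => ?_
  rcases (mk_eq_iff hvw).1 ha with h | ⟨h, -⟩ | ⟨h, -⟩
  exacts [Or.inl h, Or.inr (Or.inl h), Or.inr (Or.inr h)]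

instance compactSpace : CompactSpace (GluedCP v w) :=
  mk_surjective.compactSpace (continuous_mk v w)

instance pathConnectedSpace : PathConnectedSpace (GluedCP v w) :=
  mk_surjective.pathConnectedSpace (continuous_mk v w)

theorem holAt_iff (hvw : v ≠ w) {x : GluedCP v w} {f : GluedCP v w → ℂ} :
    (GluedCP.sheaf v w).holAt x f ↔ ∀ z, GluedCP.mk v w z = x →
      (CP.sheaf n).holAt z (f ∘ GluedCP.mk v w) :=
  quotientSheaf_holAt_iff _ (continuous_mk v w) (isClosedMap_mk hvw)

end GluedCP

/-! ### The universal covering -/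

namespace ChainCP

variable {n : ℕ} {v w : CP n}

@[simp]
theorem proj_mk (a : CP n × ℤ) : proj v w (ChainCP.mk v w a) = GluedCP.mk v w a.1 := rfl

theorem proj_surjective : Function.Surjective (proj v w) := fun x => by
  obtain ⟨z, rfl⟩ := GluedCP.mk_surjective x
  exact ⟨ChainCP.mk v w (z, 0), rfl⟩

/-- The group `ℤ` acts on `X̃` by shifts. -/
instance : AddAction ℤ (ChainCP v w) where
  vadd j := shiftFun v w j
  zero_vadd := by
    rintro ⟨z, k⟩
    change ChainCP.mk v w (z, k + 0) = ChainCP.mk v w (z, k)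
    rw [add_zero]
  add_vadd := by
    rintro i j ⟨z, k⟩
    change ChainCP.mk v w (z, k + (i + j)) = ChainCP.mk v w (z, k + j + i)
    rw [add_assoc, add_comm i j]

theorem vadd_mk (j : ℤ) (a : CP n × ℤ) :
    j +ᵥ ChainCP.mk v w a = ChainCP.mk v w (a.1, a.2 + j) := rfl

theorem proj_vadd (j : ℤ) (x : ChainCP v w) : proj v w (j +ᵥ x) = proj v w x := by
  obtain ⟨a, rfl⟩ := mk_surjective x
  rfl

/-- The function `[z, k] ↦ k + χ(z)`, for a function `χ` with `χ(v) = 0` and `χ(w) = 1`. -/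
def height (χ : CP n → ℝ) (hv : χ v = 0) (hw : χ w = 1) : ChainCP v w → ℝ :=
  Quot.lift (fun a => a.2 + χ a.1) (by
    rintro _ _ ⟨k, rfl, rfl⟩
    push_cast
    simp [hv, hw])

theorem height_mk {χ : CP n → ℝ} (hv : χ v = 0) (hw : χ w = 1) (z : CP n) (k : ℤ) :
    height χ hv hw (ChainCP.mk v w (z, k)) = k + χ z := rfl

theorem continuous_height {χ : CP n → ℝ} (hv : χ v = 0) (hw : χ w = 1) (hχ : Continuous χ) :
    Continuous (height χ hv hw) := by
  refine continuous_quot_lift _ ?_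
  have : Continuous fun k : ℤ => (k : ℝ) := continuous_of_discreteTopology
  exact (this.comp continuous_snd).add (hχ.comp continuous_fst)

theorem height_vadd {χ : CP n → ℝ} (hv : χ v = 0) (hw : χ w = 1) (j : ℤ) (x : ChainCP v w) :
    height χ hv hw (j +ᵥ x) = height χ hv hw x + j := by
  obtain ⟨⟨z, k⟩, rfl⟩ := mk_surjective x
  rw [vadd_mk, height_mk, height_mk]
  push_cast
  ring

theorem proj_eq_iff (hvw : v ≠ w) {x y : ChainCP v w} :
    proj v w x = proj v w y ↔ ∃ j : ℤ, j +ᵥ y = x := by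
  constructor
  · obtain ⟨⟨z, k⟩, rfl⟩ := mk_surjective x
    obtain ⟨⟨z', k'⟩, rfl⟩ := mk_surjective y
    intro h
    rcases (GluedCP.mk_eq_iff hvw).1 h with h | ⟨h, h'⟩ | ⟨h, h'⟩
    · exact ⟨k - k', by rw [vadd_mk, add_sub_cancel]; exact congrArg _ (Prod.ext h.symm rfl)⟩
    · refine ⟨k - 1 - k', ?_⟩
      obtain rfl : z = v := h
      obtain rfl : z' = w := h'
      rw [vadd_mk, add_sub_cancel, mk_node, sub_add_cancel]
    · refine ⟨k + 1 - k', ?_⟩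
      obtain rfl : z = w := h
      obtain rfl : z' = v := h'
      rw [vadd_mk, add_sub_cancel, mk_node]
  · rintro ⟨j, rfl⟩
    exact proj_vadd j y

/-- The projection is the quotient by the action of `ℤ`, which is properly discontinuous because
the height function is translated by it. -/
theorem isAddQuotientCoveringMap (hvw : v ≠ w) : IsAddQuotientCoveringMap (proj v w) ℤ where
  toIsQuotientMap := by
    refine IsQuotientMap.of_comp (continuous_incl (v := v) (w := w) 0) (proj v w).continuous ?_
    exact (isQuotientMap_quot_mk : IsQuotientMap (GluedCP.mk v w))
  continuous_const_vadd j := continuous_shiftFun v w j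
  apply_eq_iff_mem_orbit := proj_eq_iff hvw
  disjoint x := by
    obtain ⟨χ, hχ, hv, hw, -⟩ := CP.exists_smooth_separating hvw
    refine ⟨height χ hv hw ⁻¹' Metric.ball (height χ hv hw x) (1 / 2),
      (continuous_height hv hw hχ).continuousAt.preimage_mem_nhds
        (Metric.ball_mem_nhds _ (by norm_num)), ?_⟩
    rintro j ⟨_, ⟨y, hy, rfl⟩, hy'⟩
    have h1 : |height χ hv hw y - height χ hv hw x| < 1 / 2 := hy
    have h2 : |height χ hv hw (j +ᵥ y) - height χ hv hw x| < 1 / 2 := hy'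
    rw [height_vadd] at h2
    rw [abs_lt] at h1 h2
    have h3 : (j : ℝ) < 1 := by linarith
    have h4 : (-1 : ℝ) < j := by linarith
    have h5 : j < 1 := by exact_mod_cast h3
    have h6 : -1 < j := by exact_mod_cast h4
    omega

theorem isCoveringMap_proj (hvw : v ≠ w) : IsCoveringMap (proj v w) :=
  (isAddQuotientCoveringMap hvw).isCoveringMap

/-- The components through a point of `X̃` correspond to the branches of `X` at its image. -/
theorem isLocalBihol_proj (hvw : v ≠ w) :
    IsLocalBihol (ChainCP.sheaf v w) (GluedCP.sheaf v w) (proj v w) := by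
  intro x
  obtain ⟨e, hx, he⟩ := (isCoveringMap_proj hvw).isLocalHomeomorph x
  refine ⟨e, hx, fun y _ => (congrFun he y).symm, fun y _ f => ?_⟩
  rw [← he, holAt_iff hvw, GluedCP.holAt_iff hvw]
  constructor
  · intro h z hz
    obtain ⟨j, hj⟩ := (proj_eq_iff hvw).1
      (show proj v w y = proj v w (ChainCP.mk v w (z, 0)) from hz.symm)
    exact h z _ hj
  · rintro h z k rfl
    exact h z rfl

theorem connectedSpace : ConnectedSpace (ChainCP v w) := by
  have : Nonempty (ChainCP v w) := ⟨ChainCP.mk v w (v, 0)⟩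
  have hr : ∀ k, IsPreconnected (range (incl v w k)) := fun k =>
    isPreconnected_range (continuous_incl k)
  have hnext : ∀ k : ℤ, (range (incl v w k) ∩ range (incl v w (k + 1))).Nonempty := fun k =>
    ⟨_, ⟨w, rfl⟩, ⟨v, (mk_node k).symm⟩⟩
  have h := IsPreconnected.iUnion_of_chain hr hnext
  have hu : ⋃ k, range (incl v w k) = univ := eq_univ_of_forall fun x => by
    obtain ⟨⟨z, k⟩, rfl⟩ := mk_surjective x
    exact mem_iUnion.2 ⟨k, z, rfl⟩
  rw [hu] at h
  exact { isPreconnected_univ := h, toNonempty := this }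

theorem shift_zpow_apply (j : ℤ) (x : ChainCP v w) : (shift v w ^ j) x = j +ᵥ x := by
  induction j using Int.induction_on with
  | zero => rw [zpow_zero, zero_vadd]; rfl
  | succ i ih =>
    rw [add_comm (i : ℤ), zpow_add, zpow_one, add_vadd, ← ih]
    rfl
  | pred i ih =>
    rw [sub_eq_add_neg, add_comm (-(i : ℤ)), zpow_add, zpow_neg_one, add_vadd, ← ih]
    rfl

/-- The deck transformations of `X̃` are the powers of the shift: two of them which agree at a point
are equal, and the shifts act transitively on the fibres. -/
theorem deck_iff (hvw : v ≠ w) (h : ChainCP v w ≃ₜ ChainCP v w) :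
    (∀ y, proj v w (h y) = proj v w y) ↔ h ∈ Subgroup.zpowers (shift v w) := by
  constructor
  · intro hh
    have := connectedSpace (v := v) (w := w)
    obtain ⟨x⟩ : Nonempty (ChainCP v w) := inferInstance
    obtain ⟨j, hj⟩ := (proj_eq_iff hvw).1 (hh x)
    refine Subgroup.mem_zpowers_iff.2 ⟨j, ?_⟩
    refine Homeomorph.ext fun y => ?_
    refine congrFun ((isCoveringMap_proj hvw).eq_of_comp_eq (g₁ := ⇑(shift v w ^ j)) (g₂ := ⇑h)
      (Homeomorph.continuous _) h.continuous (funext fun y => ?_) x ?_) y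
    · change proj v w ((shift v w ^ j) y) = proj v w (h y)
      rw [hh, shift_zpow_apply, proj_vadd]
    · rw [shift_zpow_apply, hj]
  · rintro hh y
    obtain ⟨j, rfl⟩ := Subgroup.mem_zpowers_iff.1 hh
    rw [shift_zpow_apply, proj_vadd]

end ChainCP

/-! ### The complex structure of the glued space -/

namespace GluedCP

variable {n : ℕ} {v w : CP n}

/-- Biholomorphic inverses of the projection, from the glued space to the chain. -/
theorem exists_section (hvw : v ≠ w) (y : ChainCP v w) :
    ∃ e : OpenPartialHomeomorph (GluedCP v w) (ChainCP v w),
      ChainCP.proj v w y ∈ e.source ∧ e (ChainCP.proj v w y) = y ∧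
      IsBihol (GluedCP.sheaf v w) (ChainCP.sheaf v w) e := by
  obtain ⟨e, hx, he, hb⟩ := ChainCP.isLocalBihol_proj hvw y
  have hy := he hx
  refine ⟨e.symm, ?_, ?_, hb.symm⟩
  · rw [← hy]
    exact e.map_source hx
  · rw [← hy]
    exact e.left_inv hx

theorem isComplexSpace (hvw : v ≠ w) : IsComplexSpace (GluedCP.sheaf v w) := by
  have h : ∀ x, Nonempty (LocalEmbedding (GluedCP.sheaf v w) x) := fun x => by
    obtain ⟨y, rfl⟩ := ChainCP.proj_surjective x
    obtain ⟨e, he, -, hb⟩ := exists_section hvw y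
    obtain ⟨c⟩ := ChainCP.exists_localEmbedding hvw (e (ChainCP.proj v w y))
    exact ⟨c.comp hb he⟩
  exact ⟨t2Space hvw, secondCountableTopology_of_localEmbedding h, h⟩

theorem germIso_cross (hvw : v ≠ w) :
    GermIso (GluedCP.sheaf v w) (GluedCP.mk v w v) (subSheaf (crossSet n)) (crossOrigin n) := by
  obtain ⟨i, hi⟩ := CP.exists_mem_dom w
  obtain ⟨j, hj⟩ := CP.exists_mem_dom v
  obtain ⟨d, -, -⟩ := exists_nodeData hvw hi hj
  obtain ⟨e, he, he', hb⟩ := exists_section hvw (ChainCP.mk v w (w, 0))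
  rw [ChainCP.proj_mk, ← mk_node] at he he'
  refine ⟨e.trans (ChainCP.nodeChart d 0 hvw), ?_, ?_, hb.trans (ChainCP.isBihol_nodeChart d 0 hvw)⟩
  · rw [OpenPartialHomeomorph.trans_source]
    refine ⟨he, ?_⟩
    rw [mem_preimage, he']
    exact ChainCP.node_mem_source d 0
  · change ChainCP.nodeFun d 0 (e _) = _
    rw [he', ChainCP.nodeFun_node]

theorem not_isIrreducibleAt_node (hvw : v ≠ w) :
    ¬ IsIrreducibleAt (GluedCP.sheaf v w) (GluedCP.mk v w v) := by
  obtain ⟨e, hx, hx0, he⟩ := germIso_cross hvw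
  exact not_isIrreducibleAt_of_crossChart (CP.dim_pos_of_ne hvw) he hx hx0

theorem exists_regularChart (hvw : v ≠ w) {x : GluedCP v w} (hx : x ≠ GluedCP.mk v w v) :
    Nonempty (RegularChart (GluedCP.sheaf v w) x n) := by
  obtain ⟨z, rfl⟩ := mk_surjective x
  rw [Ne, mk_eq_node_iff hvw, not_or] at hx
  obtain ⟨e, he, he', hb⟩ := exists_section hvw (ChainCP.mk v w (z, 0))
  obtain ⟨i, hi⟩ := CP.exists_mem_dom z
  have c := ChainCP.regularChart hvw 0 hx hi
  rw [← he'] at c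
  exact ⟨c.comp hb he⟩

theorem not_isRegularPt_iff (hvw : v ≠ w) (x : GluedCP v w) :
    ¬ IsRegularPt (GluedCP.sheaf v w) x ↔ x = GluedCP.mk v w v := by
  constructor
  · intro h
    by_contra hx
    exact h ⟨n, exists_regularChart hvw hx⟩
  · rintro rfl ⟨k, ⟨c⟩⟩
    exact not_isIrreducibleAt_node hvw c.isIrreducibleAt

theorem hasPureDim (hvw : v ≠ w) : HasPureDim (GluedCP.sheaf v w) n := by
  rintro x k ⟨c⟩
  have hx : x ≠ GluedCP.mk v w v := fun h => (not_isRegularPt_iff hvw x).2 h ⟨k, ⟨c⟩⟩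
  obtain ⟨c'⟩ := exists_regularChart hvw hx
  exact c.dim_eq c'

end GluedCP

/-! ### Simple connectivity -/

section PathClasses

variable {X : Type*} [TopologicalSpace X]

theorem trans_cast_right {a b c d : X} (P : Path.Homotopic.Quotient a b)
    (Q : Path.Homotopic.Quotient b c) (h : d = c) :
    P.trans (Q.cast rfl h) = (P.trans Q).cast rfl h := by
  subst h
  simp

/-- Classes of paths from a base point to all points of a space, which are compatible with all
short paths, are compatible with all paths. -/
theorem trans_mk_eq_of_local {b : X} (G : ∀ x, Path.Homotopic.Quotient b x)
    (h : ∀ x, ∃ U ∈ 𝓝 x, ∀ (y z : X) (δ : Path y z), range δ ⊆ U →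
      (G y).trans (Path.Homotopic.Quotient.mk δ) = G z) {y z : X} (δ : Path y z) :
    (G y).trans (Path.Homotopic.Quotient.mk δ) = G z := by
  let P : unitInterval → unitInterval → Prop := fun s t =>
    (G (δ s)).trans (Path.Homotopic.Quotient.mk (δ.subpath s t)) = G (δ t)
  have hloc : ∀ s, ∀ᶠ t in 𝓝 s, P s t ∧ P t s := by
    intro s
    obtain ⟨U, hU, H⟩ := h (δ s)
    have h1 : δ ⁻¹' U ∈ 𝓝 s := δ.continuous.continuousAt hU
    have h2 : Tendsto (fun t => uIcc s t) (𝓝 s) (𝓝 s).smallSets :=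
      tendsto_const_nhds.uIcc tendsto_id
    filter_upwards [h2.eventually (eventually_smallSets_subset.2 h1)] with t ht
    refine ⟨H _ _ _ ?_, H _ _ _ ?_⟩
    · rw [Path.range_subpath]
      exact image_subset_iff.2 ht
    · rw [Path.range_subpath, uIcc_comm]
      exact image_subset_iff.2 ht
  have htrans : IsTrans unitInterval P := ⟨fun r s t h1 h2 => by
    change _ = _ at h1
    change _ = _ at h2
    change _ = _
    rw [← h2, ← h1, Path.Homotopic.Quotient.trans_assoc, ← Path.Homotopic.Quotient.mk_trans]
    congr 1
    exact (Path.Homotopic.Quotient.eq.2 ⟨Path.Homotopy.subpathTransSubpath δ r s t⟩).symm⟩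
  have h01 : P 0 1 := PreconnectedSpace.induction₂' P hloc htrans 0 1
  have key : ∀ (y' z' : X) (hy : y' = y) (hz : z' = z),
      (G y').trans ((Path.Homotopic.Quotient.mk δ).cast hy hz) = G z' →
        (G y).trans (Path.Homotopic.Quotient.mk δ) = G z := by
    rintro _ _ rfl rfl h
    simpa using h
  refine key _ _ δ.source δ.target ?_
  change _ = _ at h01
  rwa [Path.subpath_zero_one, Path.Homotopic.Quotient.mk_cast] at h01

/-- A space is simply connected if there are classes of paths from a base point to all
points of it, which are compatible with all short paths. -/
theorem simplyConnectedSpace_of_local {b : X} (G : ∀ x, Path.Homotopic.Quotient b x)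
    (h : ∀ x, ∃ U ∈ 𝓝 x, ∀ (y z : X) (δ : Path y z), range δ ⊆ U →
      (G y).trans (Path.Homotopic.Quotient.mk δ) = G z) : SimplyConnectedSpace X := by
  rw [simply_connected_iff_paths_homotopic']
  have hj : ∀ x, Joined b x := fun x => ⟨(Path.Homotopic.Quotient.mk_surjective (G x)).choose⟩
  refine ⟨⟨⟨b⟩, fun x y => (hj x).symm.trans (hj y)⟩, fun {x y} p q => ?_⟩
  have key : ∀ p : Path x y, Path.Homotopic.Quotient.mk p = (G x).symm.trans (G y) := by
    intro p
    rw [← trans_mk_eq_of_local G h p, ← Path.Homotopic.Quotient.trans_assoc]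
    simp
  exact Path.Homotopic.Quotient.exact ((key p).trans (key q).symm)

theorem homotopic_of_range_subset {A : Set X} (hA : IsSimplyConnected A) {x y : X}
    (p q : Path x y) (hp : range p ⊆ A) (hq : range q ⊆ A) : p.Homotopic q := by
  have := hA.simplyConnectedSpace
  have hx : x ∈ A := hp ⟨0, p.source⟩
  have hy : y ∈ A := hp ⟨1, p.target⟩
  let res : ∀ r : Path x y, range r ⊆ A → Path (⟨x, hx⟩ : A) ⟨y, hy⟩ := fun r hr =>
    { toFun := fun t => ⟨r t, hr ⟨t, rfl⟩⟩
      continuous_toFun := r.continuous.subtype_mk _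
      source' := Subtype.ext r.source
      target' := Subtype.ext r.target }
  exact (SimplyConnectedSpace.paths_homotopic (res p hp) (res q hq)).map
    ⟨Subtype.val, continuous_subtype_val⟩

theorem isSimplyConnected_source {Y : Type*} [TopologicalSpace Y] (e : OpenPartialHomeomorph X Y)
    (h : IsSimplyConnected e.target) : IsSimplyConnected e.source := by
  have := h.simplyConnectedSpace
  exact e.toHomeomorphSourceTarget.toHomotopyEquiv.simplyConnectedSpace

end PathClasses

namespace CP

variable {n : ℕ}

theorem isSimplyConnected_dom (i : Fin (n + 1)) : IsSimplyConnected (dom (n := n) i) := by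
  refine isSimplyConnected_source (chart i 0) ?_
  have : ContractibleSpace (univ : Set (Fin n → ℂ)) := convex_univ.contractibleSpace univ_nonempty
  exact (inferInstance : SimplyConnectedSpace (univ : Set (Fin n → ℂ)))

theorem isPathConnected_dom_inter (i j : Fin (n + 1)) :
    IsPathConnected (dom (n := n) i ∩ dom j) := by
  obtain rfl | ⟨l, rfl⟩ := Fin.eq_self_or_eq_succAbove i j
  · rw [inter_self]
    exact (isSimplyConnected_dom _).isPathConnected
  have h0 : IsPathConnected ({0}ᶜ : Set ℂ) :=
    isPathConnected_compl_singleton_of_one_lt_rank (by simp) 0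
  have hS : IsPathConnected (univ.pi fun m : Fin n => if m = l then ({0}ᶜ : Set ℂ) else univ) := by
    refine IsPathConnected.pi fun m => ?_
    split_ifs
    exacts [h0, isPathConnected_univ]
  convert hS.image (continuous_ofAffine i)
  ext y
  constructor
  · rintro ⟨hi, hj⟩
    refine ⟨affine i y, fun m _ => ?_, ofAffine_affine hi⟩
    change _ ∈ ite _ _ _
    split_ifs with hm
    · obtain ⟨z, rfl⟩ := mk_surjective y
      subst hm
      exact div_ne_zero (mk_mem_dom.1 hj) (mk_mem_dom.1 hi)
    · trivial
  · rintro ⟨x, hx, rfl⟩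
    refine ⟨ofAffine_mem_dom i x, mk_mem_dom.2 ?_⟩
    have := hx l trivial
    simpa using this

/-- Projective space is covered by affine spaces, any two of which have a path connected
intersection. -/
instance simplyConnectedSpace : SimplyConnectedSpace (CP n) := by
  choose i hi using fun y : CP n => exists_mem_dom y
  have hJ : ∀ y : CP n, JoinedIn (dom (i y)) (ones n) y := fun y =>
    (isSimplyConnected_dom _).isPathConnected.joinedIn _ (ones_mem_dom _) _ (hi y)
  let G : ∀ y : CP n, Path.Homotopic.Quotient (ones n) y := fun y =>
    Path.Homotopic.Quotient.mk (hJ y).somePath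
  have hG : ∀ (y : CP n) (j : Fin (n + 1)) (γ : Path (ones n) y), range γ ⊆ dom j →
      G y = Path.Homotopic.Quotient.mk γ := by
    intro y j γ hγ
    have hy : y ∈ dom j := hγ ⟨1, γ.target⟩
    obtain ⟨δ, hδ⟩ := (isPathConnected_dom_inter (i y) j).joinedIn _
      ⟨ones_mem_dom _, ones_mem_dom _⟩ _ ⟨hi y, hy⟩
    have h1 : (hJ y).somePath.Homotopic δ :=
      homotopic_of_range_subset (isSimplyConnected_dom (i y)) _ _
      (range_subset_iff.2 (hJ y).somePath_mem) (range_subset_iff.2 fun t => (hδ t).1)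
    have h2 : δ.Homotopic γ := homotopic_of_range_subset (isSimplyConnected_dom j) _ _
      (range_subset_iff.2 fun t => (hδ t).2) hγ
    exact Path.Homotopic.Quotient.eq.2 (h1.trans h2)
  refine simplyConnectedSpace_of_local G fun x => ⟨dom (i x), (isOpen_dom _).mem_nhds (hi x), ?_⟩
  intro y z δ hδ
  have hy : y ∈ dom (i x) := hδ ⟨0, δ.source⟩
  obtain ⟨γ, hγ⟩ := (isSimplyConnected_dom (i x)).isPathConnected.joinedIn _ (ones_mem_dom _) _ hy
  have hγ' : range γ ⊆ dom (i x) := range_subset_iff.2 hγ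
  rw [hG y _ γ hγ', ← Path.Homotopic.Quotient.mk_trans, hG z (i x) (γ.trans δ)]
  rw [Path.trans_range]
  exact union_subset hγ' hδ

theorem isPathConnected_polydisc {i : Fin (n + 1)} {y : CP n} {r : ℝ} (hr : 0 < r) :
    IsPathConnected (polydisc i y r) := by
  have h1 : IsPathConnected (Metric.ball (0 : Fin n → ℂ) r) :=
    (convex_ball 0 r).isPathConnected (Metric.nonempty_ball.2 hr)
  have h2 : Continuous fun x : Fin n → ℂ => ofAffine i (x + affine i y) :=
    (continuous_ofAffine i).comp (by fun_prop)
  convert h1.image h2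
  ext z
  constructor
  · rintro ⟨hz, hz'⟩
    exact ⟨affine i z - affine i y, by simpa using hz', by simp [ofAffine_affine hz]⟩
  · rintro ⟨x, hx, rfl⟩
    exact ofAffine_mem_polydisc.2 (by simpa using hx)

end CP

/-- A recursively defined section of a family of sets indexed by `ℤ` with bijections between
consecutive members. -/
theorem exists_int_section {α : ℤ → Type*} (a : α 0)
    (E : ∀ k k' : ℤ, k' = k + 1 → α k ≃ α k') :
    ∃ c : ∀ k, α k, ∀ (k k' : ℤ) (h : k' = k + 1), c k' = E k k' h (c k) := by
  let f : ∀ m : ℕ, α (Int.ofNat m) := fun m =>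
    Nat.rec a (fun m x => E m (Int.ofNat (m + 1)) rfl x) m
  let g : ∀ m : ℕ, α (Int.negSucc m) := fun m => Nat.rec ((E (Int.negSucc 0) 0 rfl).symm a)
    (fun m x => (E (Int.negSucc (m + 1)) (Int.negSucc m) (by omega)).symm x) m
  refine ⟨fun k => Int.rec f g k, ?_⟩
  rintro (m | _ | m) k' h
  · obtain rfl : k' = Int.ofNat (m + 1) := h
    rfl
  · obtain rfl : k' = Int.ofNat 0 := h
    exact ((E (Int.negSucc 0) 0 rfl).apply_symm_apply a).symm
  · obtain rfl : k' = Int.negSucc m := by omega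
    exact ((E (Int.negSucc (m + 1)) (Int.negSucc m) h).apply_symm_apply (g m)).symm

namespace ChainCP

variable {n : ℕ} {v w : CP n}

theorem isSimplyConnected_nodeSource (hvw : v ≠ w) (d : NodeData v w) (k : ℤ) :
    IsSimplyConnected (nodeSource d k) := by
  refine isSimplyConnected_source (nodeChart d k hvw) ?_
  rw [← IsEmbedding.subtypeVal.isSimplyConnected_image]
  have hS : (Subtype.val '' (nodeChart d k hvw).target : Set ((Fin n → ℂ) × (Fin n → ℂ))) =
      {p | (p.1 = 0 ∨ p.2 = 0) ∧ ‖p.1‖ < d.r ∧ ‖p.2‖ < d.r} := by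
    ext p
    constructor
    · rintro ⟨q, hq, rfl⟩
      exact ⟨q.2, hq⟩
    · rintro ⟨h1, h2⟩
      exact ⟨⟨p, h1⟩, h2, rfl⟩
  rw [hS]
  have hstar : StarConvex ℝ (0 : (Fin n → ℂ) × (Fin n → ℂ))
      {p | (p.1 = 0 ∨ p.2 = 0) ∧ ‖p.1‖ < d.r ∧ ‖p.2‖ < d.r} := by
    rintro p ⟨h1, h2, h3⟩ a b ha hb hab
    have hb1 : b ≤ 1 := by linarith
    have hn : ∀ x : Fin n → ℂ, ‖x‖ < d.r → ‖b • x‖ < d.r := fun x hx => by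
      rw [norm_smul, Real.norm_of_nonneg hb]
      exact (mul_le_of_le_one_left (norm_nonneg x) hb1).trans_lt hx
    rw [smul_zero, zero_add]
    refine ⟨?_, hn _ h2, hn _ h3⟩
    rcases h1 with h | h
    · exact Or.inl (by simp [h])
    · exact Or.inr (by simp [h])
  have := hstar.contractibleSpace ⟨0, Or.inl rfl, by simpa using d.r_pos, by simpa using d.r_pos⟩
  exact (inferInstance : SimplyConnectedSpace
    {p : (Fin n → ℂ) × (Fin n → ℂ) | (p.1 = 0 ∨ p.2 = 0) ∧ ‖p.1‖ < d.r ∧ ‖p.2‖ < d.r})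

/-- Points near a node are joined to it inside the given neighbourhood and inside a component. -/
theorem exists_path_node (d : NodeData v w) (k : ℤ) {x : ChainCP v w} (hx : x ∈ nodeSource d k) :
    ∃ (m : ℤ) (γ : Path x (ChainCP.mk v w (w, k))),
      range γ ⊆ nodeSource d k ∧ range γ ⊆ range (incl v w m) := by
  obtain ⟨⟨z, m⟩, rfl⟩ := mk_surjective x
  rcases (mk_mem_nodeSource d k).1 hx with ⟨rfl, hz⟩ | ⟨rfl, hz⟩
  · obtain ⟨γ, hγ⟩ := (CP.isPathConnected_polydisc d.r_pos).joinedIn _ hz _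
      (CP.self_mem_polydisc d.w_mem d.r_pos)
    refine ⟨m, γ.map (continuous_incl m), ?_, ?_⟩
    · exact range_subset_iff.2 fun t => Or.inl ⟨rfl, hγ t⟩
    · exact range_subset_iff.2 fun t => ⟨γ t, rfl⟩
  · obtain ⟨γ, hγ⟩ := (CP.isPathConnected_polydisc d.r_pos).joinedIn _ hz _
      (CP.self_mem_polydisc d.v_mem d.r_pos)
    refine ⟨k + 1, (γ.map (continuous_incl (k + 1))).cast rfl (mk_node k), ?_, ?_⟩
    · exact range_subset_iff.2 fun t => Or.inr ⟨rfl, hγ t⟩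
    · exact range_subset_iff.2 fun t => ⟨γ t, rfl⟩

/-- The class of the paths from `[v, k]` to `[z, k]` in the component `X̃_k`. -/
def componentClass (v w : CP n) (k : ℤ) (z : CP n) :
    Path.Homotopic.Quotient (ChainCP.mk v w (v, k)) (ChainCP.mk v w (z, k)) :=
  Path.Homotopic.Quotient.mk ((PathConnectedSpace.somePath v z).map (continuous_incl k))

theorem componentClass_trans (k : ℤ) {y z : CP n} (ε : Path y z) :
    (componentClass v w k y).trans (Path.Homotopic.Quotient.mk (ε.map (continuous_incl k))) =
      componentClass v w k z := by
  unfold componentClass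
  erw [← Path.Homotopic.Quotient.mk_trans, ← Path.map_trans]
  exact Path.Homotopic.Quotient.eq.2
    ((SimplyConnectedSpace.paths_homotopic _ _).map ⟨_, continuous_incl k⟩)

theorem componentClass_self (k : ℤ) : componentClass v w k v = Path.Homotopic.Quotient.refl _ :=
  Path.Homotopic.Quotient.eq.2
    ((SimplyConnectedSpace.paths_homotopic _ (Path.refl v)).map ⟨_, continuous_incl k⟩)

/-- The class of the paths from `[v, k]` to `[v, k + 1]` in the component `X̃_k`. -/
def stepClass (v w : CP n) (k k' : ℤ) (h : k' = k + 1) :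
    Path.Homotopic.Quotient (ChainCP.mk v w (v, k)) (ChainCP.mk v w (v, k')) :=
  (componentClass v w k w).cast rfl (by rw [h, mk_node])

/-- The chain of projective spaces is simply connected: a class of paths from `[v, 0]` to `[z, k]`
is obtained by running through the components between them one after the other. -/
theorem simplyConnectedSpace (hvw : v ≠ w) : SimplyConnectedSpace (ChainCP v w) := by
  obtain ⟨c, hc⟩ := exists_int_section
    (α := fun k => Path.Homotopic.Quotient (ChainCP.mk v w (v, 0)) (ChainCP.mk v w (v, k)))
    (Path.Homotopic.Quotient.refl _) fun k k' h =>
      { toFun := fun P => P.trans (stepClass v w k k' h)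
        invFun := fun P => P.trans (stepClass v w k k' h).symm
        left_inv := fun P => by simp
        right_inv := fun P => by simp }
  let g : ∀ a : CP n × ℤ, Path.Homotopic.Quotient (ChainCP.mk v w (v, 0)) (ChainCP.mk v w a) :=
    fun a => (c a.2).trans (componentClass v w a.2 a.1)
  have hg : ∀ k, g (w, k) = (g (v, k + 1)).cast rfl (mk_node k) := by
    intro k
    change (c k).trans (componentClass v w k w) =
      ((c (k + 1)).trans (componentClass v w (k + 1) v)).cast rfl _
    rw [componentClass_self, hc k (k + 1) rfl]
    change _ = Path.Homotopic.Quotient.cast (((c k).trans (stepClass v w k (k + 1) rfl)).trans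
      (Path.Homotopic.Quotient.refl _)) rfl _
    rw [Path.Homotopic.Quotient.trans_refl, stepClass, trans_cast_right,
      Path.Homotopic.Quotient.cast_cast]
    simp
  let G : ∀ x, Path.Homotopic.Quotient (ChainCP.mk v w (v, 0)) x := fun x =>
    (g (Function.surjInv mk_surjective x)).cast rfl (Function.surjInv_eq mk_surjective x).symm
  have hG : ∀ a, G (ChainCP.mk v w a) = g a := by
    have key : ∀ a b (h : ChainCP.mk v w a = ChainCP.mk v w b), (g b).cast rfl h = g a := by
      intro a b h
      rcases (mk_eq_iff hvw).1 h with rfl | ⟨k, rfl, rfl⟩ | ⟨k, rfl, rfl⟩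
      · simp
      · exact (hg k).symm
      · rw [hg, Path.Homotopic.Quotient.cast_cast]
        simp
    exact fun a => key _ _ _
  -- paths inside a component
  have hcomp : ∀ (k : ℤ) (x y : ChainCP v w) (δ : Path x y), range δ ⊆ range (incl v w k) →
      (G x).trans (Path.Homotopic.Quotient.mk δ) = G y := by
    intro k x y δ hδ
    obtain ⟨a, rfl⟩ := hδ ⟨0, δ.source⟩
    obtain ⟨b, rfl⟩ := hδ ⟨1, δ.target⟩
    let ε : Path a b := (δ.map (continuous_retraction k)).cast
      (retraction_incl k a).symm (retraction_incl k b).symm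
    have hε : δ = ε.map (continuous_incl k) := by
      ext t
      obtain ⟨s, hs⟩ := hδ ⟨t, rfl⟩
      change δ t = incl v w k (retraction v w k (δ t))
      rw [← hs, retraction_incl]
    change (G (ChainCP.mk v w (a, k))).trans _ = G (ChainCP.mk v w (b, k))
    rw [hG, hG, hε]
    exact (Path.Homotopic.Quotient.trans_assoc (c k) (componentClass v w k a) _).trans
      (congrArg _ (componentClass_trans k ε))
  refine simplyConnectedSpace_of_local G fun x => ?_
  rcases exists_rep x with ⟨z, k, hz, rfl⟩ | ⟨k, rfl⟩
  · refine ⟨(interior v w k).target, (interior v w k).open_target.mem_nhds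
      ((interior v w k).map_source (by simpa [interior] using hz)), fun y y' δ hδ => ?_⟩
    refine hcomp k y y' δ (hδ.trans fun a ha => ?_)
    exact ⟨_, (interior v w k).right_inv ha⟩
  · obtain ⟨i, hi⟩ := CP.exists_mem_dom w
    obtain ⟨j, hj⟩ := CP.exists_mem_dom v
    obtain ⟨d, -, -⟩ := exists_nodeData hvw hi hj
    refine ⟨nodeSource d k, (nodeChart d k hvw).open_source.mem_nhds (node_mem_source d k),
      fun y z δ hδ => ?_⟩
    obtain ⟨m, p, hp, hp'⟩ := exists_path_node d k (hδ ⟨0, δ.source⟩)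
    obtain ⟨m', q, hq, hq'⟩ := exists_path_node d k (hδ ⟨1, δ.target⟩)
    have h1 : δ.Homotopic (p.trans q.symm) :=
      homotopic_of_range_subset (isSimplyConnected_nodeSource hvw d k) _ _ hδ (by
        rw [Path.trans_range, Path.symm_range]
        exact union_subset hp hq)
    rw [Path.Homotopic.Quotient.eq.2 h1, Path.Homotopic.Quotient.mk_trans,
      ← Path.Homotopic.Quotient.trans_assoc, hcomp m _ _ p hp']
    exact hcomp m' _ _ q.symm (by rwa [Path.symm_range])

end ChainCP

theorem GluedCP.fundamentalGroup_equiv {n : ℕ} {v w : CP n} (hvw : v ≠ w) (x : GluedCP v w) :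
    Nonempty (FundamentalGroup (GluedCP v w) x ≃* Multiplicative ℤ) := by
  have := ChainCP.simplyConnectedSpace hvw
  obtain ⟨e, he⟩ := ChainCP.proj_surjective x
  exact ⟨((ChainCP.isAddQuotientCoveringMap hvw).fundamentalGroupEquiv ⟨e, he⟩).trans
    MulOpposite.opMulEquiv.symm⟩

/-! ### Potentials of multiples of the Fubini-Study form -/

namespace CP

variable {n : ℕ}

/-- Near `y`, the function `φ` is `a` times a standard potential of the Fubini-Study form, up to
a constant. -/
def IsPotAt (a : ℝ) (y : CP n) (φ : CP n → ℝ) : Prop :=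
  ∃ i, y ∈ dom i ∧ ∃ d, ∀ᶠ y' in 𝓝 y, φ y' = a * pot i y' + d

theorem holAt_affine {i : Fin (n + 1)} {y : CP n} (hy : y ∈ dom i) (l : Fin n) :
    (CP.sheaf n).holAt y fun y' => affine i y' l := by
  have h := (isBihol_chart i 0 y hy fun x => x l).2
    ((ContinuousLinearMap.proj (R := ℂ) (φ := fun _ : Fin n => ℂ) l).analyticAt _)
  refine (CP.sheaf n).congr (Eventually.of_forall fun y' => ?_) h
  change (affine i y' - 0) l = affine i y' l
  rw [sub_zero]

theorem holAt_ratio {i : Fin (n + 1)} {y : CP n} (hy : y ∈ dom i) (j : Fin (n + 1)) :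
    (CP.sheaf n).holAt y fun y' => ratio i y' j := by
  obtain rfl | ⟨l, rfl⟩ := Fin.eq_self_or_eq_succAbove i j
  · have h1 : (CP.sheaf n).holAt y fun _ => 1 := (holAt_iff_chart 0 hy _).2 analyticAt_const
    refine (CP.sheaf n).congr ?_ h1
    filter_upwards [(isOpen_dom j).mem_nhds hy] with y' hy'
    obtain ⟨z, rfl⟩ := mk_surjective y'
    exact (div_self (mk_mem_dom.1 hy')).symm
  · exact holAt_affine hy l

theorem ratio_ne_zero {i j : Fin (n + 1)} {y : CP n} (hi : y ∈ dom i) (hj : y ∈ dom j) :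
    ratio i y j ≠ 0 := by
  obtain ⟨z, rfl⟩ := mk_surjective y
  exact div_ne_zero (mk_mem_dom.1 hj) (mk_mem_dom.1 hi)

theorem contDiffAt_pot {i : Fin (n + 1)} {y : CP n} (hy : y ∈ dom i) {k : ℕ}
    (c : RegularChart (CP.sheaf n) y k) : ContDiffAt ℝ 2 (pot i ∘ c.e.symm) (c.e y) := by
  have h : ContDiffAt ℝ 2 (affine i ∘ c.e.symm) (c.e y) := contDiffAt_pi.2 fun l =>
    (c.analyticAt (holAt_affine hy l)).contDiffAt.restrict_scalars ℝ
  exact (contDiff_infty.1 (contDiff_fsPotential n) 2).contDiffAt.comp _ h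

/-- The Fubini-Study form does not depend on the affine chart. -/
theorem ddbar_pot_eq {i j : Fin (n + 1)} {y : CP n} (hi : y ∈ dom i) (hj : y ∈ dom j) {k : ℕ}
    (c : RegularChart (CP.sheaf n) y k) (ξ η : Fin k → ℂ) :
    ddbar (pot j ∘ c.e.symm) (c.e y) ξ η = ddbar (pot i ∘ c.e.symm) (c.e y) ξ η := by
  have ht : Tendsto c.e.symm (𝓝 (c.e y)) (𝓝 y) := by
    have := c.e.symm.continuousAt (c.e.map_source c.mem_source)
    rwa [ContinuousAt, c.e.left_inv c.mem_source] at this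
  have han := c.analyticAt (holAt_ratio hj i)
  have h0 : ((fun y' => ratio j y' i) ∘ c.e.symm) (c.e y) ≠ 0 := by
    change ratio j (c.e.symm (c.e y)) i ≠ 0
    rw [c.e.left_inv c.mem_source]
    exact ratio_ne_zero hj hi
  have hev : pot j ∘ c.e.symm =ᶠ[𝓝 (c.e y)] fun x => (pot i ∘ c.e.symm) x +
      Real.log (‖((fun y' => ratio j y' i) ∘ c.e.symm) x‖ ^ 2) := by
    filter_upwards [ht.eventually ((isOpen_dom i).mem_nhds hi),
      ht.eventually ((isOpen_dom j).mem_nhds hj)] with x h1 h2 using pot_eq_add h1 h2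
  have hlog : ContDiffAt ℝ 2 (fun x => Real.log (‖((fun y' => ratio j y' i) ∘ c.e.symm) x‖ ^ 2))
      (c.e y) :=
    ((han.contDiffAt.restrict_scalars ℝ).norm_sq ℝ).log (pow_ne_zero _ (norm_ne_zero_iff.2 h0))
  rw [ddbar_congr hev, ddbar_add (contDiffAt_pot hi c) hlog, ddbar_log_normSq han h0, add_zero]

theorem IsPotAt.ddbarEqAt {a b s t : ℝ} {y : CP n} {φ ψ : CP n → ℝ} (hφ : IsPotAt a y φ)
    (hψ : IsPotAt b y ψ) (h : s * a = t * b) : DdbarEqAt (CP.sheaf n) y s φ t ψ := by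
  obtain ⟨i, hi, d, hd⟩ := hφ
  obtain ⟨j, hj, d', hd'⟩ := hψ
  refine DdbarEqAt.congr (φ := fun y => a * pot i y + d) (ψ := fun y => b * pot j y + d') ?_
    (EventuallyEq.symm hd) (EventuallyEq.symm hd')
  intro k c ξ η
  have key : ∀ {i : Fin (n + 1)}, y ∈ dom i → ∀ a d : ℝ,
      ddbar ((fun y => a * pot i y + d) ∘ c.e.symm) (c.e y) ξ η =
        a * ddbar (pot i ∘ c.e.symm) (c.e y) ξ η := fun hi a d =>
    (ddbar_add_const _ d _ ξ η).trans (ddbar_const_mul (contDiffAt_pot hi c) a ξ η)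
  rw [key hi, key hj, ddbar_pot_eq hi hj, ← mul_assoc, ← mul_assoc, h]

/-- The potentials in affine charts define the Fubini-Study form as it is given on
`ℂ^{n+1} ∖ 0`. -/
theorem IsPotAt.eqFSAt {a : ℝ} {z : ({z | z ≠ 0} : Set (Fin (n + 1) → ℂ))} {φ : CP n → ℝ}
    (hφ : IsPotAt a (CP.mk z) φ) : CP.EqFSAt z 1 φ a := by
  obtain ⟨i, hi, d, hd⟩ := hφ
  rw [mk_mem_dom] at hi
  have hopen : IsOpen {z : Fin (n + 1) → ℂ | z ≠ 0} := isOpen_ne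
  have hcoord : AnalyticAt ℂ (fun z : Fin (n + 1) → ℂ => z i) z :=
    (ContinuousLinearMap.proj (R := ℂ) (φ := fun _ : Fin (n + 1) => ℂ) i).analyticAt _
  have hd1 : ∀ᶠ z' : ({z | z ≠ 0} : Set (Fin (n + 1) → ℂ)) in 𝓝 z,
      φ (CP.mk z') = a * pot i (CP.mk z') + d := continuous_mk.continuousAt.eventually hd
  have hd2 : ∀ᶠ z' in 𝓝 (z : Fin (n + 1) → ℂ), ∀ h : z' ≠ 0,
      φ (CP.mk ⟨z', h⟩) = a * pot i (CP.mk ⟨z', h⟩) + d := by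
    rw [← hopen.isOpenEmbedding_subtypeVal.map_nhds_eq z, eventually_map]
    exact hd1.mono fun z' h _ => h
  have hev : CP.lift φ =ᶠ[𝓝 (z : Fin (n + 1) → ℂ)] fun z' =>
      (a * Real.log (∑ l, ‖z' l‖ ^ 2) + (-a) * Real.log (‖z' i‖ ^ 2)) + d := by
    filter_upwards [hd2, hopen.mem_nhds z.2, hcoord.continuousAt.eventually_ne hi] with z' h1 h2 h3
    rw [CP.lift, dif_pos h2, h1 h2, pot_mk h3]
    ring
  have hc1 : ContDiffAt ℝ 2 (fun z' : Fin (n + 1) → ℂ => Real.log (∑ l, ‖z' l‖ ^ 2)) z := by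
    refine ContDiffAt.log ?_ (sum_normSq_pos z.2).ne'
    exact (ContDiff.sum fun l _ => contDiff_infty.1 (contDiff_normSq_coord l) 2).contDiffAt
  have hc2 : ContDiffAt ℝ 2 (fun z' : Fin (n + 1) → ℂ => Real.log (‖z' i‖ ^ 2)) z :=
    ((hcoord.contDiffAt.restrict_scalars ℝ).norm_sq ℝ).log (pow_ne_zero _ (norm_ne_zero_iff.2 hi))
  intro ξ η
  rw [one_mul, ddbar_congr hev, ddbar_add_const,
    ddbar_add (contDiffAt_const.mul hc1) (contDiffAt_const.mul hc2), ddbar_const_mul hc1,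
    ddbar_const_mul hc2, ddbar_log_normSq hcoord hi, mul_zero, add_zero]

end CP

namespace ChainCP

variable {n : ℕ} {v w : CP n}

theorem isSmoothStronglyPshAt_of_isPotAt (hvw : v ≠ w) {φ : ChainCP v w → ℝ} {x : ChainCP v w}
    (h : ∀ z k, ChainCP.mk v w (z, k) = x →
      ∃ a, 0 < a ∧ CP.IsPotAt a z fun y => φ (ChainCP.mk v w (y, k))) :
    IsSmoothStronglyPshAt (ChainCP.sheaf v w) φ x := by
  refine isSmoothStronglyPshAt_of_components hvw fun z k hzk => ?_
  obtain ⟨a, ha, i, hi, d, hd⟩ := h z k hzk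
  have hc := contDiff_fsPotential n
  refine ⟨i, hi, fun x => a * fsPotential n x + d,
    ⟨(contDiff_const.mul hc).add contDiff_const, fun z ξ hξ => ?_⟩, hd⟩
  rw [ddbar_add_const, ddbar_const_mul (contDiff_infty.1 hc 2).contDiffAt]
  exact mul_pos ha (ddbar_fsPotential_pos z ξ hξ)

/-- Proportionality of the forms `i∂∂̄φ` and `i∂∂̄ψ` can be checked on the components, since the
nodes are not regular points. -/
theorem ddbarEqAt_of_isPotAt (hvw : v ≠ w) {φ ψ : ChainCP v w → ℝ} {x : ChainCP v w} {s t : ℝ}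
    (h : ∀ z k, ChainCP.mk v w (z, k) = x → ∃ a b, s * a = t * b ∧
      CP.IsPotAt a z (fun y => φ (ChainCP.mk v w (y, k))) ∧
      CP.IsPotAt b z (fun y => ψ (ChainCP.mk v w (y, k)))) :
    DdbarEqAt (ChainCP.sheaf v w) x s φ t ψ := by
  rcases exists_rep x with ⟨z, k, hz, rfl⟩ | ⟨k, rfl⟩
  · obtain ⟨a, b, hab, h1, h2⟩ := h z k rfl
    exact DdbarEqAt.of_comp (isBihol_interior hvw k) (mem_interior_source.2 hz)
      (h1.ddbarEqAt h2 hab)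
  · intro m c
    exact absurd c.isIrreducibleAt (nodal_not_isIrreducibleAt hvw k)

/-- All local potentials of the form on `X̃` which restricts to `c k • ω_FS` on `X̃_k`. -/
def potFamily (v w : CP n) (c : ℤ → ℝ) : Set (Opens (ChainCP v w) × (ChainCP v w → ℝ)) :=
  {a | ∀ z k, ChainCP.mk v w (z, k) ∈ a.1 →
    CP.IsPotAt (c k) z fun y => a.2 (ChainCP.mk v w (y, k))}

/-- Potentials exist near each point. Near a node, potentials on both branches are
combined to a function `G₁(z) + G₂(t)` of the coordinates. -/
theorem exists_mem_potFamily (hvw : v ≠ w) (c : ℤ → ℝ) (x : ChainCP v w) :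
    ∃ a ∈ potFamily v w c, x ∈ a.1 := by
  rcases exists_rep x with ⟨z, k, hz, rfl⟩ | ⟨k, rfl⟩
  · obtain ⟨i, hi⟩ := CP.exists_mem_dom z
    refine ⟨(⟨(interior v w k).target ∩ retraction v w k ⁻¹' CP.dom i,
      (interior v w k).open_target.inter ((CP.isOpen_dom i).preimage (continuous_retraction k))⟩,
      fun x => c k * CP.pot i (retraction v w k x)), ?_, ?_⟩
    · rintro z' k' ⟨⟨-, hk⟩, hi'⟩
      obtain rfl : k' = k := hk
      have hr : ∀ y, retraction v w k' (ChainCP.mk v w (y, k')) = y := retraction_incl k'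
      rw [mem_preimage, hr] at hi'
      refine ⟨i, hi', 0, Eventually.of_forall fun y => ?_⟩
      rw [add_zero]
      exact congrArg (fun y => c k' * CP.pot i y) (hr y)
    · refine ⟨(interior v w k).map_source (mem_interior_source.2 hz), ?_⟩
      change retraction v w k (incl v w k z) ∈ CP.dom i
      rwa [retraction_incl]
  · obtain ⟨i, hi⟩ := CP.exists_mem_dom w
    obtain ⟨j, hj⟩ := CP.exists_mem_dom v
    obtain ⟨d, rfl, rfl⟩ := exists_nodeData hvw hi hj
    refine ⟨(⟨nodeSource d k, (nodeChart d k hvw).open_source⟩, fun x =>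
      c k * fsPotential n ((nodeFun d k x).1.1 + CP.affine d.i w) +
        c (k + 1) * fsPotential n ((nodeFun d k x).1.2 + CP.affine d.j v)), ?_,
      node_mem_source d k⟩
    rintro z m hm
    rcases (mk_mem_nodeSource d k).1 hm with ⟨rfl, hz⟩ | ⟨rfl, hz⟩
    · refine ⟨d.i, hz.1, c (m + 1) * fsPotential n (0 + CP.affine d.j v), ?_⟩
      filter_upwards [(CP.isOpen_polydisc d.i w d.r).mem_nhds hz] with y hy
      rw [nodeFun_left d m hy]
      simp only [crossLeft, sub_add_cancel]
      rfl
    · refine ⟨d.j, hz.1, c k * fsPotential n (0 + CP.affine d.i w), ?_⟩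
      filter_upwards [(CP.isOpen_polydisc d.j v d.r).mem_nhds hz] with y hy
      rw [nodeFun_right d k hy]
      simp only [crossRight, sub_add_cancel]
      exact add_comm _ _

theorem isKahlerFamily_potFamily (hvw : v ≠ w) {c : ℤ → ℝ} (hc : ∀ k, 0 < c k) :
    IsKahlerFamily (ChainCP.sheaf v w) (potFamily v w c) where
  cover := exists_mem_potFamily hvw c
  spsh := by
    rintro a ha _ hx
    refine isSmoothStronglyPshAt_of_isPotAt hvw ?_
    rintro z k rfl
    exact ⟨c k, hc k, ha z k hx⟩
  compat := by
    rintro a ha b hb _ hx hx'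
    refine ddbarEqAt_of_isPotAt hvw ?_
    rintro z k rfl
    exact ⟨c k, c k, rfl, ha z k hx, hb z k hx'⟩

/-- The Kähler metric on `X̃` which restricts to `c k • ω_FS` on `X̃_k`. -/
def potMetric (hvw : v ≠ w) {c : ℤ → ℝ} (hc : ∀ k, 0 < c k) : KahlerMetric (ChainCP.sheaf v w) :=
  Quotient.mk (kahlerSetoid _) ⟨potFamily v w c, isKahlerFamily_potFamily hvw hc⟩

theorem isRep_potMetric (hvw : v ≠ w) {c : ℤ → ℝ} (hc : ∀ k, 0 < c k) :
    (potMetric hvw hc).IsRep (potFamily v w c) :=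
  ⟨isKahlerFamily_potFamily hvw hc, rfl⟩

theorem restrictsToFS_potMetric (hvw : v ≠ w) {c : ℤ → ℝ} (hc : ∀ k, 0 < c k) :
    RestrictsToFS (potMetric hvw hc) c :=
  ⟨_, isRep_potMetric hvw hc, fun _ ha k z hz => (ha (CP.mk z) k hz).eqFSAt⟩

end ChainCP

/-- A covering subfamily defines the same Kähler metric. -/
theorem KahlerMetric.IsRep.subfamily {X : Type*} [TopologicalSpace X] {O : FunctionSheaf X}
    {ω : KahlerMetric O} {S T : Set (Opens X × (X → ℝ))} (h : ω.IsRep T) (hST : S ⊆ T)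
    (hS : ∀ x, ∃ a ∈ S, x ∈ a.1) : ω.IsRep S := by
  obtain ⟨hT, rfl⟩ := h
  have hS' : IsKahlerFamily O S := ⟨hS, fun a ha => hT.spsh a (hST ha),
    fun a ha b hb => hT.compat a (hST ha) b (hST hb)⟩
  refine ⟨hS', Quotient.sound (?_ : IsKahlerFamily O (T ∪ S))⟩
  rwa [union_eq_self_of_subset_right hST]

/-! ### Metrics on the glued space -/

section LocalBihol

variable {X Y : Type*} [TopologicalSpace X] [TopologicalSpace Y] {O : FunctionSheaf X}
  {O' : FunctionSheaf Y} {p : X → Y}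

theorem IsLocalBihol.isSmoothAt (hp : IsLocalBihol O O' p) {φ : Y → ℝ} {x : X}
    (h : IsSmoothAt O (φ ∘ p) x) : IsSmoothAt O' φ (p x) := by
  obtain ⟨e, hx, he, hb⟩ := hp x
  rw [← he hx]
  refine IsSmoothAt.of_comp hb hx (h.congr ?_)
  filter_upwards [e.open_source.mem_nhds hx] with y hy using congrArg φ (he hy).symm

theorem IsLocalBihol.isSmoothStronglyPshAt (hp : IsLocalBihol O O' p) {φ : Y → ℝ} {x : X}
    (h : IsSmoothStronglyPshAt O (φ ∘ p) x) : IsSmoothStronglyPshAt O' φ (p x) := by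
  obtain ⟨e, hx, he, hb⟩ := hp x
  rw [← he hx]
  refine IsSmoothStronglyPshAt.of_comp hb hx (h.congr ?_)
  filter_upwards [e.open_source.mem_nhds hx] with y hy using congrArg φ (he hy).symm

theorem IsLocalBihol.ddbarEqAt (hp : IsLocalBihol O O' p) {φ ψ : Y → ℝ} {x : X} {a b : ℝ}
    (h : DdbarEqAt O x a (φ ∘ p) b (ψ ∘ p)) : DdbarEqAt O' (p x) a φ b ψ := by
  obtain ⟨e, hx, he, hb⟩ := hp x
  have hev : ∀ φ : Y → ℝ, φ ∘ p =ᶠ[𝓝 x] φ ∘ e := fun φ => by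
    filter_upwards [e.open_source.mem_nhds hx] with y hy using congrArg φ (he hy).symm
  rw [← he hx]
  exact DdbarEqAt.of_comp hb hx (h.congr (hev φ) (hev ψ))

end LocalBihol

namespace GluedCP

variable {n : ℕ} {v w : CP n}

/-- Local sections of the projection `X̃ → X`. -/
theorem exists_localSection (hvw : v ≠ w) (x : ChainCP v w) (U : Opens (ChainCP v w))
    (hx : x ∈ U) : ∃ (V : Opens (GluedCP v w)) (s : GluedCP v w → ChainCP v w),
      ChainCP.proj v w x ∈ V ∧ ∀ z, GluedCP.mk v w z ∈ V → ∃ k, ChainCP.mk v w (z, k) ∈ U ∧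
        ∀ᶠ y in 𝓝 z, s (GluedCP.mk v w y) = ChainCP.mk v w (y, k) := by
  obtain ⟨e, hxe, he, -⟩ := ChainCP.isLocalBihol_proj hvw x
  refine ⟨⟨e.symm.source ∩ e.symm ⁻¹' U, e.symm.isOpen_inter_preimage U.isOpen⟩, e.symm,
    ⟨?_, ?_⟩, ?_⟩
  · rw [← he hxe]
    exact e.map_source hxe
  · rw [mem_preimage, ← he hxe, e.left_inv hxe]
    exact hx
  · rintro z ⟨hz, hzU⟩
    have hs := e.map_target hz
    have h1 : ChainCP.proj v w (ChainCP.mk v w (z, 0)) =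
        ChainCP.proj v w (e.symm (GluedCP.mk v w z)) := by
      rw [← he hs, e.right_inv hz, ChainCP.proj_mk]
    obtain ⟨j, hj⟩ := (ChainCP.proj_eq_iff hvw).1 h1.symm
    rw [ChainCP.vadd_mk] at hj
    rw [mem_preimage, ← hj] at hzU
    rw [← hj] at hs
    refine ⟨_, hzU, ?_⟩
    filter_upwards [(ChainCP.continuous_incl _).continuousAt.preimage_mem_nhds
      (e.open_source.mem_nhds hs)] with y hy
    have h2 := he hy
    change e (ChainCP.mk v w _) = GluedCP.mk v w y at h2
    rw [← h2]
    exact e.left_inv hy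

/-- All local potentials of the form on `X` whose pull-back to `ℙ^n` is `ω_FS`. -/
def potFamily (v w : CP n) : Set (Opens (GluedCP v w) × (GluedCP v w → ℝ)) :=
  {a | ∀ z, GluedCP.mk v w z ∈ a.1 → CP.IsPotAt 1 z fun y => a.2 (GluedCP.mk v w y)}

theorem isKahlerFamily_potFamily (hvw : v ≠ w) :
    IsKahlerFamily (GluedCP.sheaf v w) (potFamily v w) where
  cover x := by
    obtain ⟨y, rfl⟩ := ChainCP.proj_surjective x
    obtain ⟨a, ha, hy⟩ := ChainCP.exists_mem_potFamily hvw (fun _ => 1) y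
    obtain ⟨V, s, hV, hs⟩ := exists_localSection hvw y a.1 hy
    refine ⟨(V, a.2 ∘ s), fun z hz => ?_, hV⟩
    obtain ⟨k, hk, hsk⟩ := hs z hz
    obtain ⟨i, hi, d, hd⟩ := ha z k hk
    refine ⟨i, hi, d, ?_⟩
    filter_upwards [hsk, hd] with y' h1 h2
    rw [Function.comp_apply, h1, h2]
  spsh := by
    rintro a ha x hx
    obtain ⟨y, rfl⟩ := ChainCP.proj_surjective x
    refine (ChainCP.isLocalBihol_proj hvw).isSmoothStronglyPshAt
      (ChainCP.isSmoothStronglyPshAt_of_isPotAt hvw ?_)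
    rintro z k rfl
    exact ⟨1, one_pos, ha z hx⟩
  compat := by
    rintro a ha b hb x hx hx'
    obtain ⟨y, rfl⟩ := ChainCP.proj_surjective x
    refine (ChainCP.isLocalBihol_proj hvw).ddbarEqAt (ChainCP.ddbarEqAt_of_isPotAt hvw ?_)
    rintro z k rfl
    exact ⟨1, 1, rfl, ha z hx, hb z hx'⟩

/-- The Kähler metric on `X` whose pull-back to `ℙ^n` is `ω_FS`. -/
def potMetric (hvw : v ≠ w) : KahlerMetric (GluedCP.sheaf v w) :=
  Quotient.mk (kahlerSetoid _) ⟨potFamily v w, isKahlerFamily_potFamily hvw⟩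

theorem isPullback_potMetric (hvw : v ≠ w) {c : ℤ → ℝ} (hc : ∀ k, 0 < c k) (hc1 : ∀ k, c k = 1) :
    ChainCP.IsPullback (potMetric hvw) (ChainCP.potMetric hvw hc) := by
  refine ⟨potFamily v w, ⟨isKahlerFamily_potFamily hvw, rfl⟩,
    (ChainCP.isRep_potMetric hvw hc).subfamily ?_ fun x => ?_⟩
  · rintro _ ⟨a, ha, rfl⟩ z k hz
    rw [hc1]
    exact ha z hz
  · obtain ⟨a, ha, hx⟩ := (isKahlerFamily_potFamily hvw).cover (ChainCP.proj v w x)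
    exact ⟨_, ⟨a, ha, rfl⟩, hx⟩

/-! ### The locally conformally Kähler metric -/

/-- The triples `(U, φ, f)` on `X` such that the pull-back of `e^f i∂∂̄φ` to `ℙ^n` is `2^{-χ} ω_FS`;
locally `φ` is a potential of some multiple `a • ω_FS`, where `a` may be different on the two
branches at the node. -/
def lcKFamily (v w : CP n) (χ : CP n → ℝ) :
    Set (Opens (GluedCP v w) × (GluedCP v w → ℝ) × (GluedCP v w → ℝ)) :=
  {a | ∀ z, GluedCP.mk v w z ∈ a.1 → ∃ c, 0 < c ∧
    CP.IsPotAt c z (fun y => a.2.1 (GluedCP.mk v w y)) ∧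
    ∀ᶠ y in 𝓝 z, a.2.2 (GluedCP.mk v w y) = -Real.log 2 * χ y - Real.log c}

variable {χ : CP n → ℝ}

/-- The exponent `f = -log 2 * χ - log c` compensates the constant `c` in the potential. Since `f` has
one value at the node, the constants `c_v` and `c_w` on the two branches satisfy `c_v = 2 * c_w`. -/
theorem isLcKFamily_lcKFamily (hv : χ v = 0) (hw : χ w = 1) (hvw : v ≠ w)
    (hχ : ∀ i, ∃ G : (Fin n → ℂ) → ℝ,
      ContDiff ℝ (⊤ : ℕ∞) G ∧ ∀ y ∈ CP.dom i, χ y = G (CP.affine i y)) :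
    IsLcKFamily (GluedCP.sheaf v w) (lcKFamily v w χ) where
  cover x := by
    obtain ⟨y, rfl⟩ := ChainCP.proj_surjective x
    obtain ⟨a, ha, hy⟩ := ChainCP.exists_mem_potFamily hvw (fun k => (2 : ℝ) ^ k) y
    obtain ⟨V, s, hV, hs⟩ := exists_localSection hvw y a.1 hy
    -- the function `-log 2 * height` on `X̃` is used as logarithm of the conformal factor
    refine ⟨(V, a.2 ∘ s, fun x => -Real.log 2 * ChainCP.height χ hv hw (s x)), fun z hz => ?_, hV⟩
    obtain ⟨k, hk, hsk⟩ := hs z hz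
    obtain ⟨i, hi, d, hd⟩ := ha z k hk
    refine ⟨2 ^ k, by positivity, ⟨i, hi, d, ?_⟩, ?_⟩
    · filter_upwards [hsk, hd] with y' h1 h2
      rw [Function.comp_apply, h1, h2]
    · filter_upwards [hsk] with y' h1
      rw [h1, ChainCP.height_mk, Real.log_zpow]
      ring
  spsh := by
    rintro a ha x hx
    obtain ⟨y, rfl⟩ := ChainCP.proj_surjective x
    refine (ChainCP.isLocalBihol_proj hvw).isSmoothStronglyPshAt
      (ChainCP.isSmoothStronglyPshAt_of_isPotAt hvw ?_)
    rintro z k rfl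
    obtain ⟨c, hc, h, -⟩ := ha z hx
    exact ⟨c, hc, h⟩
  smooth := by
    rintro a ha x hx
    obtain ⟨y, rfl⟩ := ChainCP.proj_surjective x
    refine (ChainCP.isLocalBihol_proj hvw).isSmoothAt (ChainCP.isSmoothAt_of_components hvw ?_)
    rintro z k rfl
    obtain ⟨c, hc, -, h⟩ := ha z hx
    obtain ⟨i, hi⟩ := CP.exists_mem_dom z
    obtain ⟨G, hG, hχG⟩ := hχ i
    refine ⟨i, hi, fun x => -Real.log 2 * G x - Real.log c,
      (contDiff_const.mul hG).sub contDiff_const, ?_⟩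
    filter_upwards [h, (CP.isOpen_dom i).mem_nhds hi] with y h1 h2
    rw [← hχG y h2, ← h1]
    rfl
  compat := by
    rintro a ha b hb x hx hx'
    obtain ⟨y, rfl⟩ := ChainCP.proj_surjective x
    refine (ChainCP.isLocalBihol_proj hvw).ddbarEqAt (ChainCP.ddbarEqAt_of_isPotAt hvw ?_)
    rintro z k rfl
    obtain ⟨c, hc, h1, h2⟩ := ha z hx
    obtain ⟨c', hc', h1', h2'⟩ := hb z hx'
    refine ⟨c, c', ?_, h1, h1'⟩
    rw [ChainCP.proj_mk, h2.self_of_nhds, h2'.self_of_nhds, Real.exp_sub, Real.exp_sub,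
      Real.exp_log hc, Real.exp_log hc', div_mul_cancel₀ _ hc.ne', div_mul_cancel₀ _ hc'.ne']
  closed := by
    rintro a ha b hb x ⟨hx, hx'⟩
    refine eventually_of_fiber (isClosedMap_mk hvw) mk_surjective ?_
    rintro z rfl
    obtain ⟨c, -, -, h⟩ := ha z hx
    obtain ⟨c', -, -, h'⟩ := hb z hx'
    filter_upwards [h, h'] with y e e'
    rw [e, e', h.self_of_nhds, h'.self_of_nhds]
    ring

/-- The logarithms `f` of the conformal factors pull back to primitives of `d(-log 2 * height)`. -/
theorem locConstDiffOn_height (hv : χ v = 0) (hw : χ w = 1) (hvw : v ≠ w)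
    {a : Opens (GluedCP v w) × (GluedCP v w → ℝ) × (GluedCP v w → ℝ)} (ha : a ∈ lcKFamily v w χ) :
    LocConstDiffOn (ChainCP.proj v w ⁻¹' a.1) (fun x => -Real.log 2 * ChainCP.height χ hv hw x)
      (a.2.2 ∘ ChainCP.proj v w) := by
  intro x hx
  refine ChainCP.eventually_nhds hvw ?_
  rintro z k rfl
  obtain ⟨c, -, -, h⟩ := ha z hx
  filter_upwards [h] with y hy
  simp only [Function.comp_apply, ChainCP.proj_mk, ChainCP.height_mk]
  rw [hy, h.self_of_nhds]
  ring

end GluedCP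

theorem ChainCP.isSmoothAt_height {n : ℕ} {v w : CP n} (hvw : v ≠ w) {χ : CP n → ℝ} (hv : χ v = 0)
    (hw : χ w = 1) (hχ : ∀ i, ∃ G : (Fin n → ℂ) → ℝ,
      ContDiff ℝ (⊤ : ℕ∞) G ∧ ∀ y ∈ CP.dom i, χ y = G (CP.affine i y)) (x : ChainCP v w) :
    IsSmoothAt (ChainCP.sheaf v w) (fun x => -Real.log 2 * ChainCP.height χ hv hw x) x := by
  refine ChainCP.isSmoothAt_of_components hvw ?_
  rintro z k rfl
  obtain ⟨i, hi⟩ := CP.exists_mem_dom z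
  obtain ⟨G, hG, hχG⟩ := hχ i
  refine ⟨i, hi, fun x => -Real.log 2 * (k + G x),
    contDiff_const.mul (contDiff_const.add hG), ?_⟩
  filter_upwards [(CP.isOpen_dom i).mem_nhds hi] with y h2
  rw [← hχG y h2]
  rfl

namespace GluedCP

variable {n : ℕ} {v w : CP n}

/-- The metric on `X̃` with the weights `2^k` induces an lcK metric on `X`. It is not gcK: the
pull-back of its Lee form to `X̃` is `dF` with `F = -log 2 * height`, and `F` is not invariant under
the shift. -/
theorem exists_lcKMetric (hvw : v ≠ w) {c : ℤ → ℝ} (hc : ∀ k, 0 < c k)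
    (hc2 : ∀ k, c k = 2 ^ k) : ∃ ω : LcKMetric (GluedCP.sheaf v w),
      ChainCP.Induces (ChainCP.potMetric hvw hc) ω ∧ ¬ ω.IsGcK := by
  obtain ⟨χ, -, hv, hw, hχ⟩ := CP.exists_smooth_separating hvw
  have hS := isLcKFamily_lcKFamily hv hw hvw hχ
  refine ⟨Quotient.mk (lcKSetoid _) ⟨_, hS⟩, ⟨_, _, _, ⟨hS, rfl⟩, ChainCP.isRep_potMetric hvw hc,
    ChainCP.isSmoothAt_height hvw hv hw hχ, fun a ha => locConstDiffOn_height hv hw hvw ha, ?_⟩, ?_⟩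
  · rintro a ha b hb x hxb hxa
    refine ChainCP.ddbarEqAt_of_isPotAt hvw ?_
    rintro z k rfl
    obtain ⟨d, hd, h1, h2⟩ := ha z hxa
    refine ⟨d, c k, ?_, h1, hb z k hxb⟩
    have h3 : -Real.log 2 * ((k : ℝ) + χ z) = -Real.log 2 * χ z - Real.log (2 ^ k) := by
      rw [Real.log_zpow]
      ring
    rw [ChainCP.proj_mk, h2.self_of_nhds, ChainCP.height_mk, h3, hc2, Real.exp_sub, Real.exp_sub,
      Real.exp_log hd, Real.exp_log (by positivity), div_mul_cancel₀ _ hd.ne',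
      div_mul_cancel₀ _ (by positivity)]
  · rintro ⟨f, hf, hθ⟩
    have hZ : IsZ1Family (GluedCP v w) (leeFamily (lcKFamily v w χ) ∪ {(⊤, f)}) :=
      Quotient.exact hθ
    let D : ChainCP v w → ℂ := fun x =>
      ((-Real.log 2 * ChainCP.height χ hv hw x : ℝ) : ℂ) - f (ChainCP.proj v w x)
    have hD : IsLocallyConstant D := by
      refine (IsLocallyConstant.iff_eventually_eq D).2 fun x => ?_
      obtain ⟨a, ha, hx⟩ := hS.cover (ChainCP.proj v w x)
      have h1 := hZ.compat _ (Or.inl ⟨a, ha, rfl⟩) _ (Or.inr rfl) (ChainCP.proj v w x) ⟨hx, trivial⟩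
      filter_upwards [(ChainCP.proj v w).continuous.continuousAt.eventually h1,
        locConstDiffOn_height hv hw hvw ha x hx] with y e1 e2
      have e3 := congrArg (fun t : ℝ => (t : ℂ)) e2
      simp only [Function.comp_apply, Complex.ofReal_sub] at e3
      simp only [D]
      linear_combination e1 + e3
    have := ChainCP.connectedSpace (v := v) (w := w)
    let x := ChainCP.mk v w (v, 0)
    have h2 : D ((1 : ℤ) +ᵥ x) = D x := hD.apply_eq_of_preconnectedSpace _ _
    simp only [D] at h2
    rw [ChainCP.proj_vadd, ChainCP.height_vadd, sub_left_inj] at h2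
    have h3 : -Real.log 2 * (ChainCP.height χ hv hw x + (1 : ℤ)) =
      -Real.log 2 * ChainCP.height χ hv hw x := by exact_mod_cast h2
    have h4 := Real.log_pos one_lt_two
    push_cast at h3
    linarith

end GluedCP

end LcKSpace

end

open LcKSpace in
theorem mainTheorem4 (n : ℕ) (v w : CP n) (hvw : v ≠ w) :
    -- `X` is a compact connected complex space of dimension `n`
    (IsComplexSpace (GluedCP.sheaf v w) ∧ CompactSpace (GluedCP v w) ∧
      ConnectedSpace (GluedCP v w) ∧ HasPureDim (GluedCP.sheaf v w) n) ∧
    -- its only singular point is `[v]`, with the stated germ; `X` is not locally irreducible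
    ((∀ x, ¬ IsRegularPt (GluedCP.sheaf v w) x ↔ x = GluedCP.mk v w v) ∧
      GermIso (GluedCP.sheaf v w) (GluedCP.mk v w v) (subSheaf (crossSet n)) (crossOrigin n) ∧
      ¬ IsIrreducibleAt (GluedCP.sheaf v w) (GluedCP.mk v w v) ∧
      ¬ IsLocallyIrreducible (GluedCP.sheaf v w)) ∧
    -- the fundamental group
    (∀ x : GluedCP v w, Nonempty (FundamentalGroup (GluedCP v w) x ≃* Multiplicative ℤ)) ∧
    -- the universal covering and its deck transformations
    (IsComplexSpace (ChainCP.sheaf v w) ∧ SimplyConnectedSpace (ChainCP v w) ∧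
      IsCoveringMap (ChainCP.proj v w) ∧
      IsLocalBihol (ChainCP.sheaf v w) (GluedCP.sheaf v w) (ChainCP.proj v w) ∧
      ∀ h : ChainCP v w ≃ₜ ChainCP v w,
        (∀ y, ChainCP.proj v w (h y) = ChainCP.proj v w y) ↔
          h ∈ Subgroup.zpowers (ChainCP.shift v w)) ∧
    -- the metrics
    (∃ ω₁ ω₂ : KahlerMetric (ChainCP.sheaf v w),
      ChainCP.RestrictsToFS ω₁ (fun _ => 1) ∧ ChainCP.RestrictsToFS ω₂ (fun k => (2 : ℝ) ^ k) ∧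
      (∃ ω : KahlerMetric (GluedCP.sheaf v w), ChainCP.IsPullback ω ω₁) ∧
      ∃ ω : LcKMetric (GluedCP.sheaf v w), ChainCP.Induces ω₂ ω ∧ ¬ ω.IsGcK) ∧
    -- local irreducibility cannot be dropped in the Vaisman theorem
    ¬ VaismanWithoutIrreducibility n := by
  have hX := And.intro (GluedCP.isComplexSpace hvw) (GluedCP.hasPureDim hvw)
  have hconn : ConnectedSpace (GluedCP v w) := inferInstance
  have h1 : ∀ _ : ℤ, (0 : ℝ) < 1 := fun _ => one_pos
  have h2 : ∀ k : ℤ, (0 : ℝ) < 2 ^ k := fun k => by positivity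
  obtain ⟨ω, hω, hω'⟩ := GluedCP.exists_lcKMetric hvw h2 fun _ => rfl
  have hirr := GluedCP.not_isIrreducibleAt_node hvw
  refine ⟨⟨hX.1, inferInstance, hconn, hX.2⟩,
    ⟨GluedCP.not_isRegularPt_iff hvw, GluedCP.germIso_cross hvw, hirr, fun h => hirr (h _)⟩,
    GluedCP.fundamentalGroup_equiv hvw,
    ⟨ChainCP.isComplexSpace hvw, ChainCP.simplyConnectedSpace hvw, ChainCP.isCoveringMap_proj hvw,
      ChainCP.isLocalBihol_proj hvw, ChainCP.deck_iff hvw⟩,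
    ⟨ChainCP.potMetric hvw h1, ChainCP.potMetric hvw h2, ChainCP.restrictsToFS_potMetric hvw h1,
      ChainCP.restrictsToFS_potMetric hvw h2,
      ⟨GluedCP.potMetric hvw, GluedCP.isPullback_potMetric hvw h1 fun _ => rfl⟩, ω, hω, hω'⟩, ?_⟩
  intro hV
  exact hω' (hV (GluedCP v w) (GluedCP.sheaf v w) hX.1 inferInstance hconn hX.2
    ⟨GluedCP.potMetric hvw⟩ ω)
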